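/- Let $\Gamma\subseteq\mathbb{N}^2$ be a finite set for which there are integers $m,n\ge 1$ such that $(m,0),(0,n)\in\Gamma$ and $n\alpha+m\beta=nm$ for every $(\alpha,\beta)\in\Gamma$, and let $$\varphi(z,w)=\varphi_\Gamma(z,w)=\sum_{(\alpha,\beta)\in\Gamma}|z^\alpha w^\beta|^2,\qquad (z,w)\in\mathbb{C}^2,$$ be the associated homogeneous model monomial weight. Let $\sigma,\tau\ge 0$ be the smallest non-negative real numbers such that $\alpha\le\sigma\beta$ and $\beta\le\tau\alpha$ for all $(\alpha,\beta)\in\Gamma$ with $\alpha\neq0\neq\beta$ (so $\sigma=\tau=0$ if there are no such points). Let $L^2(\mathbb{C}^2,\varphi)$ be the space of functions $f$ with $\|f\|_\varphi^2=\int_{\mathbb{C}^2}|f|^2e^{-2\varphi}<\infty$ (with respect to Lebesgue measure), and let $L^2_{(0,q)}(\mathbb{C}^2,\varphi)$ be the Hilbert space of $(0,q)$-forms with coefficients in $L^2(\mathbb{C}^2,\varphi)$, where $\|u_1d\bar z+u_2d\bar w\|_\varphi^2=\|u_1\|_\varphi^2+\|u_2\|_\varphi^2$ and $\|g\,d\bar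 z\wedge d\bar w\|_\varphi=\|g\|_\varphi$. Let $$\bar\partial f=\frac{\partial f}{\partial\bar z}d\bar z+\frac{\partial f}{\partial\bar w}d\bar w,\qquad \bar\partial(u_1d\bar z+u_2d\bar w)=\Big(\frac{\partial u_2}{\partial\bar z}-\frac{\partial u_1}{\partial\bar w}\Big)d\bar z\wedge d\bar w$$ be the operators $L^2(\mathbb{C}^2,\varphi)\to L^2_{(0,1)}(\mathbb{C}^2,\varphi)\to L^2_{(0,2)}(\mathbb{C}^2,\varphi)$ taken in the sense of distributions, each with its maximal domain (all elements of $L^2_{(0,q)}(\mathbb{C}^2,\varphi)$ whose image has coefficients in $L^2(\mathbb{C}^2,\varphi)$), and let $\bar\partial^*_\varphi$ be the Hilbert space adjoint of the first one. For every $(0,1)$-form $u$ in the form domain $\mathcal{D}(\mathcal{E}_\varphi)=\mathrm{dom}(\bar\partial)\cap\mathrm{dom}(\bar\partial^*_\varphi)$ put $$\mathcal{E}_\varphi(u)=\|\bar\partial u\|_\varphi^2+\|\bar\partial^*_\varphi u\|_\varphi^2,$$ the quadratic form of the weighted Kohn Laplacian $\Box_\varphi=\bar\partial^*_\varphi\bar\partial+\bar\partial\bar\partial^*_\varphi$.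 Then there is a constant $c>0$, depending on $\Gamma$, such that $\Box_{\varphi}$ is $\mu$-coercive with $\mu(z,w)=c\,(1+|z|^\sigma+|w|^\tau)$, that is, $$\mathcal{E}_\varphi(u)\ \ge\ \|\mu u\|_\varphi^2=\int_{\mathbb{C}^2}\mu^2\,(|u_1|^2+|u_2|^2)\,e^{-2\varphi}\qquad\text{for all } u=u_1d\bar z+u_2d\bar w\in\mathcal{D}(\mathcal{E}_\varphi).$$ (Here $x^0=1$ for all $x\ge 0$.) -/

import Mathlib

open MeasureTheory
open scoped ENNReal NNReal ContDiff LinearPMap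

noncomputable section

namespace WeightedKohn

/-! ### Wirtinger derivatives and test functions on `ℂ²` (coordinates `z`, `w`) -/

/-- `∂ψ/∂z̄ = (∂ψ/∂x + i ∂ψ/∂y) / 2` for `z = x + i y`. -/
def dzbar (ψ : ℂ × ℂ → ℂ) (p : ℂ × ℂ) : ℂ :=
  (1 / 2 : ℂ) * (fderiv ℝ ψ p (1, 0) + Complex.I * fderiv ℝ ψ p (Complex.I, 0))

/-- `∂ψ/∂w̄ = (∂ψ/∂s + i ∂ψ/∂t) / 2` for `w = s + i t`. -/
def dwbar (ψ : ℂ × ℂ → ℂ) (p : ℂ × ℂ) : ℂ :=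
  (1 / 2 : ℂ) * (fderiv ℝ ψ p (0, 1) + Complex.I * fderiv ℝ ψ p (0, Complex.I))

/-- Complex-valued `C_c^∞` functions on `ℂ²`. -/
def IsTest (ψ : ℂ × ℂ → ℂ) : Prop := ContDiff ℝ ∞ ψ ∧ HasCompactSupport ψ

/-! ### Weighted `L²` spaces of `(0,q)`-forms -/

/-- The measure `e^{-2φ} dℒ` on `ℂ²`. -/
def weightMeasure (φ : C(ℂ × ℂ, ℝ)) : Measure (ℂ × ℂ) :=
  (volume : Measure (ℂ × ℂ)).withDensity fun p => ENNReal.ofReal (Real.exp (-2 * φ p))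

/-- `L²(ℂ², φ)`, that is, functions with `∫ |f|² e^{-2φ} < ∞` modulo a.e. equality.
It also serves as `L²_{(0,2)}(ℂ², φ)`: a `(0,2)`-form on `ℂ²` is `g dz̄ ∧ dw̄`. -/
abbrev L2 (φ : C(ℂ × ℂ, ℝ)) := Lp ℂ 2 (weightMeasure φ)

/-- `L²_{(0,1)}(ℂ², φ)`: the form `u 0 dz̄ + u 1 dw̄`, with `‖u‖² = ‖u 0‖² + ‖u 1‖²`. -/
abbrev L2Form (φ : C(ℂ × ℂ, ℝ)) := PiLp 2 fun _ : Fin 2 => L2 φ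

/-! ### Basic facts needed for the operators to be well defined -/

instance weightMeasure_isLocallyFinite (φ : C(ℂ × ℂ, ℝ)) :
    IsLocallyFiniteMeasure (weightMeasure φ) :=
  IsLocallyFiniteMeasure.withDensity_ofReal (by fun_prop)

theorem volume_ac_weightMeasure (φ : C(ℂ × ℂ, ℝ)) :
    (volume : Measure (ℂ × ℂ)) ≪ weightMeasure φ := by
  refine withDensity_absolutelyContinuous' (by fun_prop) (Filter.Eventually.of_forall fun p => ?_)
  simpa using Real.exp_pos _

theorem weightMeasure_ac_volume (φ : C(ℂ × ℂ, ℝ)) :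
    weightMeasure φ ≪ (volume : Measure (ℂ × ℂ)) :=
  withDensity_absolutelyContinuous _ _

theorem locallyIntegrable_L2 {φ : C(ℂ × ℂ, ℝ)} (f : L2 φ) :
    LocallyIntegrable (f : ℂ × ℂ → ℂ) volume := by
  have h1 : LocallyIntegrable (f : ℂ × ℂ → ℂ) (weightMeasure φ) :=
    (Lp.memLp f).locallyIntegrable one_le_two
  have h2 : LocallyIntegrable (fun p => Real.exp (-2 * φ p) • (f : ℂ × ℂ → ℂ) p) volume := by
    rw [locallyIntegrable_iff] at h1 ⊢
    intro K hK
    have h3 := h1 K hK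
    unfold IntegrableOn weightMeasure at h3
    unfold IntegrableOn
    rw [restrict_withDensity hK.measurableSet,
      integrable_withDensity_iff_integrable_smul' (by fun_prop) (by simp)] at h3
    simp only [ENNReal.toReal_ofReal (Real.exp_pos _).le] at h3
    exact h3
  have h4 := h2.continuous_smul (g := fun p => Real.exp (2 * φ p)) (by fun_prop)
  refine h4.congr (Filter.Eventually.of_forall fun p => ?_)
  simp only [smul_smul, ← Real.exp_add]
  simp

theorem IsTest.continuous_dzbar {ψ : ℂ × ℂ → ℂ} (h : IsTest ψ) : Continuous (dzbar ψ) := by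
  have := h.1.continuous_fderiv (by simp)
  unfold dzbar
  fun_prop

theorem IsTest.continuous_dwbar {ψ : ℂ × ℂ → ℂ} (h : IsTest ψ) : Continuous (dwbar ψ) := by
  have := h.1.continuous_fderiv (by simp)
  unfold dwbar
  fun_prop

theorem IsTest.hasCompactSupport_dzbar {ψ : ℂ × ℂ → ℂ} (h : IsTest ψ) :
    HasCompactSupport (dzbar ψ) := by
  refine (h.2.fderiv (𝕜 := ℝ)).mono fun p hp hp' => hp ?_
  simp [dzbar, hp']

theorem IsTest.hasCompactSupport_dwbar {ψ : ℂ × ℂ → ℂ} (h : IsTest ψ) :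
    HasCompactSupport (dwbar ψ) := by
  refine (h.2.fderiv (𝕜 := ℝ)).mono fun p hp hp' => hp ?_
  simp [dwbar, hp']

/-- The pairing `∫ f χ dℒ`, well defined for `f ∈ L²(ℂ², φ)` and `χ` continuous with compact
support. -/
def pair {φ : C(ℂ × ℂ, ℝ)} (f : L2 φ) (χ : ℂ × ℂ → ℂ) : ℂ := ∫ p, f p * χ p

theorem integrable_pair {φ : C(ℂ × ℂ, ℝ)} (f : L2 φ) {χ : ℂ × ℂ → ℂ} (h : Continuous χ)
    (h' : HasCompactSupport χ) : Integrable (fun p => f p * χ p) volume :=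
  (locallyIntegrable_L2 f).integrable_smul_right_of_hasCompactSupport h h'

theorem pair_zero {φ : C(ℂ × ℂ, ℝ)} (χ : ℂ × ℂ → ℂ) : pair (0 : L2 φ) χ = 0 := by
  unfold pair
  rw [integral_eq_zero_of_ae]
  filter_upwards [(volume_ac_weightMeasure φ).ae_le (Lp.coeFn_zero ℂ 2 (weightMeasure φ))]
    with p hp
  rw [hp]
  simp

theorem pair_add {φ : C(ℂ × ℂ, ℝ)} (f g : L2 φ) {χ : ℂ × ℂ → ℂ} (h : Continuous χ)
    (h' : HasCompactSupport χ) : pair (f + g) χ = pair f χ + pair g χ := by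
  unfold pair
  rw [← integral_add (integrable_pair f h h') (integrable_pair g h h')]
  refine integral_congr_ae ?_
  filter_upwards [(volume_ac_weightMeasure φ).ae_le (Lp.coeFn_add f g)] with p hp
  rw [hp, Pi.add_apply, add_mul]

theorem pair_smul {φ : C(ℂ × ℂ, ℝ)} (c : ℂ) (f : L2 φ) (χ : ℂ × ℂ → ℂ) :
    pair (c • f) χ = c * pair f χ := by
  unfold pair
  rw [← integral_const_mul]
  refine integral_congr_ae ?_
  filter_upwards [(volume_ac_weightMeasure φ).ae_le (Lp.coeFn_smul c f)] with p hp
  rw [hp, Pi.smul_apply, smul_eq_mul, mul_assoc]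

theorem eq_zero_of_pair_eq_zero {φ : C(ℂ × ℂ, ℝ)} (f : L2 φ)
    (h : ∀ ψ, IsTest ψ → pair f ψ = 0) : f = 0 := by
  have key : ∀ᵐ p ∂(volume : Measure (ℂ × ℂ)), (f : ℂ × ℂ → ℂ) p = 0 := by
    refine ae_eq_zero_of_integral_contDiff_smul_eq_zero (locallyIntegrable_L2 f)
      fun g hg hg' => ?_
    have := h (fun p => (g p : ℂ)) ⟨Complex.ofRealCLM.contDiff.comp hg,
      hg'.comp_left (g := fun x : ℝ => (x : ℂ)) Complex.ofReal_zero⟩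
    simpa [pair, mul_comm] using this
  exact (Lp.eq_zero_iff_ae_eq_zero).2 ((weightMeasure_ac_volume φ).ae_le key)

/-! ### The weighted `∂̄`-complex -/

/-- Graph of `∂̄ : L²(ℂ², φ) → L²_{(0,1)}(ℂ², φ)`: the pairs `(f, u)` with `∂f/∂z̄ = u 0` and
`∂f/∂w̄ = u 1` in the sense of distributions. -/
def dbar0Graph (φ : C(ℂ × ℂ, ℝ)) : Submodule ℂ (L2 φ × L2Form φ) where
  carrier := {q | ∀ ψ, IsTest ψ →
    pair q.1 (dzbar ψ) = -pair (q.2 0) ψ ∧ pair q.1 (dwbar ψ) = -pair (q.2 1) ψ}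
  zero_mem' ψ _ := by simp [pair_zero]
  add_mem' {a b} ha hb ψ hψ := by
    obtain ⟨h1, h2⟩ := ha ψ hψ
    obtain ⟨h3, h4⟩ := hb ψ hψ
    have c := hψ.1.continuous
    simp only [Prod.fst_add, Prod.snd_add, PiLp.add_apply,
      pair_add _ _ hψ.continuous_dzbar hψ.hasCompactSupport_dzbar,
      pair_add _ _ hψ.continuous_dwbar hψ.hasCompactSupport_dwbar, pair_add _ _ c hψ.2,
      h1, h2, h3, h4]
    constructor <;> ring
  smul_mem' c a ha ψ hψ := by
    obtain ⟨h1, h2⟩ := ha ψ hψ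
    simp [pair_smul, h1, h2]

/-- Graph of `∂̄ : L²_{(0,1)}(ℂ², φ) → L²_{(0,2)}(ℂ², φ)`: the pairs `(u, g)` with
`∂(u 1)/∂z̄ - ∂(u 0)/∂w̄ = g` in the sense of distributions. -/
def dbar1Graph (φ : C(ℂ × ℂ, ℝ)) : Submodule ℂ (L2Form φ × L2 φ) where
  carrier := {q | ∀ ψ, IsTest ψ →
    pair (q.1 1) (dzbar ψ) - pair (q.1 0) (dwbar ψ) = -pair q.2 ψ}
  zero_mem' ψ _ := by simp [pair_zero]
  add_mem' {a b} ha hb ψ hψ := by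
    have h1 := ha ψ hψ
    have h2 := hb ψ hψ
    have c := hψ.1.continuous
    simp only [Prod.fst_add, Prod.snd_add, PiLp.add_apply,
      pair_add _ _ hψ.continuous_dzbar hψ.hasCompactSupport_dzbar,
      pair_add _ _ hψ.continuous_dwbar hψ.hasCompactSupport_dwbar, pair_add _ _ c hψ.2]
    linear_combination h1 + h2
  smul_mem' c a ha ψ hψ := by
    have h1 := ha ψ hψ
    simp only [Prod.smul_fst, Prod.smul_snd, PiLp.smul_apply, pair_smul]
    linear_combination c * h1

/-- `∂̄ : L²(ℂ², φ) → L²_{(0,1)}(ℂ², φ)`, with domain the `f ∈ L²(ℂ², φ)` whose distributional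
derivatives `∂f/∂z̄`, `∂f/∂w̄` lie in `L²(ℂ², φ)`. -/
def dbar0 (φ : C(ℂ × ℂ, ℝ)) : L2 φ →ₗ.[ℂ] L2Form φ := (dbar0Graph φ).toLinearPMap

/-- `∂̄ : L²_{(0,1)}(ℂ², φ) → L²_{(0,2)}(ℂ², φ)`, with domain the `u` for which the distribution
`∂(u 1)/∂z̄ - ∂(u 0)/∂w̄` lies in `L²(ℂ², φ)`. -/
def dbar1 (φ : C(ℂ × ℂ, ℝ)) : L2Form φ →ₗ.[ℂ] L2 φ := (dbar1Graph φ).toLinearPMap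

theorem dbar0_graph (φ : C(ℂ × ℂ, ℝ)) : (dbar0 φ).graph = dbar0Graph φ := by
  refine Submodule.toLinearPMap_graph_eq _ fun q hq hq0 => ?_
  have h0 : q.2 0 = 0 := eq_zero_of_pair_eq_zero _ fun ψ hψ => by
    have := (hq ψ hψ).1
    rw [hq0, pair_zero] at this
    simpa using this.symm
  have h1 : q.2 1 = 0 := eq_zero_of_pair_eq_zero _ fun ψ hψ => by
    have := (hq ψ hψ).2
    rw [hq0, pair_zero] at this
    simpa using this.symm
  ext1 j
  fin_cases j
  · exact h0
  · exact h1

theorem dbar1_graph (φ : C(ℂ × ℂ, ℝ)) : (dbar1 φ).graph = dbar1Graph φ := by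
  refine Submodule.toLinearPMap_graph_eq _ fun q hq hq0 => ?_
  refine eq_zero_of_pair_eq_zero _ fun ψ hψ => ?_
  have := hq ψ hψ
  rw [hq0] at this
  simpa [pair_zero] using this.symm

theorem integral_mul_fderiv_test {g ψ : ℂ × ℂ → ℂ} (hg : IsTest g) (hψ : IsTest ψ) (v : ℂ × ℂ) :
    Integrable (fun p => g p * fderiv ℝ ψ p v) ∧ Integrable (fun p => fderiv ℝ g p v * ψ p) ∧
    ∫ p, g p * fderiv ℝ ψ p v = -∫ p, fderiv ℝ g p v * ψ p := by
  have cg := hg.1.continuous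
  have cψ := hψ.1.continuous
  have dg := hg.1.continuous_fderiv (by simp)
  have dψ := hψ.1.continuous_fderiv (by simp)
  have i1 : Integrable (fun p => g p * fderiv ℝ ψ p v) :=
    Continuous.integrable_of_hasCompactSupport (by fun_prop) hg.2.mul_right
  have i2 : Integrable (fun p => fderiv ℝ g p v * ψ p) :=
    Continuous.integrable_of_hasCompactSupport (by fun_prop) hψ.2.mul_left
  have i3 : Integrable (fun p => g p * ψ p) :=
    Continuous.integrable_of_hasCompactSupport (by fun_prop) hg.2.mul_right
  have : (volume : Measure (ℂ × ℂ)).IsAddHaarMeasure :=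
    inferInstanceAs (((volume : Measure ℂ).prod (volume : Measure ℂ)).IsAddHaarMeasure)
  exact ⟨i1, i2, integral_mul_fderiv_eq_neg_fderiv_mul_of_integrable i2 i1 i3
    (fun p _ => (hg.1.differentiable (by simp)) p) (fun p _ => (hψ.1.differentiable (by simp)) p)⟩

theorem integral_mul_dzbar {g ψ : ℂ × ℂ → ℂ} (hg : IsTest g) (hψ : IsTest ψ) :
    ∫ p, g p * dzbar ψ p = -∫ p, dzbar g p * ψ p := by
  obtain ⟨a1, a2, a3⟩ := integral_mul_fderiv_test hg hψ (1, 0)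
  obtain ⟨b1, b2, b3⟩ := integral_mul_fderiv_test hg hψ (Complex.I, 0)
  have e1 : ∀ p, g p * dzbar ψ p = (1 / 2 : ℂ) * (g p * fderiv ℝ ψ p (1, 0)) +
    (1 / 2 * Complex.I) * (g p * fderiv ℝ ψ p (Complex.I, 0)) := fun p => by unfold dzbar; ring
  have e2 : ∀ p, dzbar g p * ψ p = (1 / 2 : ℂ) * (fderiv ℝ g p (1, 0) * ψ p) +
    (1 / 2 * Complex.I) * (fderiv ℝ g p (Complex.I, 0) * ψ p) := fun p => by unfold dzbar; ring
  simp only [e1, e2]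
  rw [integral_add (a1.const_mul _) (b1.const_mul _), integral_add (a2.const_mul _)
    (b2.const_mul _)]
  simp only [integral_const_mul, a3, b3]
  ring

theorem integral_mul_dwbar {g ψ : ℂ × ℂ → ℂ} (hg : IsTest g) (hψ : IsTest ψ) :
    ∫ p, g p * dwbar ψ p = -∫ p, dwbar g p * ψ p := by
  obtain ⟨a1, a2, a3⟩ := integral_mul_fderiv_test hg hψ (0, 1)
  obtain ⟨b1, b2, b3⟩ := integral_mul_fderiv_test hg hψ (0, Complex.I)
  have e1 : ∀ p, g p * dwbar ψ p = (1 / 2 : ℂ) * (g p * fderiv ℝ ψ p (0, 1)) +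
    (1 / 2 * Complex.I) * (g p * fderiv ℝ ψ p (0, Complex.I)) := fun p => by unfold dwbar; ring
  have e2 : ∀ p, dwbar g p * ψ p = (1 / 2 : ℂ) * (fderiv ℝ g p (0, 1) * ψ p) +
    (1 / 2 * Complex.I) * (fderiv ℝ g p (0, Complex.I) * ψ p) := fun p => by unfold dwbar; ring
  simp only [e1, e2]
  rw [integral_add (a1.const_mul _) (b1.const_mul _), integral_add (a2.const_mul _)
    (b2.const_mul _)]
  simp only [integral_const_mul, a3, b3]
  ring

/-- `∂̄` is densely defined on `L²(ℂ², φ)`, so that its Hilbert space adjoint exists. -/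
theorem dbar0_dense (φ : C(ℂ × ℂ, ℝ)) : Dense ((dbar0 φ).domain : Set (L2 φ)) := by
  refine (Lp.dense_hasCompactSupport_contDiff (F := ℂ) (μ := weightMeasure φ) (p := 2)
    (by simp)).mono ?_
  rintro f ⟨g, hfg, hgc, hgs⟩
  have hg : IsTest g := ⟨hgs, hgc⟩
  have m0 : MemLp (dzbar g) 2 (weightMeasure φ) :=
    hg.continuous_dzbar.memLp_of_hasCompactSupport hg.hasCompactSupport_dzbar
  have m1 : MemLp (dwbar g) 2 (weightMeasure φ) :=
    hg.continuous_dwbar.memLp_of_hasCompactSupport hg.hasCompactSupport_dwbar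
  have pf : ∀ χ, pair f χ = ∫ p, g p * χ p := fun χ => by
    refine integral_congr_ae ?_
    filter_upwards [(volume_ac_weightMeasure φ).ae_le hfg] with p hp
    rw [hp]
  have p0 : ∀ χ, pair (m0.toLp : L2 φ) χ = ∫ p, dzbar g p * χ p := fun χ => by
    refine integral_congr_ae ?_
    filter_upwards [(volume_ac_weightMeasure φ).ae_le m0.coeFn_toLp] with p hp
    rw [hp]
  have p1 : ∀ χ, pair (m1.toLp : L2 φ) χ = ∫ p, dwbar g p * χ p := fun χ => by
    refine integral_congr_ae ?_
    filter_upwards [(volume_ac_weightMeasure φ).ae_le m1.coeFn_toLp] with p hp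
    rw [hp]
  refine ⟨(f, WithLp.toLp 2 ![m0.toLp, m1.toLp]), fun ψ hψ => ?_, rfl⟩
  simp only [Matrix.cons_val_zero, Matrix.cons_val_one, pf, p0, p1]
  exact ⟨integral_mul_dzbar hg hψ, integral_mul_dwbar hg hψ⟩

/-- `∂̄*_φ : L²_{(0,1)}(ℂ², φ) → L²(ℂ², φ)`, the Hilbert space adjoint of `dbar0 φ`. -/
def dbarStar (φ : C(ℂ × ℂ, ℝ)) : L2Form φ →ₗ.[ℂ] L2 φ := (dbar0 φ)†

/-! ### The energy form and `μ`-coercivity -/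

/-- The form domain `𝒟(ℰ_φ) = 𝒟₁(∂̄) ∩ 𝒟₁(∂̄*_φ)`. -/
def energyDomain (φ : C(ℂ × ℂ, ℝ)) : Submodule ℂ (L2Form φ) :=
  (dbar1 φ).domain ⊓ (dbarStar φ).domain

/-- The energy `ℰ_φ(u) = ‖∂̄u‖²_φ + ‖∂̄*_φ u‖²_φ`, the quadratic form of the weighted Kohn
Laplacian `□_φ = ∂̄*_φ ∂̄ + ∂̄ ∂̄*_φ`. -/
def energy (φ : C(ℂ × ℂ, ℝ)) (u : energyDomain φ) : ℝ :=
  ‖dbar1 φ ⟨u, u.2.1⟩‖ ^ 2 + ‖dbarStar φ ⟨u, u.2.2⟩‖ ^ 2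

/-- `‖μ u‖²_φ = ∫ μ² (|u 0|² + |u 1|²) e^{-2φ}`, possibly infinite. -/
def mulNormSq (φ : C(ℂ × ℂ, ℝ)) (μ : ℂ × ℂ → ℝ) (u : L2Form φ) : ℝ≥0∞ :=
  ∫⁻ p, ENNReal.ofReal (μ p ^ 2 * (‖u 0 p‖ ^ 2 + ‖u 1 p‖ ^ 2)) ∂(weightMeasure φ)

/-- `□_φ` is `μ`-coercive: `ℰ_φ(u) ≥ ‖μ u‖²_φ` for every `u` in the form domain (in particular the
right-hand side is finite). -/
def IsCoercive (φ : C(ℂ × ℂ, ℝ)) (μ : ℂ × ℂ → ℝ) : Prop :=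
  ∀ u : energyDomain φ, mulNormSq φ μ u ≤ ENNReal.ofReal (energy φ u)

/-! ### Model monomial weights -/

/-- `φ_Γ(z,w) = ∑_{(α,β) ∈ Γ} |z^α w^β|²`. -/
def modelWeight (Γ : Finset (ℕ × ℕ)) : C(ℂ × ℂ, ℝ) where
  toFun p := ∑ a ∈ Γ, ‖p.1 ^ a.1 * p.2 ^ a.2‖ ^ 2

/-- `Γ` contains `(m,0)` and `(0,n)`, for some `m, n ≥ 1`, and lies on the segment between them. -/
def IsHomogeneous (Γ : Finset (ℕ × ℕ)) : Prop :=
  ∃ m n : ℕ, 1 ≤ m ∧ 1 ≤ n ∧ (m, 0) ∈ Γ ∧ (0, n) ∈ Γ ∧ ∀ a ∈ Γ, n * a.1 + m * a.2 = n * m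

/-- The points `(α,β) ∈ Γ` with `α, β ≠ 0`. -/
def mixed (Γ : Finset (ℕ × ℕ)) : Finset (ℕ × ℕ) := Γ.filter fun a => a.1 ≠ 0 ∧ a.2 ≠ 0

/-- `σ`: the least `s ≥ 0` with `α / β ≤ s` for all mixed points; `0` if there are none. -/
def sigma (Γ : Finset (ℕ × ℕ)) : ℝ≥0 := (mixed Γ).sup fun a => (a.1 : ℝ≥0) / a.2

/-- `τ`: the least `t ≥ 0` with `β / α ≤ t` for all mixed points; `0` if there are none. -/
def tau (Γ : Finset (ℕ × ℕ)) : ℝ≥0 := (mixed Γ).sup fun a => (a.2 : ℝ≥0) / a.1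

theorem isLeast_sup_mixed (Γ : Finset (ℕ × ℕ)) (r : ℕ × ℕ → ℝ≥0) :
    IsLeast {s : ℝ | 0 ≤ s ∧ ∀ a ∈ Γ, a.1 ≠ 0 → a.2 ≠ 0 → (r a : ℝ) ≤ s}
      ((mixed Γ).sup r : ℝ≥0) := by
  refine ⟨⟨NNReal.coe_nonneg _, fun a ha h1 h2 => ?_⟩, fun s hs => ?_⟩
  · exact NNReal.coe_le_coe.2 (Finset.le_sup (f := r) (Finset.mem_filter.2 ⟨ha, h1, h2⟩))
  · lift s to ℝ≥0 using hs.1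
    refine NNReal.coe_le_coe.2 (Finset.sup_le fun a ha => ?_)
    obtain ⟨h, h1, h2⟩ := Finset.mem_filter.1 ha
    exact NNReal.coe_le_coe.1 (hs.2 a h h1 h2)

theorem isLeast_sigma (Γ : Finset (ℕ × ℕ)) :
    IsLeast {s : ℝ | 0 ≤ s ∧ ∀ a ∈ Γ, a.1 ≠ 0 → a.2 ≠ 0 → (a.1 : ℝ) / a.2 ≤ s} (sigma Γ) := by
  simpa [sigma, tau] using isLeast_sup_mixed Γ fun a => (a.1 : ℝ≥0) / a.2

theorem isLeast_tau (Γ : Finset (ℕ × ℕ)) :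
    IsLeast {t : ℝ | 0 ≤ t ∧ ∀ a ∈ Γ, a.1 ≠ 0 → a.2 ≠ 0 → (a.2 : ℝ) / a.1 ≤ t} (tau Γ) := by
  simpa [sigma, tau] using isLeast_sup_mixed Γ fun a => (a.2 : ℝ≥0) / a.1

end WeightedKohn

end

/-! Since φ is a sum of squared moduli of holomorphic monomials, its Levi matrix is a Gram matrix.
The Morrey–Kohn–Hörmander formula `integral_energyDensity` turns the energy of a test form into the
integral of |∂̄-derivatives of the coefficients|² plus twice the Levi form. The Levi form alone can
degenerate at the coordinate axes, so both terms are needed.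

First, homogeneity makes the Levi form comparable to its diagonal (`diag_le_leviForm`). Where |w|^n
≤ |z|^m, the monomial z^m has the largest z-derivative and no w-derivative, so its single term in
the Levi form controls every z-derivative times u₁; the triangle inequality then recovers the w-part
of each term. The other region is symmetric. Hence u₁ and u₂ decouple: the energy controls ‖∂̄_z
u₁‖² + ∫ `diag₁` |u₁|² and ‖∂̄_w u₂‖² + ∫ `diag₂` |u₂|².

Second, put Λ = (1 + |w|²)^τ. The mixed monomial realizing τ, together with z^m, gives `diag₁` ≥ cΛ
as soon as Λ|z|² ≥ 1 (`exists_mul_le_diag₁`). In the remaining tube |z| < Λ^(-1/2) an uncertainty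
principle for ∂̄ in the z-direction applies (`integral_le_of_uncertainty`): integrating by parts
against a = Λ z̄ / (1 + Λ|z|²), whose z̄-derivative is Λ / (1 + Λ|z|²)² and is of size Λ in the
tube, while |a|² ≤ Λ/4, bounds ∫ Λ|u₁|² by the z-derivative terms and the diagonal. The same holds
for u₂ with (1 + |z|²)^σ. The other power in the growth function is absorbed by the diagonal entry,
because σ ≤ m - 1 and τ ≤ n - 1 (`growth_sq_le`).

For a general element of the form domain no density theorem in the graph norm is used. The form is
cut off and mollified, and the inequality passes to the limit by a generalized Fatou argument
(`lintegral_limit_le`). Mollification commutes with the constant coefficient parts of ∂̄ and ∂̄*,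
the gradient of φ is bounded on the compact sets involved, and the derivatives of the cut-offs tend
uniformly to zero. -/

noncomputable section

namespace WeightedKohn

open scoped ComplexConjugate Convolution Topology Pointwise
open Filter

/-! ### Wirtinger derivatives in a complex direction -/

/-- The antiholomorphic derivative in the complex direction `e`. -/
def dbarDir (e : ℂ × ℂ) (f : ℂ × ℂ → ℂ) (p : ℂ × ℂ) : ℂ :=
  (1 / 2 : ℂ) * (fderiv ℝ f p e + Complex.I * fderiv ℝ f p (Complex.I • e))

/-- The holomorphic derivative in the complex direction `e`. -/
def dDir (e : ℂ × ℂ) (f : ℂ × ℂ → ℂ) (p : ℂ × ℂ) : ℂ :=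
  (1 / 2 : ℂ) * (fderiv ℝ f p e - Complex.I * fderiv ℝ f p (Complex.I • e))

theorem dzbar_eq : dzbar = dbarDir (1, 0) := by
  funext f p
  simp [dzbar, dbarDir]

theorem dwbar_eq : dwbar = dbarDir (0, 1) := by
  funext f p
  simp [dwbar, dbarDir]

instance volume_isAddHaarMeasure : (volume : Measure (ℂ × ℂ)).IsAddHaarMeasure :=
  inferInstanceAs (((volume : Measure ℂ).prod (volume : Measure ℂ)).IsAddHaarMeasure)

section Calculus

variable {f g : ℂ × ℂ → ℂ} (e e' : ℂ × ℂ) (p : ℂ × ℂ)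

theorem contDiff_dbarDir (hf : ContDiff ℝ ∞ f) : ContDiff ℝ ∞ (dbarDir e f) := by
  have h := hf.fderiv_right (m := ∞) (by simp)
  unfold dbarDir
  fun_prop

theorem contDiff_dDir (hf : ContDiff ℝ ∞ f) : ContDiff ℝ ∞ (dDir e f) := by
  have h := hf.fderiv_right (m := ∞) (by simp)
  unfold dDir
  fun_prop

theorem contDiff_conj (hf : ContDiff ℝ ∞ f) : ContDiff ℝ ∞ fun q => conj (f q) :=
  Complex.conjCLE.contDiff.comp hf

theorem hasCompactSupport_dbarDir (hf : HasCompactSupport f) :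
    HasCompactSupport (dbarDir e f) := by
  refine (hf.fderiv (𝕜 := ℝ)).mono fun p hp hp' => hp ?_
  simp [dbarDir, hp']

theorem hasCompactSupport_dDir (hf : HasCompactSupport f) :
    HasCompactSupport (dDir e f) := by
  refine (hf.fderiv (𝕜 := ℝ)).mono fun p hp hp' => hp ?_
  simp [dDir, hp']

theorem hasCompactSupport_conj (hf : HasCompactSupport f) :
    HasCompactSupport fun q => conj (f q) :=
  hf.comp_left (g := fun z : ℂ => conj z) (map_zero _)

theorem IsTest.dbarDir (hf : IsTest f) : IsTest (dbarDir e f) :=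
  ⟨contDiff_dbarDir e hf.1, hasCompactSupport_dbarDir e hf.2⟩

theorem IsTest.dDir (hf : IsTest f) : IsTest (dDir e f) :=
  ⟨contDiff_dDir e hf.1, hasCompactSupport_dDir e hf.2⟩

theorem IsTest.conj (hf : IsTest f) : IsTest fun q => conj (f q) :=
  ⟨contDiff_conj hf.1, hasCompactSupport_conj hf.2⟩

theorem IsTest.mul_right (hf : IsTest f) (hg : ContDiff ℝ ∞ g) : IsTest fun q => f q * g q :=
  ⟨hf.1.mul hg, hf.2.mul_right⟩

theorem IsTest.mul_left (hf : IsTest f) (hg : ContDiff ℝ ∞ g) : IsTest fun q => g q * f q :=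
  ⟨hg.mul hf.1, hf.2.mul_left⟩

theorem IsTest.add (hf : IsTest f) (hg : IsTest g) : IsTest fun q => f q + g q :=
  ⟨hf.1.add hg.1, hf.2.add hg.2⟩

theorem IsTest.sub (hf : IsTest f) (hg : IsTest g) : IsTest fun q => f q - g q :=
  ⟨hf.1.sub hg.1, hf.2.sub hg.2⟩

theorem IsTest.integrable (hf : IsTest f) : Integrable f :=
  hf.1.continuous.integrable_of_hasCompactSupport hf.2

theorem dbarDir_mul (hf : DifferentiableAt ℝ f p) (hg : DifferentiableAt ℝ g p) :
    dbarDir e (fun q => f q * g q) p = dbarDir e f p * g p + f p * dbarDir e g p := by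
  unfold dbarDir
  rw [fderiv_fun_mul hf hg]
  simp only [_root_.add_apply, _root_.smul_apply, smul_eq_mul]
  ring

theorem dDir_mul (hf : DifferentiableAt ℝ f p) (hg : DifferentiableAt ℝ g p) :
    dDir e (fun q => f q * g q) p = dDir e f p * g p + f p * dDir e g p := by
  unfold dDir
  rw [fderiv_fun_mul hf hg]
  simp only [_root_.add_apply, _root_.smul_apply, smul_eq_mul]
  ring

theorem dbarDir_add (hf : DifferentiableAt ℝ f p) (hg : DifferentiableAt ℝ g p) :
    dbarDir e (fun q => f q + g q) p = dbarDir e f p + dbarDir e g p := by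
  unfold dbarDir
  rw [fderiv_fun_add hf hg]
  simp only [_root_.add_apply]
  ring

theorem dbarDir_sub (hf : DifferentiableAt ℝ f p) (hg : DifferentiableAt ℝ g p) :
    dbarDir e (fun q => f q - g q) p = dbarDir e f p - dbarDir e g p := by
  unfold dbarDir
  rw [fderiv_fun_sub hf hg]
  simp only [_root_.sub_apply]
  ring

theorem fderiv_conj (v : ℂ × ℂ) :
    fderiv ℝ (fun q => conj (f q)) p v = conj (fderiv ℝ f p v) := by
  have h : fderiv ℝ (Complex.conjCLE ∘ f) p = _ := ContinuousLinearEquiv.comp_fderiv _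
  have h2 : (fun q => conj (f q)) = Complex.conjCLE ∘ f := by
    funext q
    simp
  rw [h2, h]
  simp

theorem dDir_conj : dDir e (fun q => conj (f q)) p = conj (dbarDir e f p) := by
  unfold dbarDir dDir
  simp only [fderiv_conj]
  simp [sub_eq_add_neg, Complex.conj_ofNat]

theorem dbarDir_conj : dbarDir e (fun q => conj (f q)) p = conj (dDir e f p) := by
  unfold dbarDir dDir
  simp only [fderiv_conj]
  simp [sub_eq_add_neg, Complex.conj_ofNat]

/-- Symmetry of the real second derivative. This lets `dDir` pass through ∂̄ in the commutator below
and makes the ∂̄-derivative of ∂h vanish for holomorphic h. -/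
theorem dbarDir_dDir_comm (hf : ContDiff ℝ ∞ f) :
    dbarDir e (dDir e' f) p = dDir e' (dbarDir e f) p := by
  have h1 : ContDiff ℝ ∞ (fderiv ℝ f) := hf.fderiv_right (by simp)
  have hs : ∀ v w, fderiv ℝ (fderiv ℝ f) p v w = fderiv ℝ (fderiv ℝ f) p w v :=
    hf.contDiffAt.isSymmSndFDerivAt
      (by rw [minSmoothness_of_isRCLikeNormedField]; exact ENat.LEInfty.out)
  have hd := (h1.differentiable (by simp)) p
  have hv : ∀ v, DifferentiableAt ℝ (fun q => fderiv ℝ f q v) p := fun v => by fun_prop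
  have hv' : ∀ v w, fderiv ℝ (fun q => fderiv ℝ f q v) p w = fderiv ℝ (fderiv ℝ f) p w v :=
    fun v w => by rw [fderiv_clm_apply hd (by fun_prop)]; simp
  have k1 : ∀ v, fderiv ℝ (dDir e' f) p v = (1 / 2 : ℂ) * (fderiv ℝ (fderiv ℝ f) p v e' -
      Complex.I * fderiv ℝ (fderiv ℝ f) p v (Complex.I • e')) := fun v => by
    unfold dDir
    rw [fderiv_const_mul (by fun_prop), fderiv_fun_sub (hv _) ((hv _).const_mul _),
      fderiv_const_mul (hv _)]
    simp [hv', mul_sub]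
  have k2 : ∀ v, fderiv ℝ (dbarDir e f) p v = (1 / 2 : ℂ) * (fderiv ℝ (fderiv ℝ f) p v e +
      Complex.I * fderiv ℝ (fderiv ℝ f) p v (Complex.I • e)) := fun v => by
    unfold dbarDir
    rw [fderiv_const_mul (by fun_prop), fderiv_fun_add (hv _) ((hv _).const_mul _),
      fderiv_const_mul (hv _)]
    simp [hv', mul_add]
  rw [WeightedKohn.dbarDir, WeightedKohn.dDir, k1, k1, k2, k2, hs e' e, hs e' (Complex.I • e),
    hs (Complex.I • e') e, hs (Complex.I • e') (Complex.I • e)]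
  ring

/-- Integration by parts against the constant function 1. -/
theorem integral_fderiv_eq_zero (hf : IsTest f) : ∫ q, fderiv ℝ f q e = 0 := by
  have dψ := hf.1.continuous_fderiv (by simp)
  have h2 : Integrable (fun q => fderiv ℝ f q e) :=
    Continuous.integrable_of_hasCompactSupport (by fun_prop) (hf.2.fderiv_apply (𝕜 := ℝ) e)
  simpa using integral_mul_fderiv_eq_neg_fderiv_mul_of_integrable (μ := volume) (𝕜 := ℂ)
    (f := fun _ : ℂ × ℂ => (1 : ℂ)) (g := f) (v := e)
    (by simp) (by simpa using h2) (by simpa using hf.integrable)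
    (fun _ _ => by fun_prop) (fun q _ => hf.1.differentiable (by simp) q)

theorem integrable_fderiv (hf : IsTest f) : Integrable fun q => fderiv ℝ f q e := by
  have dψ := hf.1.continuous_fderiv (by simp)
  exact Continuous.integrable_of_hasCompactSupport (by fun_prop) (hf.2.fderiv_apply (𝕜 := ℝ) e)

theorem integral_dDir_eq_zero (hf : IsTest f) : ∫ q, dDir e f q = 0 := by
  unfold dDir
  rw [integral_const_mul, integral_sub (integrable_fderiv _ hf)
    ((integrable_fderiv _ hf).const_mul _), integral_const_mul, integral_fderiv_eq_zero _ hf,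
    integral_fderiv_eq_zero _ hf]
  simp

end Calculus

/-! ### Weighted integration by parts -/

/-- The weight `e^{-2φ}` as a complex valued function. -/
def expWeight (φ : ℂ × ℂ → ℝ) (p : ℂ × ℂ) : ℂ := Complex.exp (-2 * (φ p : ℂ))

/-- The holomorphic gradient of a real function. -/
def grad (φ : ℂ × ℂ → ℝ) (e : ℂ × ℂ) : ℂ × ℂ → ℂ := dDir e fun q => (φ q : ℂ)

/-- The coefficients of the Levi form of a real function. -/
def levi (φ : ℂ × ℂ → ℝ) (e e' : ℂ × ℂ) : ℂ × ℂ → ℂ := dbarDir e' (grad φ e)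

/-- The formal adjoint of `dbarDir e` with respect to the weight `e^{-2φ}`. -/
def delta (φ : ℂ × ℂ → ℝ) (e : ℂ × ℂ) (f : ℂ × ℂ → ℂ) (p : ℂ × ℂ) : ℂ :=
  2 * grad φ e p * f p - dDir e f p

section Weighted

variable {φ : ℂ × ℂ → ℝ} {f g a : ℂ × ℂ → ℂ} (e e' : ℂ × ℂ) (p : ℂ × ℂ)

theorem expWeight_eq_ofReal : expWeight φ p = (Real.exp (-2 * φ p) : ℂ) := by
  simp [expWeight]

theorem contDiff_ofReal (hφ : ContDiff ℝ ∞ φ) : ContDiff ℝ ∞ fun q => (φ q : ℂ) :=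
  Complex.ofRealCLM.contDiff.comp hφ

theorem contDiff_expWeight (hφ : ContDiff ℝ ∞ φ) : ContDiff ℝ ∞ (expWeight φ) :=
  (contDiff_const.mul (contDiff_ofReal hφ)).cexp

theorem contDiff_grad (hφ : ContDiff ℝ ∞ φ) : ContDiff ℝ ∞ (grad φ e) :=
  contDiff_dDir e (contDiff_ofReal hφ)

theorem contDiff_levi (hφ : ContDiff ℝ ∞ φ) : ContDiff ℝ ∞ (levi φ e e') :=
  contDiff_dbarDir e' (contDiff_grad e hφ)

theorem conj_expWeight : conj (expWeight φ p) = expWeight φ p := by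
  rw [expWeight_eq_ofReal, Complex.conj_ofReal]

theorem dDir_exp (c : ℂ) (hφ : DifferentiableAt ℝ φ p) :
    dDir e (fun q => Complex.exp (c * (φ q : ℂ))) p =
      c * grad φ e p * Complex.exp (c * (φ p : ℂ)) := by
  have h1 : DifferentiableAt ℝ (fun q => (φ q : ℂ)) p :=
    Complex.ofRealCLM.differentiableAt.comp p hφ
  have h2 := (h1.hasFDerivAt.const_mul c).cexp.fderiv
  unfold grad dDir
  rw [h2]
  simp only [_root_.smul_apply, smul_eq_mul]
  ring

theorem dDir_expWeight (hφ : DifferentiableAt ℝ φ p) :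
    dDir e (expWeight φ) p = -2 * grad φ e p * expWeight φ p :=
  dDir_exp e p (-2) hφ

theorem IsTest.delta (hφ : ContDiff ℝ ∞ φ) (hf : IsTest f) : IsTest (delta φ e f) :=
  (hf.mul_left (contDiff_const.mul (contDiff_grad e hφ))).sub (hf.dDir e)

/-- `delta φ e` and `dbarDir e` are adjoint to each other, with a multiplier `a`. -/
theorem integral_mul_delta (hφ : ContDiff ℝ ∞ φ) (ha : ContDiff ℝ ∞ a) (hf : IsTest f)
    (hg : IsTest g) :
    ∫ q, conj (a q) * delta φ e f q * conj (g q) * expWeight φ q =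
      ∫ q, (conj (a q) * f q * conj (dbarDir e g q) + conj (dbarDir e a q) * f q * conj (g q)) *
        expWeight φ q := by
  have d : ∀ {h : ℂ × ℂ → ℂ}, ContDiff ℝ ∞ h → ∀ q, DifferentiableAt ℝ h q :=
    fun hh q => hh.differentiable (by simp) q
  -- The identity is the vanishing of the integral of the e-derivative of this product: the
  -- derivative of the weight supplies the term 2 `grad φ e` f in `delta φ e f`.
  have hF : IsTest fun q => conj (a q) * f q * conj (g q) * expWeight φ q :=
    ((hf.mul_left (contDiff_conj ha)).mul_right (contDiff_conj hg.1)).mul_right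
      (contDiff_expWeight hφ)
  have h0 := integral_dDir_eq_zero e hF
  have h1 : ∀ q, dDir e (fun q => conj (a q) * f q * conj (g q) * expWeight φ q) q =
      (conj (a q) * f q * conj (dbarDir e g q) + conj (dbarDir e a q) * f q * conj (g q)) *
        expWeight φ q - conj (a q) * delta φ e f q * conj (g q) * expWeight φ q := fun q => by
    have da := d (contDiff_conj ha) q
    have df := d hf.1 q
    have dg := d (contDiff_conj hg.1) q
    rw [dDir_mul e q (by fun_prop) (d (contDiff_expWeight hφ) q), dDir_mul e q (by fun_prop) dg,
      dDir_mul e q da df, dDir_conj, dDir_conj,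
      dDir_expWeight e q (hφ.differentiable (by simp) q), WeightedKohn.delta]
    ring
  simp only [h1] at h0
  rw [integral_sub] at h0
  · exact (sub_eq_zero.1 h0).symm
  · refine IsTest.integrable (IsTest.mul_right (IsTest.add ?_ ?_) (contDiff_expWeight hφ))
    · exact (hf.mul_left (contDiff_conj ha)).mul_right (contDiff_conj (hg.dbarDir e).1)
    · exact (hf.mul_left (contDiff_conj (contDiff_dbarDir e ha))).mul_right (contDiff_conj hg.1)
  · exact ((((hf.delta e hφ).mul_left (contDiff_conj ha)).mul_right
      (contDiff_conj hg.1)).mul_right (contDiff_expWeight hφ)).integrable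

theorem integral_delta (hφ : ContDiff ℝ ∞ φ) (hf : IsTest f) (hg : IsTest g) :
    ∫ q, delta φ e f q * conj (g q) * expWeight φ q =
      ∫ q, f q * conj (dbarDir e g q) * expWeight φ q := by
  have h := integral_mul_delta (a := fun _ => 1) e hφ contDiff_const hf hg
  have h0 : ∀ q, dbarDir e (fun _ => (1 : ℂ)) q = 0 := fun q => by simp [dbarDir]
  simpa [h0] using h

/-- The commutator of ∂̄ with its formal adjoint is multiplication by a Levi coefficient:
derivatives commute, so only the derivative falling on `grad φ e` survives. -/
theorem dbarDir_delta (hφ : ContDiff ℝ ∞ φ) (hf : IsTest f) :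
    dbarDir e' (delta φ e f) p = delta φ e (dbarDir e' f) p + 2 * levi φ e e' p * f p := by
  have d : ∀ {h : ℂ × ℂ → ℂ}, ContDiff ℝ ∞ h → ∀ q, DifferentiableAt ℝ h q :=
    fun hh q => hh.differentiable (by simp) q
  have d1 := d (contDiff_grad e hφ) p
  have d2 := d hf.1 p
  have d3 := d (hf.dDir e).1 p
  have h2 : dbarDir e' (fun _ : ℂ × ℂ => (2 : ℂ)) p = 0 := by simp [dbarDir]
  unfold WeightedKohn.delta
  rw [dbarDir_sub e' p (by fun_prop) d3, dbarDir_mul e' p (by fun_prop) d2,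
    dbarDir_mul e' p (by fun_prop) d1, h2, dbarDir_dDir_comm _ _ _ hf.1, levi]
  ring

/-- The commutator identity behind the Morrey–Kohn–Hörmander formula. -/
theorem integral_delta_mul_conj_delta (hφ : ContDiff ℝ ∞ φ) (hf : IsTest f) (hg : IsTest g) :
    ∫ q, delta φ e f q * conj (delta φ e' g q) * expWeight φ q =
      ∫ q, (dbarDir e' f q * conj (dbarDir e g q) + 2 * levi φ e e' q * f q * conj (g q)) *
        expWeight φ q := by
  have hW := contDiff_expWeight hφ
  have h1 := integral_delta e' hφ hg (hf.delta e hφ)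
  have h2 := congrArg conj h1
  rw [← integral_conj, ← integral_conj] at h2
  simp only [map_mul, Complex.conj_conj, conj_expWeight] at h2
  have h3 := integral_delta e hφ (hf.dbarDir e') hg
  calc _ = ∫ q, conj (delta φ e' g q) * delta φ e f q * expWeight φ q := by
        congr 1; funext q; ring
    _ = ∫ q, (delta φ e (dbarDir e' f) q * conj (g q) * expWeight φ q +
        2 * levi φ e e' q * f q * conj (g q) * expWeight φ q) := by
        rw [h2]; congr 1; funext q; rw [dbarDir_delta e e' q hφ hf]; ring
    _ = (∫ q, dbarDir e' f q * conj (dbarDir e g q) * expWeight φ q) +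
        ∫ q, 2 * levi φ e e' q * f q * conj (g q) * expWeight φ q := by
        rw [integral_add, h3]
        · exact ((((hf.dbarDir e').delta e hφ).mul_right
            (contDiff_conj hg.1)).mul_right hW).integrable
        · exact (((hf.mul_left (contDiff_const.mul (contDiff_levi e e' hφ))).mul_right
            (contDiff_conj hg.1)).mul_right hW).integrable
    _ = _ := by
        rw [← integral_add]
        · congr 1; funext q; ring
        · exact (((hf.dbarDir e').mul_right (contDiff_conj (hg.dbarDir e).1)).mul_right
            hW).integrable
        · exact (((hf.mul_left (contDiff_const.mul (contDiff_levi e e' hφ))).mul_right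
            (contDiff_conj hg.1)).mul_right hW).integrable

end Weighted

/-! ### The Levi form of a model monomial weight -/

section Holomorphic

variable {h : ℂ × ℂ → ℂ} (e e' : ℂ × ℂ) (p : ℂ × ℂ)

theorem dDir_of_differentiableAt (hh : DifferentiableAt ℂ h p) :
    dDir e h p = fderiv ℂ h p e := by
  have h1 := (hh.hasFDerivAt.restrictScalars ℝ).fderiv
  unfold dDir
  rw [h1]
  simp only [ContinuousLinearMap.coe_restrictScalars', map_smul, smul_eq_mul]
  linear_combination (-(1 / 2) * fderiv ℂ h p e) * Complex.I_mul_I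

theorem dbarDir_of_differentiableAt (hh : DifferentiableAt ℂ h p) : dbarDir e h p = 0 := by
  have h1 := (hh.hasFDerivAt.restrictScalars ℝ).fderiv
  unfold dbarDir
  rw [h1]
  simp only [ContinuousLinearMap.coe_restrictScalars', map_smul, smul_eq_mul]
  linear_combination ((1 / 2) * fderiv ℂ h p e) * Complex.I_mul_I

theorem dDir_normSq (hh : ContDiff ℂ ∞ h) :
    dDir e (fun q => h q * conj (h q)) p = dDir e h p * conj (h p) := by
  have hr : ContDiff ℝ ∞ h := hh.restrict_scalars ℝ
  rw [dDir_mul e p (hr.differentiable (by simp) p)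
    ((contDiff_conj hr).differentiable (by simp) p), dDir_conj,
    dbarDir_of_differentiableAt e p (hh.differentiable (by simp) p)]
  simp

theorem dbarDir_dDir_normSq (hh : ContDiff ℂ ∞ h) :
    dbarDir e' (fun q => dDir e h q * conj (h q)) p = dDir e h p * conj (dDir e' h p) := by
  have hr : ContDiff ℝ ∞ h := hh.restrict_scalars ℝ
  have h0 : dbarDir e' h = fun _ => 0 := funext fun q =>
    dbarDir_of_differentiableAt e' q (hh.differentiable (by simp) q)
  rw [dbarDir_mul e' p ((contDiff_dDir e hr).differentiable (by simp) p)
    ((contDiff_conj hr).differentiable (by simp) p), dbarDir_conj,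
    dbarDir_dDir_comm _ _ _ hr, h0]
  simp [dDir]

end Holomorphic

section Sum

variable {ι : Type*} {h : ι → ℂ × ℂ → ℂ} {s : Finset ι} (e : ℂ × ℂ) (p : ℂ × ℂ)

theorem dDir_sum (hh : ∀ i ∈ s, DifferentiableAt ℝ (h i) p) :
    dDir e (fun q => ∑ i ∈ s, h i q) p = ∑ i ∈ s, dDir e (h i) p := by
  unfold dDir
  rw [fderiv_fun_sum hh, ← Finset.mul_sum, Finset.sum_sub_distrib, ← Finset.mul_sum]
  simp

theorem dbarDir_sum (hh : ∀ i ∈ s, DifferentiableAt ℝ (h i) p) :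
    dbarDir e (fun q => ∑ i ∈ s, h i q) p = ∑ i ∈ s, dbarDir e (h i) p := by
  unfold dbarDir
  rw [fderiv_fun_sum hh, ← Finset.mul_sum, Finset.sum_add_distrib, ← Finset.mul_sum]
  simp

end Sum

/-! ### Monomials and the Levi matrix of the weight -/

/-- The monomial `z^α w^β`. -/
def mono (a : ℕ × ℕ) (p : ℂ × ℂ) : ℂ := p.1 ^ a.1 * p.2 ^ a.2

/-- The `z`-derivative of `z^α w^β`. -/
def mono₁ (a : ℕ × ℕ) (p : ℂ × ℂ) : ℂ := a.1 * p.1 ^ (a.1 - 1) * p.2 ^ a.2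

/-- The `w`-derivative of `z^α w^β`. -/
def mono₂ (a : ℕ × ℕ) (p : ℂ × ℂ) : ℂ := a.2 * p.1 ^ a.1 * p.2 ^ (a.2 - 1)

theorem contDiff_mono (a : ℕ × ℕ) : ContDiff ℂ ∞ (mono a) := by
  unfold mono
  fun_prop

theorem fderiv_mono (a : ℕ × ℕ) (p v : ℂ × ℂ) :
    fderiv ℂ (mono a) p v = mono₁ a p * v.1 + mono₂ a p * v.2 := by
  have h1 : HasFDerivAt (fun q : ℂ × ℂ => q.1) (ContinuousLinearMap.fst ℂ ℂ ℂ) p :=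
    hasFDerivAt_fst
  have h2 : HasFDerivAt (fun q : ℂ × ℂ => q.2) (ContinuousLinearMap.snd ℂ ℂ ℂ) p :=
    hasFDerivAt_snd
  have h3 := ((h1.pow a.1).mul (h2.pow a.2)).fderiv
  unfold mono
  erw [h3]
  simp [mono₁, mono₂]
  ring

theorem dDir_mono_one (a : ℕ × ℕ) : dDir (1, 0) (mono a) = mono₁ a := by
  funext p
  rw [dDir_of_differentiableAt _ _ ((contDiff_mono a).differentiable (by simp) p), fderiv_mono]
  simp

theorem dDir_mono_two (a : ℕ × ℕ) : dDir (0, 1) (mono a) = mono₂ a := by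
  funext p
  rw [dDir_of_differentiableAt _ _ ((contDiff_mono a).differentiable (by simp) p), fderiv_mono]
  simp

theorem modelWeight_eq (Γ : Finset (ℕ × ℕ)) (p : ℂ × ℂ) :
    (modelWeight Γ p : ℂ) = ∑ a ∈ Γ, mono a p * conj (mono a p) := by
  change ((∑ a ∈ Γ, ‖p.1 ^ a.1 * p.2 ^ a.2‖ ^ 2 : ℝ) : ℂ) = _
  push_cast
  exact Finset.sum_congr rfl fun a _ => by
    rw [Complex.mul_conj, Complex.normSq_eq_norm_sq]
    simp [mono]

theorem contDiff_modelWeight (Γ : Finset (ℕ × ℕ)) : ContDiff ℝ ∞ (modelWeight Γ) := by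
  change ContDiff ℝ ∞ fun p : ℂ × ℂ => ∑ a ∈ Γ, ‖p.1 ^ a.1 * p.2 ^ a.2‖ ^ 2
  refine ContDiff.sum fun a _ => ContDiff.norm_sq ℝ ?_
  fun_prop

theorem modelWeight_nonneg (Γ : Finset (ℕ × ℕ)) (p : ℂ × ℂ) : 0 ≤ modelWeight Γ p :=
  Finset.sum_nonneg fun _ _ => by positivity

theorem grad_modelWeight (Γ : Finset (ℕ × ℕ)) (e : ℂ × ℂ) :
    grad (modelWeight Γ) e = fun p => ∑ a ∈ Γ, dDir e (mono a) p * conj (mono a p) := by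
  funext p
  have hr : ∀ a, ContDiff ℝ ∞ (mono a) := fun a => (contDiff_mono a).restrict_scalars ℝ
  have h1 : (fun q => (modelWeight Γ q : ℂ)) = fun q => ∑ a ∈ Γ, mono a q * conj (mono a q) :=
    funext (modelWeight_eq Γ)
  rw [grad, h1, dDir_sum]
  · exact Finset.sum_congr rfl fun a _ => dDir_normSq e p (contDiff_mono a)
  · exact fun a _ => ((hr a).mul (contDiff_conj (hr a))).differentiable (by simp) p

/-- For holomorphic h, ∂ acts only on the first factor of h h̄ and ∂̄ only on the second. The Levi
matrix is thus the Gram matrix of the gradients of the monomials. -/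
theorem levi_modelWeight (Γ : Finset (ℕ × ℕ)) (e e' p : ℂ × ℂ) :
    levi (modelWeight Γ) e e' p =
      ∑ a ∈ Γ, dDir e (mono a) p * conj (dDir e' (mono a) p) := by
  have hr : ∀ a, ContDiff ℝ ∞ (mono a) := fun a => (contDiff_mono a).restrict_scalars ℝ
  rw [levi, grad_modelWeight, dbarDir_sum]
  · exact Finset.sum_congr rfl fun a _ => dbarDir_dDir_normSq e e' p (contDiff_mono a)
  · exact fun a _ =>
      ((contDiff_dDir e (hr a)).mul (contDiff_conj (hr a))).differentiable (by simp) p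

/-- The Levi form of the model weight, evaluated on `(u₁, u₂)`. -/
def leviForm (Γ : Finset (ℕ × ℕ)) (p : ℂ × ℂ) (u₁ u₂ : ℂ) : ℝ :=
  ∑ a ∈ Γ, ‖mono₁ a p * u₁ + mono₂ a p * u₂‖ ^ 2

/-- The first diagonal entry of the Levi form. -/
def diag₁ (Γ : Finset (ℕ × ℕ)) (p : ℂ × ℂ) : ℝ := ∑ a ∈ Γ, ‖mono₁ a p‖ ^ 2

/-- The second diagonal entry of the Levi form. -/
def diag₂ (Γ : Finset (ℕ × ℕ)) (p : ℂ × ℂ) : ℝ := ∑ a ∈ Γ, ‖mono₂ a p‖ ^ 2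

theorem diag₁_nonneg (Γ : Finset (ℕ × ℕ)) (p : ℂ × ℂ) : 0 ≤ diag₁ Γ p :=
  Finset.sum_nonneg fun _ _ => by positivity

theorem diag₂_nonneg (Γ : Finset (ℕ × ℕ)) (p : ℂ × ℂ) : 0 ≤ diag₂ Γ p :=
  Finset.sum_nonneg fun _ _ => by positivity

theorem leviForm_nonneg (Γ : Finset (ℕ × ℕ)) (p : ℂ × ℂ) (u₁ u₂ : ℂ) : 0 ≤ leviForm Γ p u₁ u₂ :=
  Finset.sum_nonneg fun _ _ => by positivity

theorem levi_one_one (Γ : Finset (ℕ × ℕ)) (p : ℂ × ℂ) :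
    levi (modelWeight Γ) (1, 0) (1, 0) p = diag₁ Γ p := by
  simp only [levi_modelWeight, dDir_mono_one, diag₁, Complex.ofReal_sum, Complex.ofReal_pow,
    ← Complex.mul_conj']

theorem levi_two_two (Γ : Finset (ℕ × ℕ)) (p : ℂ × ℂ) :
    levi (modelWeight Γ) (0, 1) (0, 1) p = diag₂ Γ p := by
  simp only [levi_modelWeight, dDir_mono_two, diag₂, Complex.ofReal_sum, Complex.ofReal_pow,
    ← Complex.mul_conj']

theorem leviForm_eq (Γ : Finset (ℕ × ℕ)) (p : ℂ × ℂ) (u₁ u₂ : ℂ) :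
    (leviForm Γ p u₁ u₂ : ℂ) =
      levi (modelWeight Γ) (1, 0) (1, 0) p * u₁ * conj u₁ +
      levi (modelWeight Γ) (0, 1) (0, 1) p * u₂ * conj u₂ +
      levi (modelWeight Γ) (1, 0) (0, 1) p * u₁ * conj u₂ +
      conj (levi (modelWeight Γ) (1, 0) (0, 1) p * u₁ * conj u₂) := by
  simp only [levi_modelWeight, dDir_mono_one, dDir_mono_two, leviForm, Complex.ofReal_sum,
    Complex.ofReal_pow, ← Complex.mul_conj', Finset.sum_mul, map_sum, map_mul, map_add,
    Complex.conj_conj, ← Finset.sum_add_distrib]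
  exact Finset.sum_congr rfl fun a _ => by ring

/-! ### Comparison of the Levi form with its diagonal -/

/-- After taking n-th powers, B^n ≤ A^m replaces B by A, and the exponents add up to (m - 1)n
because (α, β) lies on the segment from (m, 0) to (0, n). -/
theorem pow_mul_pow_le_of_pow_le_pow {A B : ℝ} (hA : 0 ≤ A) (hB : 0 ≤ B) {m n α β : ℕ}
    (hm : 1 ≤ m) (hn : 1 ≤ n) (hα : 1 ≤ α) (h : n * α + m * β = n * m) (hAB : B ^ n ≤ A ^ m) :
    A ^ (α - 1) * B ^ β ≤ A ^ (m - 1) := by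
  obtain ⟨k, rfl⟩ := Nat.exists_eq_add_of_le' hα
  obtain ⟨j, rfl⟩ := Nat.exists_eq_add_of_le' hm
  have he : k * n + (j + 1) * β = j * n := by nlinarith
  refine (pow_le_pow_iff_left₀ (by positivity) (by positivity) (by omega : n ≠ 0)).1 ?_
  calc (A ^ k * B ^ β) ^ n = A ^ (k * n) * (B ^ n) ^ β := by
        rw [mul_pow, ← pow_mul, ← pow_mul, ← pow_mul, mul_comm β n]
    _ ≤ A ^ (k * n) * (A ^ (j + 1)) ^ β := by gcongr
    _ = (A ^ j) ^ n := by rw [← pow_mul, ← pow_add, he, pow_mul]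

/-- In the region around the z-axis the pure power z^m dominates all z-derivatives; the coefficients
compare because α ≤ m. -/
theorem norm_mono₁_le {m n : ℕ} (hm : 1 ≤ m) (hn : 1 ≤ n) {a : ℕ × ℕ}
    (h : n * a.1 + m * a.2 = n * m) (p : ℂ × ℂ) (hp : ‖p.2‖ ^ n ≤ ‖p.1‖ ^ m) :
    ‖mono₁ a p‖ ≤ ‖mono₁ (m, 0) p‖ := by
  rcases Nat.eq_zero_or_pos a.1 with h0 | h0
  · simp [mono₁, h0]; positivity
  have h1 := pow_mul_pow_le_of_pow_le_pow (norm_nonneg p.1) (norm_nonneg p.2) hm hn h0 h hp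
  have h2 : a.1 ≤ m := by nlinarith
  simp only [mono₁, norm_mul, norm_pow, Complex.norm_natCast, pow_zero, mul_one, mul_assoc]
  gcongr

theorem norm_mono₂_le {m n : ℕ} (hm : 1 ≤ m) (hn : 1 ≤ n) {a : ℕ × ℕ}
    (h : n * a.1 + m * a.2 = n * m) (p : ℂ × ℂ) (hp : ‖p.1‖ ^ m ≤ ‖p.2‖ ^ n) :
    ‖mono₂ a p‖ ≤ ‖mono₂ (0, n) p‖ := by
  rcases Nat.eq_zero_or_pos a.2 with h0 | h0
  · simp [mono₂, h0]; positivity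
  have h1 := pow_mul_pow_le_of_pow_le_pow (norm_nonneg p.2) (norm_nonneg p.1) hn hm h0
    (by rw [add_comm, h, mul_comm]) hp
  have h2 : a.2 ≤ n := by nlinarith
  simp only [mono₂, norm_mul, norm_pow, Complex.norm_natCast, pow_zero, mul_one, mul_assoc]
  rw [mul_comm (‖p.1‖ ^ _)]
  gcongr

theorem norm_sq_le_two_mul_add (x y : ℂ) : ‖x‖ ^ 2 ≤ 2 * ‖x + y‖ ^ 2 + 2 * ‖y‖ ^ 2 := by
  have h := norm_sub_le (x + y) y
  rw [add_sub_cancel_right] at h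
  nlinarith [norm_nonneg x, norm_nonneg y, norm_nonneg (x + y), sq_nonneg (‖x + y‖ - ‖y‖)]

/-- The Levi form of a homogeneous model weight is comparable to its diagonal part. -/
theorem diag_le_leviForm {Γ : Finset (ℕ × ℕ)} (hΓ : IsHomogeneous Γ) (p : ℂ × ℂ) (u₁ u₂ : ℂ) :
    diag₁ Γ p * ‖u₁‖ ^ 2 ≤ 4 * Γ.card * leviForm Γ p u₁ u₂ ∧
      diag₂ Γ p * ‖u₂‖ ^ 2 ≤ 4 * Γ.card * leviForm Γ p u₁ u₂ := by
  obtain ⟨m, n, hm, hn, hm', hn', h⟩ := hΓ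
  set H := leviForm Γ p u₁ u₂ with hH
  have hle : ∀ a ∈ Γ, ‖mono₁ a p * u₁ + mono₂ a p * u₂‖ ^ 2 ≤ H := fun a ha =>
    Finset.single_le_sum (f := fun a => ‖mono₁ a p * u₁ + mono₂ a p * u₂‖ ^ 2)
      (fun _ _ => by positivity) ha
  have key : ∀ a ∈ Γ, ‖mono₁ a p * u₁‖ ^ 2 ≤ 4 * H ∧ ‖mono₂ a p * u₂‖ ^ 2 ≤ 4 * H := by
    intro a ha
    have h0 := hle a ha
    have h1 := norm_sq_le_two_mul_add (mono₁ a p * u₁) (mono₂ a p * u₂)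
    have h2 := norm_sq_le_two_mul_add (mono₂ a p * u₂) (mono₁ a p * u₁)
    rw [add_comm (mono₂ a p * u₂)] at h2
    have hH0 := leviForm_nonneg Γ p u₁ u₂
    -- In each region one pure power has no derivative in the other variable, so its term bounds one
    -- of the two summands by H. The triangle inequality inside the term of `a` gives 2H + 2H for
    -- the other summand.
    rcases le_total (‖p.2‖ ^ n) (‖p.1‖ ^ m) with hp | hp
    · have h3 : ‖mono₁ a p * u₁‖ ^ 2 ≤ H := by
        refine le_trans ?_ (hle _ hm')
        have : mono₂ (m, 0) p = 0 := by simp [mono₂]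
        rw [this, zero_mul, add_zero, norm_mul, norm_mul]
        have := norm_mono₁_le hm hn (h a ha) p hp
        gcongr
      constructor <;> linarith
    · have h3 : ‖mono₂ a p * u₂‖ ^ 2 ≤ H := by
        refine le_trans ?_ (hle _ hn')
        have : mono₁ (0, n) p = 0 := by simp [mono₁]
        rw [this, zero_mul, zero_add, norm_mul, norm_mul]
        have := norm_mono₂_le hm hn (h a ha) p hp
        gcongr
      constructor <;> linarith
  constructor
  · rw [diag₁, Finset.sum_mul]
    refine (Finset.sum_le_card_nsmul Γ _ (4 * H) fun a ha => ?_).trans (by simp; linarith)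
    rw [← mul_pow, ← norm_mul]
    exact (key a ha).1
  · rw [diag₂, Finset.sum_mul]
    refine (Finset.sum_le_card_nsmul Γ _ (4 * H) fun a ha => ?_).trans (by simp; linarith)
    rw [← mul_pow, ← norm_mul]
    exact (key a ha).2

/-! ### The scale of the weight near the coordinate axes -/

/-- Lower bound for `A²⁽ᵐ⁻¹⁾ + A²⁽ᵅ⁻¹⁾ B²ᵝ` at scales `A ≥ (1 + B²)^{-t/2}`, where `t = β / α`. -/
theorem exists_mul_rpow_le {t : ℝ} (ht : 0 ≤ t) {m : ℕ} (hm : 1 ≤ m) {M : ℝ → ℝ → ℝ}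
    (h1 : ∀ x y, 0 ≤ x → 0 ≤ y → x ^ (m - 1) ≤ M x y)
    (h2 : t = 0 ∨ ∃ α β : ℕ, 1 ≤ α ∧ t = β / α ∧
      ∀ x y, 0 ≤ x → 0 ≤ y → x ^ (α - 1) * y ^ β ≤ M x y) :
    ∃ c : ℝ, 0 < c ∧ ∀ x y : ℝ, 0 ≤ x → 0 ≤ y → 1 ≤ (1 + y) ^ t * x →
      c * (1 + y) ^ t ≤ M x y := by
  -- With L = (1 + y)^t, the condition Lx ≥ 1 gives L ≤ L (Lx)^(k-1) = x^(k-1) L^k. It is used with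
  -- k = m where L is bounded and with k = α where y is large.
  have self : ∀ (k : ℕ) (x y : ℝ), 1 ≤ k → 0 ≤ y → 1 ≤ (1 + y) ^ t * x →
      (1 + y) ^ t ≤ x ^ (k - 1) * ((1 + y) ^ t) ^ k := fun k x y hk hy h => by
    obtain ⟨j, rfl⟩ := Nat.exists_eq_add_of_le' hk
    have hL : 0 < (1 + y) ^ t := by positivity
    have h3 := one_le_pow₀ (n := j) h
    calc (1 + y) ^ t ≤ ((1 + y) ^ t * x) ^ j * (1 + y) ^ t := le_mul_of_one_le_left hL.le h3
      _ = _ := by rw [mul_pow, pow_succ, Nat.add_sub_cancel]; ring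
  have low : ∀ x y : ℝ, 0 ≤ x → 0 ≤ y → 1 ≤ (1 + y) ^ t * x → (1 + y) ^ t ≤ 2 ^ t →
      (((2 : ℝ) ^ t) ^ m)⁻¹ * (1 + y) ^ t ≤ M x y := fun x y hx hy h h' => by
    refine le_trans ?_ (h1 x y hx hy)
    rw [inv_mul_le_iff₀ (by positivity), mul_comm]
    exact (self m x y hm hy h).trans (by gcongr)
  rcases h2 with rfl | ⟨α, β, hα, rfl, h2⟩
  · exact ⟨_, by positivity, fun x y hx hy h => low x y hx hy h (by simp)⟩
  · refine ⟨min (((2 : ℝ) ^ ((β : ℝ) / α)) ^ m)⁻¹ ((2 : ℝ) ^ β)⁻¹, by positivity,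
      fun x y hx hy h => ?_⟩
    rcases le_total y 1 with hy1 | hy1
    · refine le_trans ?_ (low x y hx hy h
        (Real.rpow_le_rpow (by positivity) (by linarith) ht))
      gcongr
      exact min_le_left _ _
    · refine le_trans (mul_le_mul_of_nonneg_right (min_le_right _ _) (by positivity))
        (le_trans ?_ (h2 x y hx hy))
      rw [inv_mul_le_iff₀ (by positivity)]
      refine (self α x y hα hy h).trans ?_
      have hα' : (α : ℝ) ≠ 0 := by positivity
      -- The exponent t = β/α is exactly the one for which L^α is comparable to y^β when y ≥ 1.
      have h4 : ((1 + y) ^ ((β : ℝ) / α)) ^ α = (1 + y) ^ β := by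
        rw [← Real.rpow_natCast, ← Real.rpow_mul (by positivity), div_mul_cancel₀ _ hα',
          Real.rpow_natCast]
      rw [h4]
      calc x ^ (α - 1) * (1 + y) ^ β ≤ x ^ (α - 1) * (2 * y) ^ β := by gcongr; linarith
        _ = _ := by rw [mul_pow]; ring

theorem sup_mixed_eq (Γ : Finset (ℕ × ℕ)) (r : ℕ × ℕ → ℝ≥0) :
    (mixed Γ).sup r = 0 ∨ ∃ a ∈ Γ, a.1 ≠ 0 ∧ a.2 ≠ 0 ∧ (mixed Γ).sup r = r a := by
  rcases (mixed Γ).eq_empty_or_nonempty with h | h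
  · left
    simp [h]
  · right
    obtain ⟨a, ha, h'⟩ := (mixed Γ).exists_mem_eq_sup h r
    obtain ⟨h0, h1, h2⟩ := Finset.mem_filter.1 ha
    exact ⟨a, h0, h1, h2, h'⟩

theorem norm_mono₁_sq (a : ℕ × ℕ) (ha : a.1 ≠ 0) (p : ℂ × ℂ) :
    (‖p.1‖ ^ 2) ^ (a.1 - 1) * (‖p.2‖ ^ 2) ^ a.2 ≤ ‖mono₁ a p‖ ^ 2 := by
  have h : (1 : ℝ) ≤ (a.1 : ℝ) ^ 2 := one_le_pow₀ (by exact_mod_cast Nat.pos_of_ne_zero ha)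
  simp only [mono₁, norm_mul, norm_pow, Complex.norm_natCast, mul_pow]
  rw [mul_assoc, ← pow_mul, ← pow_mul, ← pow_mul, ← pow_mul, mul_comm 2, mul_comm 2]
  exact le_mul_of_one_le_left (by positivity) h

theorem norm_mono₂_sq (a : ℕ × ℕ) (ha : a.2 ≠ 0) (p : ℂ × ℂ) :
    (‖p.2‖ ^ 2) ^ (a.2 - 1) * (‖p.1‖ ^ 2) ^ a.1 ≤ ‖mono₂ a p‖ ^ 2 := by
  have h : (1 : ℝ) ≤ (a.2 : ℝ) ^ 2 := one_le_pow₀ (by exact_mod_cast Nat.pos_of_ne_zero ha)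
  simp only [mono₂, norm_mul, norm_pow, Complex.norm_natCast, mul_pow]
  rw [mul_assoc, ← pow_mul, ← pow_mul, ← pow_mul, ← pow_mul, mul_comm 2, mul_comm 2,
    mul_comm (‖p.1‖ ^ _)]
  exact le_mul_of_one_le_left (by positivity) h

/-- Outside the tube around z = 0 of radius Λ^(-1/2), where Λ = (1 + |w|²)^τ, the monomials z^m and,
if there are mixed points, one attaining τ already make the diagonal entry of size Λ. -/
theorem exists_mul_le_diag₁ {Γ : Finset (ℕ × ℕ)} (hΓ : IsHomogeneous Γ) :
    ∃ c : ℝ, 0 < c ∧ ∀ p : ℂ × ℂ, 1 ≤ (1 + ‖p.2‖ ^ 2) ^ (tau Γ : ℝ) * ‖p.1‖ ^ 2 →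
      c * (1 + ‖p.2‖ ^ 2) ^ (tau Γ : ℝ) ≤ diag₁ Γ p := by
  obtain ⟨m, n, hm, hn, hm', hn', h⟩ := hΓ
  have hle : ∀ a ∈ Γ, ∀ p, ‖mono₁ a p‖ ^ 2 ≤ diag₁ Γ p := fun a ha p =>
    Finset.single_le_sum (f := fun a => ‖mono₁ a p‖ ^ 2) (fun _ _ => by positivity) ha
  obtain ⟨c, hc, h1⟩ := exists_mul_rpow_le (t := tau Γ) (NNReal.coe_nonneg _) hm
    -- `diag₁` depends only on |z|² and |w|², so it is evaluated at the real point (√x, √y).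
    (M := fun x y => diag₁ Γ ((√x : ℝ), (√y : ℝ))) (fun x y hx hy => by
      have h1 := (norm_mono₁_sq (m, 0) (by simp; omega) ((√x : ℝ), (√y : ℝ))).trans
        (hle _ hm' _)
      simpa [Real.sq_sqrt hx] using h1) (by
      rcases sup_mixed_eq Γ fun a => (a.2 : ℝ≥0) / a.1 with h0 | ⟨a, ha, ha1, ha2, h0⟩
      · left
        rw [tau, h0, NNReal.coe_zero]
      · refine Or.inr ⟨a.1, a.2, Nat.pos_of_ne_zero ha1, by rw [tau, h0]; simp,
          fun x y hx hy => ?_⟩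
        have h1 := (norm_mono₁_sq a ha1 ((√x : ℝ), (√y : ℝ))).trans (hle _ ha _)
        simpa [Real.sq_sqrt hx, Real.sq_sqrt hy] using h1)
  refine ⟨c, hc, fun p hp => ?_⟩
  have h2 := h1 (‖p.1‖ ^ 2) (‖p.2‖ ^ 2) (by positivity) (by positivity) hp
  have h3 : diag₁ Γ ((√(‖p.1‖ ^ 2) : ℝ), (√(‖p.2‖ ^ 2) : ℝ)) = diag₁ Γ p := by
    simp [diag₁, mono₁]
  exact h2.trans h3.le

theorem exists_mul_le_diag₂ {Γ : Finset (ℕ × ℕ)} (hΓ : IsHomogeneous Γ) :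
    ∃ c : ℝ, 0 < c ∧ ∀ p : ℂ × ℂ, 1 ≤ (1 + ‖p.1‖ ^ 2) ^ (sigma Γ : ℝ) * ‖p.2‖ ^ 2 →
      c * (1 + ‖p.1‖ ^ 2) ^ (sigma Γ : ℝ) ≤ diag₂ Γ p := by
  obtain ⟨m, n, hm, hn, hm', hn', h⟩ := hΓ
  have hle : ∀ a ∈ Γ, ∀ p, ‖mono₂ a p‖ ^ 2 ≤ diag₂ Γ p := fun a ha p =>
    Finset.single_le_sum (f := fun a => ‖mono₂ a p‖ ^ 2) (fun _ _ => by positivity) ha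
  obtain ⟨c, hc, h1⟩ := exists_mul_rpow_le (t := sigma Γ) (NNReal.coe_nonneg _) hn
    (M := fun x y => diag₂ Γ ((√y : ℝ), (√x : ℝ))) (fun x y hx hy => by
      have h1 := (norm_mono₂_sq (0, n) (by simp; omega) ((√y : ℝ), (√x : ℝ))).trans
        (hle _ hn' _)
      simpa [Real.sq_sqrt hx] using h1) (by
      rcases sup_mixed_eq Γ fun a => (a.1 : ℝ≥0) / a.2 with h0 | ⟨a, ha, ha1, ha2, h0⟩
      · left
        rw [sigma, h0, NNReal.coe_zero]
      · refine Or.inr ⟨a.2, a.1, Nat.pos_of_ne_zero ha2, by rw [sigma, h0]; simp,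
          fun x y hx hy => ?_⟩
        have h1 := (norm_mono₂_sq a ha2 ((√y : ℝ), (√x : ℝ))).trans (hle _ ha _)
        simpa [Real.sq_sqrt hx, Real.sq_sqrt hy] using h1)
  refine ⟨c, hc, fun p hp => ?_⟩
  have h2 := h1 (‖p.2‖ ^ 2) (‖p.1‖ ^ 2) (by positivity) (by positivity) hp
  have h3 : diag₂ Γ ((√(‖p.1‖ ^ 2) : ℝ), (√(‖p.2‖ ^ 2) : ℝ)) = diag₂ Γ p := by
    simp [diag₂, mono₂]
  exact h2.trans h3.le

/-- A mixed point has 1 ≤ α ≤ m - 1 and 1 ≤ β ≤ n - 1, so both quotients are at most their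
numerators. -/
theorem sup_mixed_le {Γ : Finset (ℕ × ℕ)} {m n : ℕ} (hn : 1 ≤ n) (hm : 1 ≤ m)
    (h : ∀ a ∈ Γ, n * a.1 + m * a.2 = n * m) :
    (sigma Γ : ℝ) ≤ (m - 1 : ℕ) ∧ (tau Γ : ℝ) ≤ (n - 1 : ℕ) := by
  have key : ∀ a ∈ mixed Γ, a.1 ≤ m - 1 ∧ a.2 ≤ n - 1 ∧ 1 ≤ a.1 ∧ 1 ≤ a.2 := fun a ha => by
    obtain ⟨h0, h1, h2⟩ := Finset.mem_filter.1 ha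
    have h3 := h a h0
    have h4 : a.1 < m := by
      by_contra! h5
      have := Nat.mul_le_mul_left n h5
      have : 0 < m * a.2 := by positivity
      omega
    have h5 : a.2 < n := by
      by_contra! h5
      have := Nat.mul_le_mul_left m h5
      have : 0 < n * a.1 := by positivity
      rw [mul_comm m n] at *
      omega
    omega
  have div_le : ∀ x y k : ℕ, x ≤ k → 1 ≤ y → (x : ℝ≥0) / y ≤ k := fun x y k hx hy =>
    (div_le_self (by positivity) (by exact_mod_cast hy)).trans (by exact_mod_cast hx)
  constructor
  · exact_mod_cast (Finset.sup_le fun a ha => div_le _ _ _ (key a ha).1 (key a ha).2.2.2 :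
      sigma Γ ≤ (m - 1 : ℕ))
  · exact_mod_cast (Finset.sup_le fun a ha => div_le _ _ _ (key a ha).2.1 (key a ha).2.2.1 :
      tau Γ ≤ (n - 1 : ℕ))

theorem rpow_sq_le_one_add {x s : ℝ} {k : ℕ} (hx : 0 ≤ x) (hs : 0 ≤ s) (hk : s ≤ k) :
    (x ^ s) ^ 2 ≤ 1 + (x ^ 2) ^ k := by
  rcases le_total x 1 with h | h
  · have h1 : x ^ s ≤ 1 := Real.rpow_le_one hx h hs
    have h2 : (x ^ s) ^ 2 ≤ 1 := pow_le_one₀ (by positivity) h1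
    have : 0 ≤ (x ^ 2) ^ k := by positivity
    linarith
  · have h1 : x ^ s ≤ x ^ k := by
      rw [← Real.rpow_natCast]
      exact Real.rpow_le_rpow_of_exponent_le h hk
    have h2 : (x ^ s) ^ 2 ≤ (x ^ k) ^ 2 := by gcongr
    rw [← pow_mul, mul_comm 2 k, pow_mul]
    linarith

/-- The z-derivative of z^m contributes at least |z|^(2(m-1)) to the diagonal entry, and σ ≤ m - 1.
So the power |z|^σ, which Λ = (1 + |w|²)^τ does not see, costs nothing for the first coefficient. -/
theorem rpow_sigma_sq_le {Γ : Finset (ℕ × ℕ)} (hΓ : IsHomogeneous Γ) (p : ℂ × ℂ) :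
    (‖p.1‖ ^ (sigma Γ : ℝ)) ^ 2 ≤ 1 + diag₁ Γ p := by
  obtain ⟨m, n, hm, hn, hm', hn', h⟩ := hΓ
  have h1 := rpow_sq_le_one_add (norm_nonneg p.1) (NNReal.coe_nonneg _) (sup_mixed_le hn hm h).1
  have h2 := norm_mono₁_sq (m, 0) (by simp; omega) p
  have h3 : ‖mono₁ (m, 0) p‖ ^ 2 ≤ diag₁ Γ p :=
    Finset.single_le_sum (f := fun a => ‖mono₁ a p‖ ^ 2) (fun _ _ => by positivity) hm'
  simp only [pow_zero, mul_one] at h2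
  linarith

theorem rpow_tau_sq_le {Γ : Finset (ℕ × ℕ)} (hΓ : IsHomogeneous Γ) (p : ℂ × ℂ) :
    (‖p.2‖ ^ (tau Γ : ℝ)) ^ 2 ≤ 1 + diag₂ Γ p := by
  obtain ⟨m, n, hm, hn, hm', hn', h⟩ := hΓ
  have h1 := rpow_sq_le_one_add (norm_nonneg p.2) (NNReal.coe_nonneg _) (sup_mixed_le hn hm h).2
  have h2 := norm_mono₂_sq (0, n) (by simp; omega) p
  have h3 : ‖mono₂ (0, n) p‖ ^ 2 ≤ diag₂ Γ p :=
    Finset.single_le_sum (f := fun a => ‖mono₂ a p‖ ^ 2) (fun _ _ => by positivity) hn'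
  simp only [pow_zero, mul_one] at h2
  linarith

theorem rpow_sq_le_one_add_sq_rpow {x s : ℝ} (hx : 0 ≤ x) (hs : 0 ≤ s) :
    (x ^ s) ^ 2 ≤ (1 + x ^ 2) ^ s := by
  rw [← Real.rpow_natCast, ← Real.rpow_mul hx, mul_comm, Real.rpow_mul hx, Real.rpow_natCast]
  exact Real.rpow_le_rpow (by positivity) (by linarith) hs

/-! ### The uncertainty principle for `∂̄` in one direction -/

theorem IsTest.integrable_norm_sq {f : ℂ × ℂ → ℂ} (hf : IsTest f) {k : ℂ × ℂ → ℝ}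
    (hk : Continuous k) : Integrable fun q => k q * ‖f q‖ ^ 2 := by
  have := hf.1.continuous
  exact Continuous.integrable_of_hasCompactSupport (by fun_prop)
    ((hf.2.comp_left (g := fun z : ℂ => ‖z‖ ^ 2) (by simp)).mul_left)

section Uncertainty

variable {φ Λ : ℂ × ℂ → ℝ} {f l : ℂ × ℂ → ℂ} {e : ℂ × ℂ}

/-- The multiplier `Λ l̄ / (1 + Λ |l|²)`. -/
def multiplier (Λ : ℂ × ℂ → ℝ) (l : ℂ × ℂ → ℂ) (p : ℂ × ℂ) : ℂ :=
  Λ p * conj (l p) * (1 + Λ p * (l p * conj (l p)))⁻¹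

theorem multiplier_denom (p : ℂ × ℂ) :
    1 + (Λ p : ℂ) * (l p * conj (l p)) = ((1 + Λ p * ‖l p‖ ^ 2 : ℝ) : ℂ) := by
  rw [Complex.mul_conj']
  push_cast
  ring

theorem multiplier_denom_ne_zero (h0 : ∀ p, 0 ≤ Λ p) (p : ℂ × ℂ) :
    1 + (Λ p : ℂ) * (l p * conj (l p)) ≠ 0 := by
  have := h0 p
  rw [multiplier_denom]
  exact_mod_cast (by positivity : 1 + Λ p * ‖l p‖ ^ 2 ≠ 0)

theorem contDiff_multiplier (hΛ : ContDiff ℝ ∞ Λ) (h0 : ∀ p, 0 ≤ Λ p) (hl : ContDiff ℝ ∞ l) :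
    ContDiff ℝ ∞ (multiplier Λ l) := by
  have h1 := contDiff_ofReal hΛ
  have h2 := contDiff_conj hl
  exact (h1.mul h2).mul ((contDiff_const.add (h1.mul (hl.mul h2))).inv
    (multiplier_denom_ne_zero h0))

/-- With s = Λ|l|² this is 4s ≤ (1 + s)², multiplied by Λ. -/
theorem norm_multiplier_sq_le (h0 : ∀ p, 0 ≤ Λ p) (p : ℂ × ℂ) :
    4 * ‖multiplier Λ l p‖ ^ 2 ≤ Λ p := by
  have h := h0 p
  have h1 : 0 < 1 + Λ p * ‖l p‖ ^ 2 := by positivity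
  rw [multiplier, multiplier_denom]
  simp only [norm_mul, norm_inv, Complex.norm_real, Real.norm_eq_abs, abs_of_nonneg h,
    abs_of_pos h1, RCLike.norm_conj]
  rw [← div_eq_mul_inv, div_pow, ← mul_div_assoc, div_le_iff₀ (by positivity)]
  nlinarith [mul_nonneg h (sq_nonneg (1 - Λ p * ‖l p‖ ^ 2))]

theorem dbarDir_multiplier (hΛ : ContDiff ℝ ∞ Λ) (h0 : ∀ p, 0 ≤ Λ p) (hl : ContDiff ℝ ∞ l)
    (hΛe : ∀ p, dbarDir e (fun q => (Λ q : ℂ)) p = 0) (hle : ∀ p, dbarDir e l p = 0)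
    (hle' : ∀ p, dDir e l p = 1) (p : ℂ × ℂ) :
    dbarDir e (multiplier Λ l) p = ((Λ p / (1 + Λ p * ‖l p‖ ^ 2) ^ 2 : ℝ) : ℂ) := by
  have d : ∀ {h : ℂ × ℂ → ℂ}, ContDiff ℝ ∞ h → DifferentiableAt ℝ h p :=
    fun hh => hh.differentiable (by simp) p
  have h1 := d (contDiff_ofReal hΛ)
  have h2 := d (contDiff_conj hl)
  have h3 := d hl
  have h4 := d (contDiff_multiplier hΛ h0 hl)
  have h5 : dbarDir e (fun _ : ℂ × ℂ => (1 : ℂ)) p = 0 := by simp [dbarDir]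
  have hne := multiplier_denom_ne_zero (l := l) h0
  -- Differentiating multiplier × denominator = Λ l̄ and solving for the unknown derivative avoids
  -- differentiating an inverse.
  have h6 : (fun q => multiplier Λ l q * (1 + (Λ q : ℂ) * (l q * conj (l q)))) =
      fun q => (Λ q : ℂ) * conj (l q) := funext fun q => by
    rw [multiplier, inv_mul_cancel_right₀ (hne q)]
  have h7 := congrArg (fun F => dbarDir e F p) h6
  rw [dbarDir_mul e p h4 (by fun_prop), dbarDir_add e p (by fun_prop) (by fun_prop),
    dbarDir_mul e p h1 (by fun_prop), dbarDir_mul e p h3 h2, dbarDir_mul e p h1 h2,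
    dbarDir_conj, hΛe, hle, hle', h5, map_one] at h7
  have h8 : dbarDir e (multiplier Λ l) p * (1 + (Λ p : ℂ) * (l p * conj (l p))) =
      Λ p * (1 + (Λ p : ℂ) * (l p * conj (l p)))⁻¹ := by
    have h9 : multiplier Λ l p * l p * (1 + (Λ p : ℂ) * (l p * conj (l p))) =
        (Λ p : ℂ) * (l p * conj (l p)) := by
      rw [multiplier, mul_right_comm, inv_mul_cancel_right₀ (hne p)]
      ring
    have h10 : (Λ p : ℂ) * (1 + (Λ p : ℂ) * (l p * conj (l p)))⁻¹ =
        Λ p - Λ p * (multiplier Λ l p * l p) := by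
      rw [← div_eq_mul_inv, div_eq_iff (hne p)]
      linear_combination (Λ p : ℂ) * h9
    rw [h10]
    linear_combination h7
  have h11 := eq_div_of_mul_eq (hne p) h8
  rw [h11, multiplier_denom]
  have h12 : 0 < 1 + Λ p * ‖l p‖ ^ 2 := by
    have := h0 p
    positivity
  push_cast
  field_simp

/-- Integrating by parts with the multiplier a expresses ∫ (∂̄_e a)|f|² through a f paired with δf
and ∂̄f. Cauchy–Schwarz together with 4|a|² ≤ Λ lets half of ∫ Λ|f|² be absorbed. The function N
makes up for the loss where ∂̄_e a is much smaller than Λ. -/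
theorem integral_le_of_uncertainty (hφ : ContDiff ℝ ∞ φ) (hΛ : ContDiff ℝ ∞ Λ)
    (h0 : ∀ p, 0 ≤ Λ p) (hl : ContDiff ℝ ∞ l)
    (hΛe : ∀ p, dbarDir e (fun q => (Λ q : ℂ)) p = 0) (hle : ∀ p, dbarDir e l p = 0)
    (hle' : ∀ p, dDir e l p = 1) {N : ℂ × ℂ → ℝ} (hN : Continuous N)
    (hΛN : ∀ p, Λ p ≤ 4 * (Λ p / (1 + Λ p * ‖l p‖ ^ 2) ^ 2) + N p) (hf : IsTest f) :
    ∫ q, Λ q * ‖f q‖ ^ 2 * Real.exp (-2 * φ q) ≤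
      ∫ q, (8 * (‖dbarDir e f q‖ ^ 2 + ‖delta φ e f q‖ ^ 2) + 2 * N q * ‖f q‖ ^ 2) *
        Real.exp (-2 * φ q) := by
  set a := multiplier Λ l with ha
  have ca : ContDiff ℝ ∞ a := contDiff_multiplier hΛ h0 hl
  have cW := contDiff_expWeight hφ
  have cφ := hφ.continuous
  have key := integral_mul_delta e hφ ca hf hf
  set G : ℂ × ℂ → ℂ := fun q => conj (a q) * delta φ e f q * conj (f q) * expWeight φ q -
    (conj (a q) * f q * conj (dbarDir e f q) + conj (dbarDir e a q) * f q * conj (f q)) *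
        expWeight φ q with hG
  have i1 : IsTest fun q => conj (a q) * delta φ e f q * conj (f q) * expWeight φ q :=
    (((hf.delta e hφ).mul_left (contDiff_conj ca)).mul_right (contDiff_conj hf.1)).mul_right cW
  have i2 : IsTest fun q => (conj (a q) * f q * conj (dbarDir e f q) +
      conj (dbarDir e a q) * f q * conj (f q)) * expWeight φ q :=
    (((hf.mul_left (contDiff_conj ca)).mul_right (contDiff_conj (hf.dbarDir e).1)).add
      ((hf.mul_left (contDiff_conj (contDiff_dbarDir e ca))).mul_right
        (contDiff_conj hf.1))).mul_right cW
  have hG0 : ∫ q, G q = 0 := by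
    rw [hG, integral_sub i1.integrable i2.integrable, key, sub_self]
  have hGi : Integrable G := i1.integrable.sub i2.integrable
  have hGr : ∫ q, (G q).re = 0 := by
    have := integral_re hGi
    simp only [RCLike.re_to_complex] at this
    rw [this, hG0, Complex.zero_re]
  have cexp : Continuous fun q => Real.exp (-2 * φ q) := by fun_prop
  have cΛ := hΛ.continuous
  have j1 : Integrable fun q => Λ q * ‖f q‖ ^ 2 * Real.exp (-2 * φ q) :=
    (hf.integrable_norm_sq (cΛ.mul cexp)).congr
      (.of_forall fun q => by simp only [Pi.mul_apply]; ring)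
  have j2 : Integrable fun q => (8 * (‖dbarDir e f q‖ ^ 2 + ‖delta φ e f q‖ ^ 2) +
      2 * N q * ‖f q‖ ^ 2) * Real.exp (-2 * φ q) :=
    ((((hf.dbarDir e).integrable_norm_sq (cexp.const_mul 8)).add
      ((hf.delta e hφ).integrable_norm_sq (cexp.const_mul 8))).add
      (hf.integrable_norm_sq ((hN.const_mul 2).mul cexp))).congr
      (.of_forall fun q => by simp only [Pi.add_apply, Pi.mul_apply]; ring)
  have j3 : Integrable fun q => 8 * (G q).re := hGi.re.const_mul 8
  calc _ ≤ ∫ q, ((8 * (‖dbarDir e f q‖ ^ 2 + ‖delta φ e f q‖ ^ 2) + 2 * N q * ‖f q‖ ^ 2) *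
        -- Subtracting 8 Re G changes nothing in the integral, since ∫ G = 0, but makes the
        -- inequality true pointwise.
        Real.exp (-2 * φ q) - 8 * (G q).re) := by
        refine integral_mono j1 (j2.sub j3) fun q => ?_
        have e1 : (G q).re = ((conj (a q) * delta φ e f q * conj (f q)).re -
            (conj (a q) * f q * conj (dbarDir e f q)).re -
            Λ q / (1 + Λ q * ‖l q‖ ^ 2) ^ 2 * ‖f q‖ ^ 2) * Real.exp (-2 * φ q) := by
          rw [hG]
          simp only
          rw [ha, dbarDir_multiplier hΛ h0 hl hΛe hle hle', expWeight_eq_ofReal,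
            Complex.conj_ofReal, mul_assoc _ (f q) (conj (f q)), Complex.mul_conj',
            Complex.sub_re, Complex.re_mul_ofReal, Complex.re_mul_ofReal, Complex.add_re,
            ← Complex.ofReal_pow, ← Complex.ofReal_mul, Complex.ofReal_re]
          ring
        simp only
        rw [e1]
        have b1 : (conj (a q) * delta φ e f q * conj (f q)).re ≤
            ‖a q‖ * ‖delta φ e f q‖ * ‖f q‖ := by
          simpa using Complex.re_le_norm (conj (a q) * delta φ e f q * conj (f q))
        have b2 : -(conj (a q) * f q * conj (dbarDir e f q)).re ≤
            ‖a q‖ * ‖f q‖ * ‖dbarDir e f q‖ := by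
          simpa using Complex.re_le_norm (-(conj (a q) * f q * conj (dbarDir e f q)))
        have b3 := norm_multiplier_sq_le (l := l) h0 q
        rw [← ha] at b3
        have b4 := hΛN q
        rw [← sub_nonneg]
        have b5 : 0 ≤ Λ q * ‖f q‖ ^ 2 - 4 * ‖a q‖ ^ 2 * ‖f q‖ ^ 2 := by
          nlinarith [sq_nonneg ‖f q‖]
        have b6 : 0 ≤ (4 * (Λ q / (1 + Λ q * ‖l q‖ ^ 2) ^ 2) + N q - Λ q) * ‖f q‖ ^ 2 :=
          mul_nonneg (by linarith) (by positivity)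
        -- The two cross terms cost 8|∂̄f|² + 8|δf|² + 4|a|²|f|². By `b5` the last part is at most
        -- Λ|f|², and twice `b6` covers the resulting 2Λ|f|².
        have b7 : 0 ≤ 8 * (‖dbarDir e f q‖ ^ 2 + ‖delta φ e f q‖ ^ 2) + 2 * N q * ‖f q‖ ^ 2 -
            8 * ((conj (a q) * delta φ e f q * conj (f q)).re -
            (conj (a q) * f q * conj (dbarDir e f q)).re -
            Λ q / (1 + Λ q * ‖l q‖ ^ 2) ^ 2 * ‖f q‖ ^ 2) - Λ q * ‖f q‖ ^ 2 := by
          nlinarith [sq_nonneg (2 * ‖delta φ e f q‖ - ‖a q‖ * ‖f q‖),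
            sq_nonneg (2 * ‖dbarDir e f q‖ - ‖a q‖ * ‖f q‖)]
        have b8 := mul_nonneg b7 (Real.exp_pos (-2 * φ q)).le
        linarith
    _ = _ := by
        rw [integral_sub j2 j3, integral_const_mul, hGr, mul_zero, sub_zero]

end Uncertainty

/-! ### The Morrey–Kohn–Hörmander formula and coercivity on test forms -/

/-- The pointwise energy `|∂̄u|² + |∂̄*_φ u|²` of a smooth form. -/
def energyDensity (φ : ℂ × ℂ → ℝ) (u₁ u₂ : ℂ × ℂ → ℂ) (q : ℂ × ℂ) : ℝ :=
  ‖dbarDir (1, 0) u₂ q - dbarDir (0, 1) u₁ q‖ ^ 2 +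
    ‖delta φ (1, 0) u₁ q + delta φ (0, 1) u₂ q‖ ^ 2

/-- The sum of the squares of all antiholomorphic derivatives of the coefficients. -/
def dbarNormSq (u₁ u₂ : ℂ × ℂ → ℂ) (q : ℂ × ℂ) : ℝ :=
  ‖dbarDir (1, 0) u₁ q‖ ^ 2 + ‖dbarDir (0, 1) u₁ q‖ ^ 2 + ‖dbarDir (1, 0) u₂ q‖ ^ 2 +
    ‖dbarDir (0, 1) u₂ q‖ ^ 2

section Commutator

variable {φ : ℂ × ℂ → ℝ} {f g : ℂ × ℂ → ℂ} (e e' : ℂ × ℂ)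

/-- The difference of the two integrands in `integral_delta_mul_conj_delta`. -/
def commDefect (φ : ℂ × ℂ → ℝ) (e e' : ℂ × ℂ) (f g : ℂ × ℂ → ℂ) (q : ℂ × ℂ) : ℂ :=
  delta φ e f q * conj (delta φ e' g q) * expWeight φ q -
    (dbarDir e' f q * conj (dbarDir e g q) + 2 * levi φ e e' q * f q * conj (g q)) * expWeight φ q

theorem commDefect_spec (hφ : ContDiff ℝ ∞ φ) (hf : IsTest f) (hg : IsTest g) :
    Integrable (commDefect φ e e' f g) ∧ ∫ q, commDefect φ e e' f g q = 0 := by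
  have cW := contDiff_expWeight hφ
  have i1 : IsTest fun q => delta φ e f q * conj (delta φ e' g q) * expWeight φ q :=
    ((hf.delta e hφ).mul_right (contDiff_conj (hg.delta e' hφ).1)).mul_right cW
  have i2 : IsTest fun q => (dbarDir e' f q * conj (dbarDir e g q) +
      2 * levi φ e e' q * f q * conj (g q)) * expWeight φ q :=
    (((hf.dbarDir e').mul_right (contDiff_conj (hg.dbarDir e).1)).add
      ((hf.mul_left (contDiff_const.mul (contDiff_levi e e' hφ))).mul_right
        (contDiff_conj hg.1))).mul_right cW
  refine ⟨i1.integrable.sub i2.integrable, ?_⟩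
  unfold commDefect
  rw [integral_sub i1.integrable i2.integrable, integral_delta_mul_conj_delta e e' hφ hf hg,
    sub_self]

/-- The case e = e', f = g of the commutator identity. It removes δf from the uncertainty estimate
in favour of the diagonal of the Levi form. -/
theorem integral_norm_delta_sq (hφ : ContDiff ℝ ∞ φ) (hf : IsTest f) {N : ℂ × ℂ → ℝ}
    (hN : ∀ q, levi φ e e q = N q) (hN' : Continuous N) :
    ∫ q, ‖delta φ e f q‖ ^ 2 * Real.exp (-2 * φ q) =
      ∫ q, (‖dbarDir e f q‖ ^ 2 + 2 * N q * ‖f q‖ ^ 2) * Real.exp (-2 * φ q) := by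
  have cφ := hφ.continuous
  have cexp : Continuous fun q => Real.exp (-2 * φ q) := by fun_prop
  have h1 : Integrable fun q => ‖delta φ e f q‖ ^ 2 * Real.exp (-2 * φ q) :=
    ((hf.delta e hφ).integrable_norm_sq cexp).congr (.of_forall fun q => by ring)
  have h2 : Integrable fun q =>
      (‖dbarDir e f q‖ ^ 2 + 2 * N q * ‖f q‖ ^ 2) * Real.exp (-2 * φ q) :=
    (((hf.dbarDir e).integrable_norm_sq cexp).add
      (hf.integrable_norm_sq ((hN'.const_mul 2).mul cexp))).congr
      (.of_forall fun q => by simp only [Pi.add_apply, Pi.mul_apply]; ring)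
  rw [← sub_eq_zero, ← integral_sub h1 h2, ← Complex.ofReal_eq_zero, ← integral_complex_ofReal,
    ← (commDefect_spec e e hφ hf hf).2]
  congr 1
  funext q
  rw [commDefect, expWeight_eq_ofReal, hN, mul_assoc _ (f q), Complex.mul_conj',
    Complex.mul_conj', Complex.mul_conj']
  push_cast
  ring

/-- Only terms controlled by the Morrey–Kohn–Hörmander formula remain. Replacing 8|δf|² by 8|∂̄f|² +
16N|f|² produces the constants 16 and 16 + 2C. -/
theorem integral_le_of_levi {Λ : ℂ × ℂ → ℝ} {l : ℂ × ℂ → ℂ} {e : ℂ × ℂ} (hφ : ContDiff ℝ ∞ φ)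
    (hΛ : ContDiff ℝ ∞ Λ) (h0 : ∀ p, 0 ≤ Λ p) (hl : ContDiff ℝ ∞ l)
    (hΛe : ∀ p, dbarDir e (fun q => (Λ q : ℂ)) p = 0) (hle : ∀ p, dbarDir e l p = 0)
    (hle' : ∀ p, dDir e l p = 1) {N : ℂ × ℂ → ℝ} (hN' : Continuous N)
    (hN : ∀ q, levi φ e e q = N q) {C : ℝ}
    (hΛN : ∀ p, Λ p ≤ 4 * (Λ p / (1 + Λ p * ‖l p‖ ^ 2) ^ 2) + C * N p) (hf : IsTest f) :
    ∫ q, Λ q * ‖f q‖ ^ 2 * Real.exp (-2 * φ q) ≤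
      ∫ q, (16 * ‖dbarDir e f q‖ ^ 2 + (16 + 2 * C) * N q * ‖f q‖ ^ 2) * Real.exp (-2 * φ q) := by
  have cφ := hφ.continuous
  have cexp : Continuous fun q => Real.exp (-2 * φ q) := by fun_prop
  refine (integral_le_of_uncertainty hφ hΛ h0 hl hΛe hle hle' (hN'.const_mul C) hΛN hf).trans_eq ?_
  have h1 : Integrable fun q => ‖delta φ e f q‖ ^ 2 * Real.exp (-2 * φ q) :=
    ((hf.delta e hφ).integrable_norm_sq cexp).congr (.of_forall fun q => by ring)
  have h2 : Integrable fun q =>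
      (‖dbarDir e f q‖ ^ 2 + 2 * N q * ‖f q‖ ^ 2) * Real.exp (-2 * φ q) :=
    (((hf.dbarDir e).integrable_norm_sq cexp).add
      (hf.integrable_norm_sq ((hN'.const_mul 2).mul cexp))).congr
      (.of_forall fun q => by simp only [Pi.add_apply, Pi.mul_apply]; ring)
  have h3 : Integrable fun q => (16 * ‖dbarDir e f q‖ ^ 2 + (16 + 2 * C) * N q * ‖f q‖ ^ 2) *
      Real.exp (-2 * φ q) :=
    (((hf.dbarDir e).integrable_norm_sq (cexp.const_mul 16)).add
      (hf.integrable_norm_sq ((hN'.const_mul (16 + 2 * C)).mul cexp))).congr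
      (.of_forall fun q => by simp only [Pi.add_apply, Pi.mul_apply]; ring)
  have h4 : Integrable fun q => 8 * (‖delta φ e f q‖ ^ 2 * Real.exp (-2 * φ q) -
      (‖dbarDir e f q‖ ^ 2 + 2 * N q * ‖f q‖ ^ 2) * Real.exp (-2 * φ q)) :=
    (h1.sub h2).const_mul 8
  have h5 := integral_norm_delta_sq e hφ hf hN hN'
  calc _ = ∫ q, ((16 * ‖dbarDir e f q‖ ^ 2 + (16 + 2 * C) * N q * ‖f q‖ ^ 2) *
        Real.exp (-2 * φ q) + 8 * (‖delta φ e f q‖ ^ 2 * Real.exp (-2 * φ q) -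
        (‖dbarDir e f q‖ ^ 2 + 2 * N q * ‖f q‖ ^ 2) * Real.exp (-2 * φ q))) := by
        congr 1
        funext q
        ring
    _ = _ := by
        rw [integral_add h3 h4, integral_const_mul, integral_sub h1 h2, h5, sub_self, mul_zero,
          add_zero]

end Commutator

section TestForms

variable {Γ : Finset (ℕ × ℕ)} {u₁ u₂ : ℂ × ℂ → ℂ}

theorem continuous_mono₁ (a : ℕ × ℕ) : Continuous (mono₁ a) := by
  unfold mono₁
  fun_prop

theorem continuous_mono₂ (a : ℕ × ℕ) : Continuous (mono₂ a) := by
  unfold mono₂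
  fun_prop

theorem continuous_diag₁ : Continuous (diag₁ Γ) :=
  continuous_finsetSum _ fun a _ => ((continuous_mono₁ a).norm).pow 2

theorem continuous_diag₂ : Continuous (diag₂ Γ) :=
  continuous_finsetSum _ fun a _ => ((continuous_mono₂ a).norm).pow 2

theorem continuous_exp_modelWeight : Continuous fun q => Real.exp (-2 * modelWeight Γ q) := by
  fun_prop

theorem integrable_energyDensity (h₁ : IsTest u₁) (h₂ : IsTest u₂) :
    Integrable fun q => energyDensity (modelWeight Γ) u₁ u₂ q *
      Real.exp (-2 * modelWeight Γ q) := by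
  have hφ := contDiff_modelWeight Γ
  exact ((((h₂.dbarDir (1, 0)).sub (h₁.dbarDir (0, 1))).integrable_norm_sq
    continuous_exp_modelWeight).add (((h₁.delta (1, 0) hφ).add
    (h₂.delta (0, 1) hφ)).integrable_norm_sq continuous_exp_modelWeight)).congr
    (.of_forall fun q => by simp only [Pi.add_apply, energyDensity]; ring)

theorem integrable_dbarNormSq (h₁ : IsTest u₁) (h₂ : IsTest u₂) :
    Integrable fun q => dbarNormSq u₁ u₂ q * Real.exp (-2 * modelWeight Γ q) :=
  ((((h₁.dbarDir (1, 0)).integrable_norm_sq continuous_exp_modelWeight).add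
    ((h₁.dbarDir (0, 1)).integrable_norm_sq continuous_exp_modelWeight)).add
    (((h₂.dbarDir (1, 0)).integrable_norm_sq continuous_exp_modelWeight).add
    ((h₂.dbarDir (0, 1)).integrable_norm_sq continuous_exp_modelWeight))).congr
    (.of_forall fun q => by simp only [Pi.add_apply, dbarNormSq]; ring)

theorem integrable_leviForm (h₁ : IsTest u₁) (h₂ : IsTest u₂) :
    Integrable fun q => leviForm Γ q (u₁ q) (u₂ q) * Real.exp (-2 * modelWeight Γ q) := by
  unfold leviForm
  simp only [Finset.sum_mul]
  refine integrable_finsetSum _ fun a _ => ?_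
  have c₁ := h₁.1.continuous
  have c₂ := h₂.1.continuous
  have d₁ := continuous_mono₁ a
  have d₂ := continuous_mono₂ a
  have hs : HasCompactSupport fun q => mono₁ a q * u₁ q + mono₂ a q * u₂ q :=
    h₁.2.mul_left.add h₂.2.mul_left
  exact Continuous.integrable_of_hasCompactSupport (by fun_prop)
    ((hs.comp_left (g := fun z : ℂ => ‖z‖ ^ 2) (by simp)).mul_right)

/-- The Morrey–Kohn–Hörmander formula. -/
theorem integral_energyDensity (h₁ : IsTest u₁) (h₂ : IsTest u₂) :
    ∫ q, energyDensity (modelWeight Γ) u₁ u₂ q * Real.exp (-2 * modelWeight Γ q) =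
      ∫ q, (dbarNormSq u₁ u₂ q + 2 * leviForm Γ q (u₁ q) (u₂ q)) *
        Real.exp (-2 * modelWeight Γ q) := by
  have hφ := contDiff_modelWeight Γ
  have i1 := integrable_energyDensity (Γ := Γ) h₁ h₂
  have i2 : Integrable fun q => (dbarNormSq u₁ u₂ q + 2 * leviForm Γ q (u₁ q) (u₂ q)) *
      Real.exp (-2 * modelWeight Γ q) :=
    ((integrable_dbarNormSq h₁ h₂).add ((integrable_leviForm h₁ h₂).const_mul 2)).congr
      (.of_forall fun q => by simp only [Pi.add_apply]; ring)
  obtain ⟨a1, a2⟩ := commDefect_spec (1, 0) (1, 0) hφ h₁ h₁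
  obtain ⟨b1, b2⟩ := commDefect_spec (0, 1) (0, 1) hφ h₂ h₂
  obtain ⟨c1, c2⟩ := commDefect_spec (1, 0) (0, 1) hφ h₁ h₂
  have d1 : Integrable fun q => conj (commDefect (modelWeight Γ) (1, 0) (0, 1) u₁ u₂ q) :=
    Complex.conjCLE.toContinuousLinearMap.integrable_comp c1
  have d2 : ∫ q, conj (commDefect (modelWeight Γ) (1, 0) (0, 1) u₁ u₂ q) = 0 := by
    rw [integral_conj, c2, map_zero]
  rw [← sub_eq_zero, ← integral_sub i1 i2, ← Complex.ofReal_eq_zero, ← integral_complex_ofReal]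
  -- Expanding both squares, the mixed derivatives of ∂̄u cancel against those produced by commuting
  -- in the mixed product of ∂̄*u; what is left is a sum of defects, each with integral zero.
  have key : ∀ q, ((energyDensity (modelWeight Γ) u₁ u₂ q * Real.exp (-2 * modelWeight Γ q) -
      (dbarNormSq u₁ u₂ q + 2 * leviForm Γ q (u₁ q) (u₂ q)) *
        Real.exp (-2 * modelWeight Γ q) : ℝ) : ℂ) =
      commDefect (modelWeight Γ) (1, 0) (1, 0) u₁ u₁ q +
      commDefect (modelWeight Γ) (0, 1) (0, 1) u₂ u₂ q +
      (commDefect (modelWeight Γ) (1, 0) (0, 1) u₁ u₂ q +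
      conj (commDefect (modelWeight Γ) (1, 0) (0, 1) u₁ u₂ q)) := fun q => by
    simp only [Complex.ofReal_sub, Complex.ofReal_mul, Complex.ofReal_add, leviForm_eq,
      energyDensity, dbarNormSq, Complex.ofReal_pow, ← Complex.mul_conj', commDefect, map_sub,
      map_mul, map_add, Complex.conj_conj, conj_expWeight, ← expWeight_eq_ofReal,
      Complex.ofReal_ofNat, Complex.conj_ofNat]
    ring
  simp only [key]
  have a3 : Integrable fun q => commDefect (modelWeight Γ) (1, 0) (1, 0) u₁ u₁ q +
      commDefect (modelWeight Γ) (0, 1) (0, 1) u₂ u₂ q := a1.add b1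
  have c3 : Integrable fun q => commDefect (modelWeight Γ) (1, 0) (0, 1) u₁ u₂ q +
      conj (commDefect (modelWeight Γ) (1, 0) (0, 1) u₁ u₂ q) := c1.add d1
  rw [integral_add a3 c3, integral_add a1 b1, integral_add c1 d1, a2, b2, c2, d2]
  simp

/-- The total weighted energy of a smooth form. -/
def testEnergy (Γ : Finset (ℕ × ℕ)) (u₁ u₂ : ℂ × ℂ → ℂ) : ℝ :=
  ∫ q, energyDensity (modelWeight Γ) u₁ u₂ q * Real.exp (-2 * modelWeight Γ q)

theorem integral_le_testEnergy (h₁ : IsTest u₁) (h₂ : IsTest u₂) {F : ℂ × ℂ → ℝ} {K : ℝ}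
    (hF : Integrable fun q => F q * Real.exp (-2 * modelWeight Γ q))
    (h : ∀ q, F q ≤ K * (dbarNormSq u₁ u₂ q + 2 * leviForm Γ q (u₁ q) (u₂ q))) :
    ∫ q, F q * Real.exp (-2 * modelWeight Γ q) ≤ K * testEnergy Γ u₁ u₂ := by
  rw [testEnergy, integral_energyDensity h₁ h₂, ← integral_const_mul]
  refine integral_mono hF ?_ fun q => ?_
  · exact (((integrable_dbarNormSq h₁ h₂).add ((integrable_leviForm h₁ h₂).const_mul 2)).const_mul
      K).congr (.of_forall fun q => by simp only [Pi.add_apply]; ring)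
  · have := mul_le_mul_of_nonneg_right (h q) (Real.exp_pos (-2 * modelWeight Γ q)).le
    linarith

/-! ### Estimates for the individual coefficients of a test form -/

theorem contDiff_rpow_one_add_norm_sq {g : ℂ × ℂ → ℂ} (hg : ContDiff ℝ ∞ g) (s : ℝ) :
    ContDiff ℝ ∞ fun p => (1 + ‖g p‖ ^ 2) ^ s :=
  (contDiff_const.add (hg.norm_sq ℝ)).rpow_const_of_ne fun p => by positivity

/-- With x = Λ and y = |l|², this is the dichotomy tube/complement: for xy ≤ 1 the denominator is at
most 4, and for xy ≥ 1 the diagonal of the Levi form takes over. -/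
theorem le_four_mul_div_add {x y N C : ℝ} (hx : 0 ≤ x) (hy : 0 ≤ y) (hN : 0 ≤ N) (hC : 0 < C)
    (h : 1 ≤ x * y → C * x ≤ N) : x ≤ 4 * (x / (1 + x * y) ^ 2) + C⁻¹ * N := by
  have hxy : 0 ≤ x * y := mul_nonneg hx hy
  rcases le_total 1 (x * y) with h1 | h1
  · have h2 : x ≤ C⁻¹ * N := by
      rw [le_inv_mul_iff₀ hC]
      exact h h1
    have : 0 ≤ 4 * (x / (1 + x * y) ^ 2) := by positivity
    linarith
  · have h2 : x ≤ 4 * (x / (1 + x * y) ^ 2) := by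
      rw [← mul_div_assoc, le_div_iff₀ (by positivity)]
      have : (1 + x * y) ^ 2 ≤ 4 := by nlinarith
      nlinarith
    have : 0 ≤ C⁻¹ * N := by positivity
    linarith

theorem differentiable_rpow_one_add_norm_sq (s : ℝ) :
    Differentiable ℝ fun w : ℂ => (((1 + ‖w‖ ^ 2) ^ s : ℝ) : ℂ) := by
  have : ContDiff ℝ ∞ fun w : ℂ => (((1 + ‖w‖ ^ 2) ^ s : ℝ) : ℂ) :=
    Complex.ofRealCLM.contDiff.comp ((contDiff_const.add
      (contDiff_id.norm_sq ℝ)).rpow_const_of_ne fun p => by positivity)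
  exact this.differentiable (by simp)

/-- The uncertainty principle in the z-direction with l = z; Λ depends on w alone, so it is a
constant for ∂/∂z̄. The factor 4 · card Γ in the constant comes from `diag_le_leviForm`. -/
theorem exists_integral_le₁ (hΓ : IsHomogeneous Γ) : ∃ K : ℝ, 0 ≤ K ∧ ∀ u₁ u₂ : ℂ × ℂ → ℂ,
    IsTest u₁ → IsTest u₂ → ∫ q, (1 + ‖q.2‖ ^ 2) ^ (tau Γ : ℝ) * ‖u₁ q‖ ^ 2 *
      Real.exp (-2 * modelWeight Γ q) ≤ K * testEnergy Γ u₁ u₂ := by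
  obtain ⟨c, hc, hcd⟩ := exists_mul_le_diag₁ hΓ
  have hΛ : ContDiff ℝ ∞ fun p : ℂ × ℂ => (1 + ‖p.2‖ ^ 2) ^ (tau Γ : ℝ) :=
    contDiff_rpow_one_add_norm_sq contDiff_snd _
  have hΛe : ∀ p, dbarDir (1, 0)
      (fun q : ℂ × ℂ => (((1 + ‖q.2‖ ^ 2) ^ (tau Γ : ℝ) : ℝ) : ℂ)) p = 0 := fun p => by
    have h := ((differentiable_rpow_one_add_norm_sq (tau Γ) p.2).hasFDerivAt.comp p
      (hasFDerivAt_snd (𝕜 := ℝ))).fderiv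
    unfold dbarDir
    erw [h]
    simp
  have hl : ∀ p, DifferentiableAt ℂ (fun q : ℂ × ℂ => q.1) p := fun p => by fun_prop
  refine ⟨16 + (16 + 2 * c⁻¹) * (4 * Γ.card), by positivity, fun u₁ u₂ h₁ h₂ => ?_⟩
  have h : IsTest u₁ := h₁
  refine (integral_le_of_levi (contDiff_modelWeight Γ) hΛ (fun p => by positivity)
    contDiff_fst hΛe (fun p => dbarDir_of_differentiableAt _ _ (hl p))
    (fun p => by
      rw [dDir_of_differentiableAt _ _ (hl p), (hasFDerivAt_fst (𝕜 := ℂ) (p := p)).fderiv]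
      simp) continuous_diag₁ (levi_one_one Γ)
    (fun p => le_four_mul_div_add (by positivity) (by positivity) (diag₁_nonneg Γ p) hc (hcd p))
    h).trans (integral_le_testEnergy h₁ h₂ ?_ fun q => ?_)
  · exact (((h.dbarDir (1, 0)).integrable_norm_sq (continuous_exp_modelWeight.const_mul 16)).add
      (h.integrable_norm_sq ((continuous_diag₁.const_mul (16 + 2 * c⁻¹)).mul
        continuous_exp_modelWeight))).congr
      (.of_forall fun q => by simp only [Pi.add_apply, Pi.mul_apply]; ring)
  · have k1 := (diag_le_leviForm hΓ q (u₁ q) (u₂ q)).1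
    have k2 := leviForm_nonneg Γ q (u₁ q) (u₂ q)
    have k3 : ‖dbarDir (1, 0) u₁ q‖ ^ 2 ≤ dbarNormSq u₁ u₂ q := by
      unfold dbarNormSq
      nlinarith [sq_nonneg ‖dbarDir (1, 0) u₁ q‖, sq_nonneg ‖dbarDir (0, 1) u₁ q‖,
        sq_nonneg ‖dbarDir (1, 0) u₂ q‖, sq_nonneg ‖dbarDir (0, 1) u₂ q‖]
    have k4 : 0 ≤ dbarNormSq u₁ u₂ q := (sq_nonneg _).trans k3
    have k5 : (16 + 2 * c⁻¹) * (diag₁ Γ q * ‖u₁ q‖ ^ 2) ≤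
        (16 + 2 * c⁻¹) * (4 * Γ.card * leviForm Γ q (u₁ q) (u₂ q)) := by gcongr
    have k6 : 0 ≤ (16 + 2 * c⁻¹) * (4 * Γ.card) * (dbarNormSq u₁ u₂ q) := by positivity
    have k7 : 0 ≤ (16 + 2 * c⁻¹) * (4 * Γ.card) * leviForm Γ q (u₁ q) (u₂ q) := by positivity
    linarith

theorem exists_integral_le₂ (hΓ : IsHomogeneous Γ) : ∃ K : ℝ, 0 ≤ K ∧ ∀ u₁ u₂ : ℂ × ℂ → ℂ,
    IsTest u₁ → IsTest u₂ → ∫ q, (1 + ‖q.1‖ ^ 2) ^ (sigma Γ : ℝ) * ‖u₂ q‖ ^ 2 *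
      Real.exp (-2 * modelWeight Γ q) ≤ K * testEnergy Γ u₁ u₂ := by
  obtain ⟨c, hc, hcd⟩ := exists_mul_le_diag₂ hΓ
  have hΛ : ContDiff ℝ ∞ fun p : ℂ × ℂ => (1 + ‖p.1‖ ^ 2) ^ (sigma Γ : ℝ) :=
    contDiff_rpow_one_add_norm_sq contDiff_fst _
  have hΛe : ∀ p, dbarDir (0, 1)
      (fun q : ℂ × ℂ => (((1 + ‖q.1‖ ^ 2) ^ (sigma Γ : ℝ) : ℝ) : ℂ)) p = 0 := fun p => by
    have h := ((differentiable_rpow_one_add_norm_sq (sigma Γ) p.1).hasFDerivAt.comp p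
      (hasFDerivAt_fst (𝕜 := ℝ))).fderiv
    unfold dbarDir
    erw [h]
    simp
  have hl : ∀ p, DifferentiableAt ℂ (fun q : ℂ × ℂ => q.2) p := fun p => by fun_prop
  refine ⟨16 + (16 + 2 * c⁻¹) * (4 * Γ.card), by positivity, fun u₁ u₂ h₁ h₂ => ?_⟩
  have h : IsTest u₂ := h₂
  refine (integral_le_of_levi (contDiff_modelWeight Γ) hΛ (fun p => by positivity)
    contDiff_snd hΛe (fun p => dbarDir_of_differentiableAt _ _ (hl p))
    (fun p => by
      rw [dDir_of_differentiableAt _ _ (hl p), (hasFDerivAt_snd (𝕜 := ℂ) (p := p)).fderiv]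
      simp) continuous_diag₂ (levi_two_two Γ)
    (fun p => le_four_mul_div_add (by positivity) (by positivity) (diag₂_nonneg Γ p) hc (hcd p))
    h).trans (integral_le_testEnergy h₁ h₂ ?_ fun q => ?_)
  · exact (((h.dbarDir (0, 1)).integrable_norm_sq (continuous_exp_modelWeight.const_mul 16)).add
      (h.integrable_norm_sq ((continuous_diag₂.const_mul (16 + 2 * c⁻¹)).mul
        continuous_exp_modelWeight))).congr
      (.of_forall fun q => by simp only [Pi.add_apply, Pi.mul_apply]; ring)
  · have k1 := (diag_le_leviForm hΓ q (u₁ q) (u₂ q)).2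
    have k2 := leviForm_nonneg Γ q (u₁ q) (u₂ q)
    have k3 : ‖dbarDir (0, 1) u₂ q‖ ^ 2 ≤ dbarNormSq u₁ u₂ q := by
      unfold dbarNormSq
      nlinarith [sq_nonneg ‖dbarDir (1, 0) u₁ q‖, sq_nonneg ‖dbarDir (0, 1) u₁ q‖,
        sq_nonneg ‖dbarDir (1, 0) u₂ q‖, sq_nonneg ‖dbarDir (0, 1) u₂ q‖]
    have k4 : 0 ≤ dbarNormSq u₁ u₂ q := (sq_nonneg _).trans k3
    have k5 : (16 + 2 * c⁻¹) * (diag₂ Γ q * ‖u₂ q‖ ^ 2) ≤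
        (16 + 2 * c⁻¹) * (4 * Γ.card * leviForm Γ q (u₁ q) (u₂ q)) := by gcongr
    have k6 : 0 ≤ (16 + 2 * c⁻¹) * (4 * Γ.card) * (dbarNormSq u₁ u₂ q) := by positivity
    have k7 : 0 ≤ (16 + 2 * c⁻¹) * (4 * Γ.card) * leviForm Γ q (u₁ q) (u₂ q) := by positivity
    linarith


/-- The multiplier of the main theorem, up to a constant. -/
def growth (Γ : Finset (ℕ × ℕ)) (p : ℂ × ℂ) : ℝ :=
  1 + ‖p.1‖ ^ (sigma Γ : ℝ) + ‖p.2‖ ^ (tau Γ : ℝ)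

theorem continuous_growth : Continuous (growth Γ) :=
  (continuous_const.add (continuous_fst.norm.rpow_const fun _ => Or.inr (NNReal.coe_nonneg _))).add
    (continuous_snd.norm.rpow_const fun _ => Or.inr (NNReal.coe_nonneg _))

/-- For each coefficient one of the two powers is controlled by its Λ and the other by the diagonal
entry. Starting from (a + b + c)² ≤ 3(a² + b² + c²), the three remaining contributions are each at
most 3Λ, since Λ ≥ 1. -/
theorem growth_sq_le (hΓ : IsHomogeneous Γ) (p : ℂ × ℂ) :
    growth Γ p ^ 2 ≤ 9 * (1 + ‖p.2‖ ^ 2) ^ (tau Γ : ℝ) + 3 * diag₁ Γ p ∧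
      growth Γ p ^ 2 ≤ 9 * (1 + ‖p.1‖ ^ 2) ^ (sigma Γ : ℝ) + 3 * diag₂ Γ p := by
  have h1 : growth Γ p ^ 2 ≤
      3 * (1 + (‖p.1‖ ^ (sigma Γ : ℝ)) ^ 2 + (‖p.2‖ ^ (tau Γ : ℝ)) ^ 2) := by
    unfold growth
    nlinarith [sq_nonneg (1 - ‖p.1‖ ^ (sigma Γ : ℝ)), sq_nonneg (1 - ‖p.2‖ ^ (tau Γ : ℝ)),
      sq_nonneg (‖p.1‖ ^ (sigma Γ : ℝ) - ‖p.2‖ ^ (tau Γ : ℝ))]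
  have h2 := rpow_sigma_sq_le hΓ p
  have h3 := rpow_tau_sq_le hΓ p
  have h4 := rpow_sq_le_one_add_sq_rpow (norm_nonneg p.1) (NNReal.coe_nonneg (sigma Γ))
  have h5 := rpow_sq_le_one_add_sq_rpow (norm_nonneg p.2) (NNReal.coe_nonneg (tau Γ))
  have h6 : 1 ≤ (1 + ‖p.1‖ ^ 2) ^ (sigma Γ : ℝ) :=
    Real.one_le_rpow (by nlinarith [sq_nonneg ‖p.1‖]) (NNReal.coe_nonneg _)
  have h7 : 1 ≤ (1 + ‖p.2‖ ^ 2) ^ (tau Γ : ℝ) :=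
    Real.one_le_rpow (by nlinarith [sq_nonneg ‖p.2‖]) (NNReal.coe_nonneg _)
  constructor <;> linarith

/-- Coercivity on test forms. -/
theorem exists_integral_growth_le (hΓ : IsHomogeneous Γ) : ∃ K : ℝ, 0 ≤ K ∧
    ∀ u₁ u₂ : ℂ × ℂ → ℂ, IsTest u₁ → IsTest u₂ →
      ∫ q, growth Γ q ^ 2 * (‖u₁ q‖ ^ 2 + ‖u₂ q‖ ^ 2) * Real.exp (-2 * modelWeight Γ q) ≤
        K * testEnergy Γ u₁ u₂ := by
  obtain ⟨K₁, hK₁, hK₁'⟩ := exists_integral_le₁ hΓ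
  obtain ⟨K₂, hK₂, hK₂'⟩ := exists_integral_le₂ hΓ
  refine ⟨9 * K₁ + 9 * K₂ + 12 * Γ.card, by positivity, fun u₁ u₂ h₁ h₂ => ?_⟩
  have cg := (continuous_growth (Γ := Γ)).pow 2
  have cexp := continuous_exp_modelWeight (Γ := Γ)
  have cΛ₁ : Continuous fun p : ℂ × ℂ => (1 + ‖p.2‖ ^ 2) ^ (tau Γ : ℝ) :=
    (contDiff_rpow_one_add_norm_sq contDiff_snd _).continuous
  have cΛ₂ : Continuous fun p : ℂ × ℂ => (1 + ‖p.1‖ ^ 2) ^ (sigma Γ : ℝ) :=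
    (contDiff_rpow_one_add_norm_sq contDiff_fst _).continuous
  have i0 : Integrable fun q => growth Γ q ^ 2 * (‖u₁ q‖ ^ 2 + ‖u₂ q‖ ^ 2) *
      Real.exp (-2 * modelWeight Γ q) :=
    ((h₁.integrable_norm_sq (cg.mul cexp)).add (h₂.integrable_norm_sq (cg.mul cexp))).congr
      (.of_forall fun q => by simp only [Pi.add_apply, Pi.mul_apply, Pi.pow_apply]; ring)
  have i1 : Integrable fun q => 9 * ((1 + ‖q.2‖ ^ 2) ^ (tau Γ : ℝ) * ‖u₁ q‖ ^ 2 *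
      Real.exp (-2 * modelWeight Γ q)) :=
    ((h₁.integrable_norm_sq (cΛ₁.mul cexp)).const_mul 9).congr
      (.of_forall fun q => by simp only [Pi.mul_apply]; ring)
  have i2 : Integrable fun q => 9 * ((1 + ‖q.1‖ ^ 2) ^ (sigma Γ : ℝ) * ‖u₂ q‖ ^ 2 *
      Real.exp (-2 * modelWeight Γ q)) :=
    ((h₂.integrable_norm_sq (cΛ₂.mul cexp)).const_mul 9).congr
      (.of_forall fun q => by simp only [Pi.mul_apply]; ring)
  have i3 : Integrable fun q => (3 * diag₁ Γ q * ‖u₁ q‖ ^ 2 + 3 * diag₂ Γ q * ‖u₂ q‖ ^ 2) *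
      Real.exp (-2 * modelWeight Γ q) :=
    ((h₁.integrable_norm_sq ((continuous_diag₁.const_mul 3).mul cexp)).add
      (h₂.integrable_norm_sq ((continuous_diag₂.const_mul 3).mul cexp))).congr
      (.of_forall fun q => by simp only [Pi.add_apply, Pi.mul_apply]; ring)
  have h3 := integral_le_testEnergy (K := 12 * Γ.card) h₁ h₂ i3 fun q => by
    obtain ⟨k1, k2⟩ := diag_le_leviForm hΓ q (u₁ q) (u₂ q)
    have k4 : 0 ≤ 12 * Γ.card * dbarNormSq u₁ u₂ q := by
      unfold dbarNormSq
      positivity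
    linarith
  calc _ ≤ ∫ q, (9 * ((1 + ‖q.2‖ ^ 2) ^ (tau Γ : ℝ) * ‖u₁ q‖ ^ 2 *
        Real.exp (-2 * modelWeight Γ q)) + 9 * ((1 + ‖q.1‖ ^ 2) ^ (sigma Γ : ℝ) * ‖u₂ q‖ ^ 2 *
        Real.exp (-2 * modelWeight Γ q)) +
        (3 * diag₁ Γ q * ‖u₁ q‖ ^ 2 + 3 * diag₂ Γ q * ‖u₂ q‖ ^ 2) *
        Real.exp (-2 * modelWeight Γ q)) := by
        refine integral_mono i0 ((i1.add i2).add i3) fun q => ?_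
        obtain ⟨k1, k2⟩ := growth_sq_le hΓ q
        have k3 := mul_le_mul_of_nonneg_right k1 (sq_nonneg ‖u₁ q‖)
        have k4 := mul_le_mul_of_nonneg_right k2 (sq_nonneg ‖u₂ q‖)
        have k5 := mul_le_mul_of_nonneg_right (add_le_add k3 k4)
          (Real.exp_pos (-2 * modelWeight Γ q)).le
        linarith
    _ ≤ _ := by
        have i12 := i1.add i2
        simp only [Pi.add_def] at i12
        rw [integral_add i12 i3, integral_add i1 i2, integral_const_mul, integral_const_mul]
        linarith [hK₁' u₁ u₂ h₁ h₂, hK₂' u₁ u₂ h₁ h₂]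

end TestForms

/-! ### A dominated Fatou lemma -/

/-- If `∫ Aₙ ≤ ∫ Bₙ`, `0 ≤ Bₙ ≤ Fₙ`, and `∫ Fₙ ≤ ∫ F` where `F` is the limit of `Fₙ`, then the
inequality passes to the pointwise limits of `Aₙ` and `Bₙ`. -/
theorem lintegral_limit_le {α : Type*} [MeasurableSpace α] {μ : Measure α} {A B F : α → ℝ}
    {An Bn Fn : ℕ → α → ℝ} (hA0 : ∀ n x, 0 ≤ An n x) (hB0 : ∀ n x, 0 ≤ Bn n x)
    (hBF : ∀ n, ∀ᵐ x ∂μ, Bn n x ≤ Fn n x) (hAm : ∀ n, AEStronglyMeasurable (An n) μ)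
    (hBm : ∀ n, AEStronglyMeasurable (Bn n) μ) (hFi : ∀ n, Integrable (Fn n) μ)
    (hF : Integrable F μ) (hAB : ∀ n, ∫⁻ x, .ofReal (An n x) ∂μ ≤ ∫⁻ x, .ofReal (Bn n x) ∂μ)
    (hFF : ∀ n, ∫ x, Fn n x ∂μ ≤ ∫ x, F x ∂μ)
    (lA : ∀ᵐ x ∂μ, Tendsto (fun n => An n x) atTop (𝓝 (A x)))
    (lB : ∀ᵐ x ∂μ, Tendsto (fun n => Bn n x) atTop (𝓝 (B x)))
    (lF : ∀ᵐ x ∂μ, Tendsto (fun n => Fn n x) atTop (𝓝 (F x))) :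
    ∫⁻ x, .ofReal (A x) ∂μ ≤ ∫⁻ x, .ofReal (B x) ∂μ := by
  have hBF' : ∀ᵐ x ∂μ, B x ≤ F x := by
    filter_upwards [lB, lF, ae_all_iff.2 hBF] with x h1 h2 h3
    exact le_of_tendsto_of_tendsto' h1 h2 h3
  have hB0' : ∀ᵐ x ∂μ, 0 ≤ B x := by
    filter_upwards [lB] with x h1
    exact ge_of_tendsto' h1 fun n => hB0 n x
  have hBm' : AEStronglyMeasurable B μ := aestronglyMeasurable_of_tendsto_ae atTop hBm lB
  have hAm' : AEStronglyMeasurable A μ := aestronglyMeasurable_of_tendsto_ae atTop hAm lA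
  have hFB : ∀ n, ∫⁻ x, .ofReal (Fn n x) ∂μ ≤ ∫⁻ x, .ofReal (F x) ∂μ := fun n => by
    rw [← ofReal_integral_eq_lintegral_ofReal (hFi n)
      ((hBF n).mono fun x hx => (hB0 n x).trans hx), ← ofReal_integral_eq_lintegral_ofReal hF
      (by filter_upwards [hB0', hBF'] with x h1 h2 using h1.trans h2)]
    exact ENNReal.ofReal_le_ofReal (hFF n)
  have hBfin : ∫⁻ x, .ofReal (F x - B x) ∂μ ≠ ⊤ := by
    refine ne_top_of_le_ne_top hF.lintegral_lt_top.ne (lintegral_mono_ae ?_)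
    filter_upwards [hB0'] with x hx
    exact ENNReal.ofReal_le_ofReal (by linarith)
  -- Fatou's lemma is applied to the nonnegative functions Aₙ + (Fₙ - Bₙ); the finite integral of F
  -- - B is cancelled at the end.
  have hn : ∀ n, ∫⁻ x, .ofReal (An n x + (Fn n x - Bn n x)) ∂μ ≤ ∫⁻ x, .ofReal (F x) ∂μ := by
    intro n
    calc _ = ∫⁻ x, .ofReal (An n x) ∂μ + ∫⁻ x, .ofReal (Fn n x - Bn n x) ∂μ := by
          rw [← lintegral_add_left' (hAm n).aemeasurable.ennreal_ofReal]
          refine lintegral_congr_ae ((hBF n).mono fun x hx => ?_)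
          exact ENNReal.ofReal_add (hA0 n x) (by linarith)
      _ ≤ ∫⁻ x, .ofReal (Bn n x) ∂μ + ∫⁻ x, .ofReal (Fn n x - Bn n x) ∂μ := by
          exact add_le_add_left (hAB n) _
      _ = ∫⁻ x, .ofReal (Fn n x) ∂μ := by
          rw [← lintegral_add_left' (hBm n).aemeasurable.ennreal_ofReal]
          refine lintegral_congr_ae ((hBF n).mono fun x hx => ?_)
          simp only
          rw [← ENNReal.ofReal_add (hB0 n x) (by linarith)]
          congr 1
          ring
      _ ≤ _ := hFB n
  have key : ∫⁻ x, .ofReal (A x + (F x - B x)) ∂μ ≤ ∫⁻ x, .ofReal (F x) ∂μ := by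
    calc _ = ∫⁻ x, liminf (fun n => ENNReal.ofReal (An n x + (Fn n x - Bn n x))) atTop ∂μ := by
          refine lintegral_congr_ae ?_
          filter_upwards [lA, lB, lF] with x h1 h2 h3
          exact ((ENNReal.continuous_ofReal.tendsto _).comp
            (h1.add (h3.sub h2))).liminf_eq.symm
      _ ≤ liminf (fun n => ∫⁻ x, .ofReal (An n x + (Fn n x - Bn n x)) ∂μ) atTop :=
          lintegral_liminf_le' fun n => ((hAm n).aemeasurable.add
            ((hFi n).aemeasurable.sub (hBm n).aemeasurable)).ennreal_ofReal
      _ ≤ _ := by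
          refine liminf_le_of_frequently_le' (Frequently.of_forall hn)
  have e1 : ∫⁻ x, .ofReal (A x + (F x - B x)) ∂μ =
      ∫⁻ x, .ofReal (A x) ∂μ + ∫⁻ x, .ofReal (F x - B x) ∂μ := by
    rw [← lintegral_add_left' hAm'.aemeasurable.ennreal_ofReal]
    refine lintegral_congr_ae ?_
    filter_upwards [lA, hBF'] with x h1 h2
    exact ENNReal.ofReal_add (ge_of_tendsto' h1 fun n => hA0 n x) (by linarith)
  have e2 : ∫⁻ x, .ofReal (F x) ∂μ =
      ∫⁻ x, .ofReal (B x) ∂μ + ∫⁻ x, .ofReal (F x - B x) ∂μ := by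
    rw [← lintegral_add_left' hBm'.aemeasurable.ennreal_ofReal]
    refine lintegral_congr_ae ?_
    filter_upwards [hB0', hBF'] with x h1 h2
    rw [← ENNReal.ofReal_add h1 (by linarith)]
    congr 1
    ring
  rw [e1, e2] at key
  exact (ENNReal.add_le_add_iff_right hBfin).1 key

/-! ### Mollification -/

/-- Convolution with a normalized bump function. -/
def mollify (b : ContDiffBump (0 : ℂ × ℂ)) (u : ℂ × ℂ → ℂ) : ℂ × ℂ → ℂ :=
  u ⋆[ContinuousLinearMap.mul ℝ ℂ, volume] fun x => (b.normed volume x : ℂ)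

section Mollify

variable (b : ContDiffBump (0 : ℂ × ℂ)) {u : ℂ × ℂ → ℂ}

theorem mollify_apply (x : ℂ × ℂ) :
    mollify b u x = ∫ t, u t * (b.normed volume (x - t) : ℂ) := rfl

theorem isTest_normed : IsTest fun x => (b.normed volume x : ℂ) :=
  ⟨Complex.ofRealCLM.contDiff.comp b.contDiff_normed,
    b.hasCompactSupport_normed.comp_left (g := fun x : ℝ => (x : ℂ)) Complex.ofReal_zero⟩

theorem isTest_normed_sub (x : ℂ × ℂ) : IsTest fun t => (b.normed volume (x - t) : ℂ) := by
  refine ⟨(isTest_normed b).1.comp (contDiff_const.sub contDiff_id), ?_⟩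
  exact (isTest_normed b).2.comp_homeomorph (Homeomorph.subLeft x)

theorem isTest_mollify (hu : LocallyIntegrable u) (hc : HasCompactSupport u) :
    IsTest (mollify b u) :=
  ⟨(isTest_normed b).2.contDiff_convolution_right (n := (⊤ : ℕ∞)) _ hu (isTest_normed b).1,
    hc.convolution _ (isTest_normed b).2⟩

theorem fderiv_mollify (hu : LocallyIntegrable u) (x v : ℂ × ℂ) :
    fderiv ℝ (mollify b u) x v =
      ∫ t, u t * fderiv ℝ (fun x => (b.normed volume x : ℂ)) (x - t) v := by
  have h := ((isTest_normed b).2.hasFDerivAt_convolution_right (ContinuousLinearMap.mul ℝ ℂ) hu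
    ((isTest_normed b).1.of_le (by simp)) x).fderiv
  unfold mollify
  rw [h, convolution_precompR_apply _ hu ((isTest_normed b).2.fderiv (𝕜 := ℝ))
    ((isTest_normed b).1.continuous_fderiv (by simp))]
  rfl

theorem fderiv_normed_sub (x t v : ℂ × ℂ) :
    fderiv ℝ (fun t => (b.normed volume (x - t) : ℂ)) t v =
      -fderiv ℝ (fun x => (b.normed volume x : ℂ)) (x - t) v := by
  have h1 : HasFDerivAt (fun t : ℂ × ℂ => x - t) (-ContinuousLinearMap.id ℝ (ℂ × ℂ)) t :=
    (hasFDerivAt_id t).const_sub x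
  have h2 := (((isTest_normed b).1.differentiable (by simp)) (x - t)).hasFDerivAt
  have h3 := (h2.comp t h1).fderiv
  erw [h3]
  simp

theorem integrable_mul_test (hu : LocallyIntegrable u) {k : ℂ × ℂ → ℂ} (hk : Continuous k)
    (hk' : HasCompactSupport k) : Integrable fun t => u t * k t :=
  hu.integrable_smul_right_of_hasCompactSupport hk hk'

/-- The derivative falls on the kernel, the sign coming from t ↦ x - t. In this form the kernel is a
test function in t, to which a weak equation for u applies directly. -/
theorem dbarDir_mollify (hu : LocallyIntegrable u) (e x : ℂ × ℂ) :
    dbarDir e (mollify b u) x =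
      -∫ t, u t * dbarDir e (fun t => (b.normed volume (x - t) : ℂ)) t := by
  have hT := isTest_normed_sub b x
  have hi : ∀ v, Integrable fun t => u t * fderiv ℝ (fun t => (b.normed volume (x - t) : ℂ)) t v :=
    fun v => integrable_mul_test hu (by
      have := hT.1.continuous_fderiv (by simp)
      fun_prop) (hT.2.fderiv_apply (𝕜 := ℝ) v)
  have h1 : ∀ v, fderiv ℝ (mollify b u) x v =
      -∫ t, u t * fderiv ℝ (fun t => (b.normed volume (x - t) : ℂ)) t v := fun v => by
    rw [fderiv_mollify b hu, ← integral_neg]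
    simp [fderiv_normed_sub]
  have h2 : ∀ t, u t * dbarDir e (fun t => (b.normed volume (x - t) : ℂ)) t =
      (1 / 2 : ℂ) * (u t * fderiv ℝ (fun t => (b.normed volume (x - t) : ℂ)) t e +
      Complex.I * (u t * fderiv ℝ (fun t => (b.normed volume (x - t) : ℂ)) t (Complex.I • e))) :=
    fun t => by rw [dbarDir]; ring
  simp only [h2]
  rw [integral_const_mul, integral_add (hi _) ((hi _).const_mul _), integral_const_mul, dbarDir,
    h1, h1]
  ring

theorem dDir_mollify (hu : LocallyIntegrable u) (e x : ℂ × ℂ) :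
    dDir e (mollify b u) x =
      -∫ t, u t * dDir e (fun t => (b.normed volume (x - t) : ℂ)) t := by
  have hT := isTest_normed_sub b x
  have hi : ∀ v, Integrable fun t => u t * fderiv ℝ (fun t => (b.normed volume (x - t) : ℂ)) t v :=
    fun v => integrable_mul_test hu (by
      have := hT.1.continuous_fderiv (by simp)
      fun_prop) (hT.2.fderiv_apply (𝕜 := ℝ) v)
  have h1 : ∀ v, fderiv ℝ (mollify b u) x v =
      -∫ t, u t * fderiv ℝ (fun t => (b.normed volume (x - t) : ℂ)) t v := fun v => by
    rw [fderiv_mollify b hu, ← integral_neg]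
    simp [fderiv_normed_sub]
  have h2 : ∀ t, u t * dDir e (fun t => (b.normed volume (x - t) : ℂ)) t =
      (1 / 2 : ℂ) * (u t * fderiv ℝ (fun t => (b.normed volume (x - t) : ℂ)) t e -
      Complex.I * (u t * fderiv ℝ (fun t => (b.normed volume (x - t) : ℂ)) t (Complex.I • e))) :=
    fun t => by rw [dDir]; ring
  simp only [h2]
  rw [integral_const_mul, integral_sub (hi _) ((hi _).const_mul _), integral_const_mul, dDir,
    h1, h1]
  ring

theorem integral_normed_sub (x : ℂ × ℂ) : ∫ t, b.normed volume (x - t) = 1 := by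
  rw [integral_sub_left_eq_self (fun t => b.normed volume t) volume x, b.integral_normed]

/-- Jensen's inequality for a mollification. -/
theorem norm_mollify_sq_le (hu : LocallyIntegrable u)
    (hu2 : LocallyIntegrable fun t => ‖u t‖ ^ 2) (x : ℂ × ℂ) :
    ‖mollify b u x‖ ^ 2 ≤ ∫ t, ‖u t‖ ^ 2 * b.normed volume (x - t) := by
  set c := mollify b u x with hc
  have hT := isTest_normed_sub b x
  have ck : Continuous fun t => b.normed volume (x - t) :=
    b.continuous_normed.comp (continuous_const.sub continuous_id)
  have hk : HasCompactSupport fun t => b.normed volume (x - t) :=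
    b.hasCompactSupport_normed.comp_homeomorph (Homeomorph.subLeft x)
  have i1 : Integrable fun t => ‖u t‖ ^ 2 * b.normed volume (x - t) :=
    hu2.integrable_smul_right_of_hasCompactSupport ck hk
  have i2 : Integrable fun t => u t * (b.normed volume (x - t) : ℂ) :=
    integrable_mul_test hu hT.1.continuous hT.2
  have i3 : Integrable fun t => b.normed volume (x - t) :=
    ck.integrable_of_hasCompactSupport hk
  have i4 : Integrable fun t => (conj c * (u t * (b.normed volume (x - t) : ℂ))).re :=
    (i2.const_mul _).re
  have e1 : ∫ t, (conj c * (u t * (b.normed volume (x - t) : ℂ))).re = ‖c‖ ^ 2 := by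
    have := integral_re (i2.const_mul (conj c))
    simp only [RCLike.re_to_complex] at this
    rw [this, integral_const_mul, ← mollify_apply, ← hc, Complex.conj_mul', ← Complex.ofReal_pow,
      Complex.ofReal_re]
  -- The integrand dominates |u(t) - c|² times the kernel, with c the mean value; since the kernel
  -- has mass one, the integral is ∫ |u|²ρ - |c|².
  have h0 : 0 ≤ ∫ t, (‖u t‖ ^ 2 * b.normed volume (x - t) -
      2 * (conj c * (u t * (b.normed volume (x - t) : ℂ))).re +
      ‖c‖ ^ 2 * b.normed volume (x - t)) := by
    refine integral_nonneg fun t => ?_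
    have h1 : (conj c * (u t * (b.normed volume (x - t) : ℂ))).re ≤
        ‖c‖ * ‖u t‖ * b.normed volume (x - t) := by
      refine (Complex.re_le_norm _).trans_eq ?_
      rw [norm_mul, norm_mul, Complex.norm_real, Real.norm_eq_abs,
        abs_of_nonneg (b.nonneg_normed _), RCLike.norm_conj, mul_assoc]
    have h2 := mul_nonneg (sq_nonneg (‖u t‖ - ‖c‖)) (b.nonneg_normed (μ := volume) (x - t))
    simp only [Pi.zero_apply]
    nlinarith
  have i5 : Integrable fun t => ‖u t‖ ^ 2 * b.normed volume (x - t) -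
      2 * (conj c * (u t * (b.normed volume (x - t) : ℂ))).re := i1.sub (i4.const_mul 2)
  rw [integral_add i5 (i3.const_mul _), integral_sub i1 (i4.const_mul 2), integral_const_mul,
    integral_const_mul, e1, integral_normed_sub] at h0
  linarith

end Mollify

/-! ### Coercivity on compactly supported forms -/

/-- A sequence of bump functions shrinking to the origin. -/
def bumpSeq (n : ℕ) : ContDiffBump (0 : ℂ × ℂ) where
  rIn := 1 / (n + 1) / 2
  rOut := 1 / (n + 1)
  rIn_pos := by positivity
  rIn_lt_rOut := half_lt_self (by positivity)

section BumpSeq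

/-- Lebesgue differentiation; the fixed ratio 2 of outer to inner radius keeps the kernels
comparable to averages over balls. -/
theorem ae_tendsto_integral_bumpSeq {E : Type*} [NormedAddCommGroup E] [NormedSpace ℝ E]
    [CompleteSpace E] {g : ℂ × ℂ → E} (hg : LocallyIntegrable g) :
    ∀ᵐ x, Tendsto (fun n => ∫ t, (bumpSeq n).normed volume (x - t) • g t) atTop (𝓝 (g x)) := by
  have h := ContDiffBump.ae_convolution_tendsto_right_of_locallyIntegrable (φ := bumpSeq)
    (l := atTop) (K := 2) (g := g) (μ := volume) tendsto_one_div_add_atTop_nhds_zero_nat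
    (.of_forall fun n => by simp only [bumpSeq]; linarith) hg
  filter_upwards [h] with x hx
  simpa only [convolution_eq_swap, ContinuousLinearMap.lsmul_apply] using hx

theorem ae_tendsto_mollify {u : ℂ × ℂ → ℂ} (hu : LocallyIntegrable u) :
    ∀ᵐ x, Tendsto (fun n => mollify (bumpSeq n) u x) atTop (𝓝 (u x)) := by
  filter_upwards [ae_tendsto_integral_bumpSeq hu] with x hx
  simpa only [mollify_apply, Complex.real_smul, mul_comm] using hx

/-- All radii are at most 1, so a single compact set carries every mollification, and ∇φ is bounded
there uniformly in n. -/
theorem mollify_eq_zero {u : ℂ × ℂ → ℂ} (n : ℕ) {x : ℂ × ℂ}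
    (hx : x ∉ tsupport u + Metric.closedBall (0 : ℂ × ℂ) 1) : mollify (bumpSeq n) u x = 0 := by
  by_contra h
  have h1 := support_convolution_subset (ContinuousLinearMap.mul ℝ ℂ) (μ := volume)
    (f := u) (g := fun x => ((bumpSeq n).normed volume x : ℂ)) (Function.mem_support.2 h)
  obtain ⟨y, hy, z, hz, rfl⟩ := Set.mem_add.1 h1
  refine hx (Set.add_mem_add (subset_tsupport _ hy) ?_)
  have h2 : z ∈ Function.support ((bumpSeq n).normed volume) := fun h0 => hz (by simp [h0])
  rw [(bumpSeq n).support_normed_eq, Metric.mem_ball] at h2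
  refine Metric.mem_closedBall.2 (h2.le.trans ?_)
  simp only [bumpSeq]
  rw [div_le_one (by positivity)]
  linarith [n.cast_nonneg (α := ℝ)]

theorem integrable_integral_mul_normed (b : ContDiffBump (0 : ℂ × ℂ)) {F : ℂ × ℂ → ℝ}
    (hF : Integrable F) : Integrable fun x => ∫ t, F t * b.normed volume (x - t) :=
  hF.integrable_convolution (ContinuousLinearMap.mul ℝ ℝ) b.integrable_normed

theorem integral_integral_mul_normed (b : ContDiffBump (0 : ℂ × ℂ)) {F : ℂ × ℂ → ℝ}
    (hF : Integrable F) : ∫ x, ∫ t, F t * b.normed volume (x - t) = ∫ x, F x := by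
  have h := integral_convolution (ContinuousLinearMap.mul ℝ ℝ) (μ := volume) (ν := volume) hF
    (b.integrable_normed (μ := volume))
  rw [b.integral_normed] at h
  simpa [convolution_def] using h

end BumpSeq

theorem dbar_mollify_eq (b : ContDiffBump (0 : ℂ × ℂ)) {u₁ u₂ g : ℂ × ℂ → ℂ}
    (h₁ : LocallyIntegrable u₁) (h₂ : LocallyIntegrable u₂)
    (hg : ∀ ψ, IsTest ψ → ∫ t, (u₂ t * dbarDir (1, 0) ψ t - u₁ t * dbarDir (0, 1) ψ t) =
      -∫ t, g t * ψ t) (x : ℂ × ℂ) :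
    dbarDir (1, 0) (mollify b u₂) x - dbarDir (0, 1) (mollify b u₁) x = mollify b g x := by
  have hT := isTest_normed_sub b x
  have h := hg _ hT
  rw [integral_sub (integrable_mul_test h₂ (hT.dbarDir _).1.continuous (hT.dbarDir _).2)
    (integrable_mul_test h₁ (hT.dbarDir _).1.continuous (hT.dbarDir _).2)] at h
  rw [dbarDir_mollify b h₁, dbarDir_mollify b h₂, mollify_apply]
  linear_combination -h

theorem div_mollify_eq (b : ContDiffBump (0 : ℂ × ℂ)) {u₁ u₂ v : ℂ × ℂ → ℂ}
    (h₁ : LocallyIntegrable u₁) (h₂ : LocallyIntegrable u₂)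
    (hv : ∀ ψ, IsTest ψ → ∫ t, (u₁ t * dDir (1, 0) ψ t + u₂ t * dDir (0, 1) ψ t) =
      ∫ t, v t * ψ t) (x : ℂ × ℂ) :
    -dDir (1, 0) (mollify b u₁) x - dDir (0, 1) (mollify b u₂) x = mollify b v x := by
  have hT := isTest_normed_sub b x
  have h := hv _ hT
  rw [integral_add (integrable_mul_test h₁ (hT.dDir _).1.continuous (hT.dDir _).2)
    (integrable_mul_test h₂ (hT.dDir _).1.continuous (hT.dDir _).2)] at h
  rw [dDir_mollify b h₁, dDir_mollify b h₂, mollify_apply]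
  linear_combination h

/-- The pointwise energy of a form in terms of its weak derivatives: `g = ∂̄u` and
`v = ∂̄*_φ u - 2 ∑ⱼ φⱼ uⱼ`. -/
def weakDensity (φ : ℂ × ℂ → ℝ) (u₁ u₂ g v : ℂ × ℂ → ℂ) (q : ℂ × ℂ) : ℝ :=
  ‖g q‖ ^ 2 + ‖v q + 2 * grad φ (1, 0) q * u₁ q + 2 * grad φ (0, 1) q * u₂ q‖ ^ 2

/-- Since the weak equations have constant coefficients they commute exactly with mollification. The
gradient of φ multiplies the mollified form, so no commutator error appears. -/
theorem energyDensity_mollify {φ : ℂ × ℂ → ℝ} (b : ContDiffBump (0 : ℂ × ℂ))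
    {u₁ u₂ g v : ℂ × ℂ → ℂ} (h₁ : LocallyIntegrable u₁) (h₂ : LocallyIntegrable u₂)
    (hg : ∀ ψ, IsTest ψ → ∫ t, (u₂ t * dbarDir (1, 0) ψ t - u₁ t * dbarDir (0, 1) ψ t) =
      -∫ t, g t * ψ t)
    (hv : ∀ ψ, IsTest ψ → ∫ t, (u₁ t * dDir (1, 0) ψ t + u₂ t * dDir (0, 1) ψ t) =
      ∫ t, v t * ψ t) :
    energyDensity φ (mollify b u₁) (mollify b u₂) =
      weakDensity φ (mollify b u₁) (mollify b u₂) (mollify b g) (mollify b v) := by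
  funext q
  rw [energyDensity, weakDensity, dbar_mollify_eq b h₁ h₂ hg, ← div_mollify_eq b h₁ h₂ hv]
  simp only [delta]
  congr 3
  ring

theorem weakDensity_le {φ : ℂ × ℂ → ℝ} {u₁ u₂ g v : ℂ × ℂ → ℂ} {q : ℂ × ℂ} {M : ℝ}
    (h₁ : ‖grad φ (1, 0) q * u₁ q‖ ≤ M * ‖u₁ q‖) (h₂ : ‖grad φ (0, 1) q * u₂ q‖ ≤ M * ‖u₂ q‖) :
    weakDensity φ u₁ u₂ g v q ≤
      ‖g q‖ ^ 2 + 3 * ‖v q‖ ^ 2 + 12 * M ^ 2 * ‖u₁ q‖ ^ 2 + 12 * M ^ 2 * ‖u₂ q‖ ^ 2 := by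
  unfold weakDensity
  have h3 : ‖v q + 2 * grad φ (1, 0) q * u₁ q + 2 * grad φ (0, 1) q * u₂ q‖ ≤
      ‖v q‖ + 2 * (M * ‖u₁ q‖) + 2 * (M * ‖u₂ q‖) := by
    refine (norm_add₃_le).trans ?_
    rw [mul_assoc, mul_assoc, norm_mul, norm_mul 2, Complex.norm_ofNat]
    linarith
  have h4 := pow_le_pow_left₀ (norm_nonneg _) h3 2
  nlinarith [sq_nonneg (‖v q‖ - 2 * (M * ‖u₁ q‖)), sq_nonneg (‖v q‖ - 2 * (M * ‖u₂ q‖)),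
    sq_nonneg (2 * (M * ‖u₁ q‖) - 2 * (M * ‖u₂ q‖))]

theorem exp_neg_modelWeight_le_one (Γ : Finset (ℕ × ℕ)) (q : ℂ × ℂ) :
    Real.exp (-2 * modelWeight Γ q) ≤ 1 :=
  Real.exp_le_one_iff.2 (by linarith [modelWeight_nonneg Γ q])

/-- Mollification carries the test form inequality over. The energy densities need not have a common
integrable majorant, but Jensen's inequality bounds them by mollifications of one integrable F, all
with the same integral as F. -/
theorem lintegral_growth_le_of_hasCompactSupport {Γ : Finset (ℕ × ℕ)} {K : ℝ} (hK0 : 0 ≤ K)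
    (hK : ∀ u₁ u₂ : ℂ × ℂ → ℂ, IsTest u₁ → IsTest u₂ →
      ∫ q, growth Γ q ^ 2 * (‖u₁ q‖ ^ 2 + ‖u₂ q‖ ^ 2) * Real.exp (-2 * modelWeight Γ q) ≤
        K * testEnergy Γ u₁ u₂) {u₁ u₂ g v : ℂ × ℂ → ℂ}
    (h₁ : MemLp u₁ 2) (h₂ : MemLp u₂ 2) (h₃ : MemLp g 2) (h₄ : MemLp v 2)
    (s₁ : HasCompactSupport u₁) (s₂ : HasCompactSupport u₂)
    (hg : ∀ ψ, IsTest ψ → ∫ t, (u₂ t * dbarDir (1, 0) ψ t - u₁ t * dbarDir (0, 1) ψ t) =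
      -∫ t, g t * ψ t)
    (hv : ∀ ψ, IsTest ψ → ∫ t, (u₁ t * dDir (1, 0) ψ t + u₂ t * dDir (0, 1) ψ t) =
      ∫ t, v t * ψ t) :
    ∫⁻ q, .ofReal (growth Γ q ^ 2 * (‖u₁ q‖ ^ 2 + ‖u₂ q‖ ^ 2) *
        Real.exp (-2 * modelWeight Γ q)) ≤
      ∫⁻ q, .ofReal (K * (weakDensity (modelWeight Γ) u₁ u₂ g v q *
        Real.exp (-2 * modelWeight Γ q))) := by
  have hφ := contDiff_modelWeight Γ
  have l₁ := h₁.locallyIntegrable one_le_two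
  have l₂ := h₂.locallyIntegrable one_le_two
  have l₃ := h₃.locallyIntegrable one_le_two
  have l₄ := h₄.locallyIntegrable one_le_two
  have q₁ := h₁.integrable_norm_pow two_ne_zero
  have q₂ := h₂.integrable_norm_pow two_ne_zero
  have q₃ := h₃.integrable_norm_pow two_ne_zero
  have q₄ := h₄.integrable_norm_pow two_ne_zero
  set S := (tsupport u₁ + Metric.closedBall (0 : ℂ × ℂ) 1) ∪
    (tsupport u₂ + Metric.closedBall (0 : ℂ × ℂ) 1) with hS
  have cS : IsCompact S := (s₁.isCompact.add (isCompact_closedBall _ _)).union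
    (s₂.isCompact.add (isCompact_closedBall _ _))
  obtain ⟨M₁, hM₁⟩ := cS.exists_bound_of_continuousOn
    (contDiff_grad (1, 0) hφ).continuous.continuousOn
  obtain ⟨M₂, hM₂⟩ := cS.exists_bound_of_continuousOn
    (contDiff_grad (0, 1) hφ).continuous.continuousOn
  set M := max M₁ M₂ with hM
  set F : ℂ × ℂ → ℝ := fun q => K * (‖g q‖ ^ 2 + 3 * ‖v q‖ ^ 2 + 12 * M ^ 2 * ‖u₁ q‖ ^ 2 +
    12 * M ^ 2 * ‖u₂ q‖ ^ 2) with hF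
  have iF : Integrable F :=
    (((q₃.add (q₄.const_mul 3)).add (q₁.const_mul _)).add (q₂.const_mul _)).const_mul K
  have t₁ := fun n => isTest_mollify (bumpSeq n) l₁ s₁
  have t₂ := fun n => isTest_mollify (bumpSeq n) l₂ s₂
  have cg := (continuous_growth (Γ := Γ)).pow 2
  have cexp := continuous_exp_modelWeight (Γ := Γ)
  have en := fun n => energyDensity_mollify (φ := modelWeight Γ) (bumpSeq n) l₁ l₂ hg hv
  have iA : ∀ n, Integrable fun q => growth Γ q ^ 2 * (‖mollify (bumpSeq n) u₁ q‖ ^ 2 +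
      ‖mollify (bumpSeq n) u₂ q‖ ^ 2) * Real.exp (-2 * modelWeight Γ q) := fun n =>
    (((t₁ n).integrable_norm_sq (cg.mul cexp)).add
      ((t₂ n).integrable_norm_sq (cg.mul cexp))).congr
      (.of_forall fun q => by simp only [Pi.add_apply, Pi.mul_apply, Pi.pow_apply]; ring)
  have iB := fun n => (integrable_energyDensity (Γ := Γ) (t₁ n) (t₂ n)).const_mul K
  have ed0 : ∀ n q, 0 ≤ K * (energyDensity (modelWeight Γ) (mollify (bumpSeq n) u₁)
      (mollify (bumpSeq n) u₂) q * Real.exp (-2 * modelWeight Γ q)) := fun n q => by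
    unfold energyDensity
    positivity
  have a0 : ∀ n q, 0 ≤ growth Γ q ^ 2 * (‖mollify (bumpSeq n) u₁ q‖ ^ 2 +
      ‖mollify (bumpSeq n) u₂ q‖ ^ 2) * Real.exp (-2 * modelWeight Γ q) := fun n q => by
    positivity
  refine lintegral_limit_le (F := F)
    (An := fun n q => growth Γ q ^ 2 * (‖mollify (bumpSeq n) u₁ q‖ ^ 2 +
      ‖mollify (bumpSeq n) u₂ q‖ ^ 2) * Real.exp (-2 * modelWeight Γ q))
    (Bn := fun n q => K * (energyDensity (modelWeight Γ) (mollify (bumpSeq n) u₁)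
      (mollify (bumpSeq n) u₂) q * Real.exp (-2 * modelWeight Γ q)))
    (Fn := fun n q => ∫ t, F t * (bumpSeq n).normed volume (q - t))
    a0 ed0 (fun n => .of_forall fun q => ?_)
    (fun n => (iA n).aestronglyMeasurable) (fun n => (iB n).aestronglyMeasurable)
    (fun n => integrable_integral_mul_normed _ iF) iF (fun n => ?_)
    (fun n => (integral_integral_mul_normed _ iF).le) ?_ ?_ ?_
  -- The bound M is only available on S; off S both sides vanish.
  · have z : ∀ (e : ℂ × ℂ) (u : ℂ × ℂ → ℂ),
        (∀ x ∈ S, ‖grad (modelWeight Γ) e x‖ ≤ M) → tsupport u + Metric.closedBall 0 1 ⊆ S →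
        ‖grad (modelWeight Γ) e q * mollify (bumpSeq n) u q‖ ≤
          M * ‖mollify (bumpSeq n) u q‖ := fun e u he hu => by
      by_cases hq : q ∈ S
      · rw [norm_mul]
        gcongr
        exact he q hq
      · rw [mollify_eq_zero n fun h => hq (hu h)]
        simp
    have b₁ := z (1, 0) u₁ (fun x hx => (hM₁ x hx).trans (le_max_left _ _))
      Set.subset_union_left
    have b₂ := z (0, 1) u₂ (fun x hx => (hM₂ x hx).trans (le_max_right _ _))
      Set.subset_union_right
    have j₁ := norm_mollify_sq_le (bumpSeq n) l₁ q₁.locallyIntegrable q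
    have j₂ := norm_mollify_sq_le (bumpSeq n) l₂ q₂.locallyIntegrable q
    have j₃ := norm_mollify_sq_le (bumpSeq n) l₃ q₃.locallyIntegrable q
    have j₄ := norm_mollify_sq_le (bumpSeq n) l₄ q₄.locallyIntegrable q
    have ck : Continuous fun t => (bumpSeq n).normed volume (q - t) :=
      (bumpSeq n).continuous_normed.comp (continuous_const.sub continuous_id)
    have hk : HasCompactSupport fun t => (bumpSeq n).normed volume (q - t) :=
      (bumpSeq n).hasCompactSupport_normed.comp_homeomorph (Homeomorph.subLeft q)
    have r : ∀ {f : ℂ × ℂ → ℝ}, Integrable f →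
        Integrable fun t => f t * (bumpSeq n).normed volume (q - t) := fun hf =>
      hf.locallyIntegrable.integrable_smul_right_of_hasCompactSupport ck hk
    have e : ∫ t, F t * (bumpSeq n).normed volume (q - t) =
        K * ((∫ t, ‖g t‖ ^ 2 * (bumpSeq n).normed volume (q - t)) +
        3 * (∫ t, ‖v t‖ ^ 2 * (bumpSeq n).normed volume (q - t)) +
        12 * M ^ 2 * (∫ t, ‖u₁ t‖ ^ 2 * (bumpSeq n).normed volume (q - t)) +
        12 * M ^ 2 * (∫ t, ‖u₂ t‖ ^ 2 * (bumpSeq n).normed volume (q - t))) := by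
      have i3 := r q₃
      have i4 := (r q₄).const_mul 3
      have i1 := (r q₁).const_mul (12 * M ^ 2)
      have i2 := (r q₂).const_mul (12 * M ^ 2)
      have i34 := i3.add i4
      have i341 := i34.add i1
      simp only [Pi.add_def] at i34 i341
      rw [← integral_const_mul, ← integral_const_mul (12 * M ^ 2),
        ← integral_const_mul (12 * M ^ 2), ← integral_add i3 i4, ← integral_add i34 i1, ← integral_add i341 i2, ← integral_const_mul]
      congr 1
      funext t
      rw [hF]
      ring
    rw [e]
    refine mul_le_mul_of_nonneg_left ?_ hK0
    have hw := weakDensity_le (φ := modelWeight Γ) (g := mollify (bumpSeq n) g)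
      (v := mollify (bumpSeq n) v) b₁ b₂
    rw [en]
    have hw0 : 0 ≤ weakDensity (modelWeight Γ) (mollify (bumpSeq n) u₁) (mollify (bumpSeq n) u₂)
        (mollify (bumpSeq n) g) (mollify (bumpSeq n) v) q := by
      unfold weakDensity
      positivity
    have hM2 : 0 ≤ 12 * M ^ 2 := by positivity
    calc _ ≤ _ := mul_le_of_le_one_right hw0 (exp_neg_modelWeight_le_one Γ q)
      _ ≤ _ := hw
      _ ≤ _ := by gcongr
  · rw [← ofReal_integral_eq_lintegral_ofReal (iA n) (.of_forall (a0 n)),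
      ← ofReal_integral_eq_lintegral_ofReal (iB n) (.of_forall (ed0 n)), integral_const_mul]
    exact ENNReal.ofReal_le_ofReal (hK _ _ (t₁ n) (t₂ n))
  · filter_upwards [ae_tendsto_mollify l₁, ae_tendsto_mollify l₂] with x c₁ c₂
    exact (((c₁.norm.pow 2).add (c₂.norm.pow 2)).const_mul _).mul_const _
  · filter_upwards [ae_tendsto_mollify l₁, ae_tendsto_mollify l₂, ae_tendsto_mollify l₃,
      ae_tendsto_mollify l₄] with x c₁ c₂ c₃ c₄
    simp only [en]
    unfold weakDensity
    exact (((c₃.norm.pow 2).add ((((c₄.add (c₁.const_mul _)).add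
      (c₂.const_mul _)).norm).pow 2)).mul_const _).const_mul K
  · filter_upwards [ae_tendsto_integral_bumpSeq iF.locallyIntegrable] with x hx
    simpa only [smul_eq_mul, mul_comm] using hx

/-! ### Integrals against the weight -/

section WeightMeasure

variable {φ : C(ℂ × ℂ, ℝ)}

theorem integral_weightMeasure (F : ℂ × ℂ → ℂ) :
    ∫ p, F p ∂(weightMeasure φ) = ∫ p, F p * expWeight φ p := by
  rw [weightMeasure, integral_withDensity_eq_integral_toReal_smul (by fun_prop) (by simp)]
  congr 1
  funext p
  rw [ENNReal.toReal_ofReal (Real.exp_pos _).le, expWeight_eq_ofReal, Complex.real_smul, mul_comm]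

theorem lintegral_weightMeasure {F : ℂ × ℂ → ℝ} (hF : ∀ p, 0 ≤ F p) :
    ∫⁻ p, .ofReal (F p) ∂(weightMeasure φ) = ∫⁻ p, .ofReal (F p * Real.exp (-2 * φ p)) := by
  rw [weightMeasure,
    lintegral_withDensity_eq_lintegral_mul_non_measurable _ (by fun_prop) (by simp)]
  congr 1
  funext p
  rw [Pi.mul_apply, mul_comm, ← ENNReal.ofReal_mul (hF p)]

theorem integrable_weightMeasure_iff {F : ℂ × ℂ → ℝ} :
    Integrable F (weightMeasure φ) ↔ Integrable fun p => F p * Real.exp (-2 * φ p) := by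
  rw [weightMeasure, integrable_withDensity_iff_integrable_smul' (by fun_prop) (by simp)]
  refine integrable_congr (.of_forall fun p => ?_)
  simp only
  rw [ENNReal.toReal_ofReal (Real.exp_pos _).le, smul_eq_mul, mul_comm]

theorem integrable_norm_sq_L2 (f : L2 φ) :
    Integrable fun p => ‖f p‖ ^ 2 * Real.exp (-2 * φ p) :=
  integrable_weightMeasure_iff.1 ((Lp.memLp f).integrable_norm_pow two_ne_zero)

theorem aestronglyMeasurable_L2 (f : L2 φ) : AEStronglyMeasurable f volume :=
  (locallyIntegrable_L2 f).aestronglyMeasurable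

theorem ofReal_norm_sq (f : L2 φ) :
    ENNReal.ofReal (‖f‖ ^ 2) = ∫⁻ p, .ofReal (‖f p‖ ^ 2 * Real.exp (-2 * φ p)) := by
  rw [← lintegral_weightMeasure fun p => sq_nonneg _,
    ← ofReal_integral_eq_lintegral_ofReal ((Lp.memLp f).integrable_norm_pow two_ne_zero)
      (.of_forall fun p => sq_nonneg _)]
  congr 1
  have h : (inner ℂ f f : ℂ) = ((∫ p, ‖f p‖ ^ 2 ∂(weightMeasure φ) : ℝ) : ℂ) := by
    rw [L2.inner_def, ← integral_complex_ofReal]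
    congr 1
    funext p
    rw [inner_self_eq_norm_sq_to_K]
    simp
  rw [inner_self_eq_norm_sq_to_K] at h
  exact Complex.ofReal_injective ((Complex.ofReal_pow _ _).trans h)

/-- On the support of χ the factor e^{2φ} is bounded, so localization passes from the weighted to
the unweighted space, where mollification takes place. -/
theorem memLp_mul_test (f : L2 φ) {χ : ℂ × ℂ → ℂ} (hχ : IsTest χ) :
    MemLp (fun p => χ p * f p) 2 := by
  have cχ := hχ.1.continuous
  have hm : AEStronglyMeasurable (fun p => χ p * f p) volume :=
    cχ.aestronglyMeasurable.mul (aestronglyMeasurable_L2 f)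
  rw [memLp_two_iff_integrable_sq_norm hm]
  have hk : Continuous fun p => ‖χ p‖ ^ 2 * Real.exp (2 * φ p) := by fun_prop
  have hk' : HasCompactSupport fun p => ‖χ p‖ ^ 2 * Real.exp (2 * φ p) :=
    HasCompactSupport.mul_right (hχ.2.comp_left (g := fun z : ℂ => ‖z‖ ^ 2) (by simp))
  have hl : LocallyIntegrable (fun p => ‖f p‖ ^ 2 * Real.exp (-2 * φ p)) volume :=
    (integrable_norm_sq_L2 f).locallyIntegrable
  have hi := hl.integrable_smul_right_of_hasCompactSupport hk hk'
  refine hi.congr (.of_forall fun p => ?_)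
  have h : Real.exp (-2 * φ p) * Real.exp (2 * φ p) = 1 := by
    rw [← Real.exp_add, neg_mul, neg_add_cancel, Real.exp_zero]
  simp only [smul_eq_mul, norm_mul, mul_pow]
  linear_combination (‖χ p‖ ^ 2 * ‖f p‖ ^ 2) * h

end WeightMeasure

/-! ### The weak form of the adjoint equation -/

section Adjoint

variable {φ : C(ℂ × ℂ, ℝ)}

theorem IsTest.memLp {h : ℂ × ℂ → ℂ} (hh : IsTest h) : MemLp h 2 (weightMeasure φ) :=
  hh.1.continuous.memLp_of_hasCompactSupport hh.2

theorem pair_toLp {h : ℂ × ℂ → ℂ} (hh : MemLp h 2 (weightMeasure φ)) (χ : ℂ × ℂ → ℂ) :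
    pair (hh.toLp : L2 φ) χ = ∫ p, h p * χ p := by
  refine integral_congr_ae ?_
  filter_upwards [(volume_ac_weightMeasure φ).ae_le hh.coeFn_toLp] with p hp
  rw [hp]

theorem test_mem_graph {h : ℂ × ℂ → ℂ} (hh : IsTest h) :
    ((hh.memLp.toLp : L2 φ), (WithLp.toLp 2 ![((hh.dbarDir (1, 0)).memLp.toLp : L2 φ),
      ((hh.dbarDir (0, 1)).memLp.toLp : L2 φ)] : L2Form φ)) ∈ (dbar0 φ).graph := by
  rw [dbar0_graph]
  intro ψ hψ
  simp only [Matrix.cons_val_zero, Matrix.cons_val_one, pair_toLp]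
  rw [← dzbar_eq, ← dwbar_eq]
  exact ⟨integral_mul_dzbar hh hψ, integral_mul_dwbar hh hψ⟩

theorem inner_toLp (f : L2 φ) {h : ℂ × ℂ → ℂ} (hh : MemLp h 2 (weightMeasure φ)) :
    inner ℂ f (hh.toLp : L2 φ) = ∫ p, h p * conj (f p) * expWeight φ p := by
  rw [L2.inner_def, integral_weightMeasure]
  refine integral_congr_ae ?_
  filter_upwards [(volume_ac_weightMeasure φ).ae_le hh.coeFn_toLp] with p hp
  rw [hp, RCLike.inner_apply]

/-- Only the easy half of the adjoint is needed: test functions lie in the domain of ∂̄, so the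
adjoint relation may be tested on them. -/
theorem integral_dbarStar (u : (dbarStar φ).domain) {h : ℂ × ℂ → ℂ} (hh : IsTest h) :
    ∫ p, conj (h p) * dbarStar φ u p * expWeight φ p =
      (∫ p, conj (dbarDir (1, 0) h p) * (u : L2Form φ) 0 p * expWeight φ p) +
        ∫ p, conj (dbarDir (0, 1) h p) * (u : L2Form φ) 1 p * expWeight φ p := by
  obtain ⟨x, hx, hx'⟩ := (LinearPMap.mem_graph_iff _).1 (test_mem_graph (φ := φ) hh)
  have key := LinearPMap.adjoint_isFormalAdjoint (dbar0_dense φ) u x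
  rw [hx, hx', inner_toLp, PiLp.inner_apply, Fin.sum_univ_two] at key
  simp only [Matrix.cons_val_zero, Matrix.cons_val_one, inner_toLp] at key
  have := congrArg conj key
  rw [map_add, ← integral_conj, ← integral_conj, ← integral_conj] at this
  simp only [map_mul, Complex.conj_conj, conj_expWeight] at this
  exact this

/-- Testing with the conjugate of θ e^{2φ} cancels the weight and leaves an unweighted equation; the
derivative of the exponential gives the gradient terms. -/
theorem integral_dbarStar_mul (hφ : ContDiff ℝ ∞ φ) (u : (dbarStar φ).domain) {θ : ℂ × ℂ → ℂ}
    (hθ : IsTest θ) :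
    ∫ p, dbarStar φ u p * θ p =
      (∫ p, (u : L2Form φ) 0 p * (dDir (1, 0) θ p + 2 * grad φ (1, 0) p * θ p)) +
        ∫ p, (u : L2Form φ) 1 p * (dDir (0, 1) θ p + 2 * grad φ (0, 1) p * θ p) := by
  have cE : ContDiff ℝ ∞ fun p => Complex.exp (2 * (φ p : ℂ)) :=
    (contDiff_const.mul (contDiff_ofReal hφ)).cexp
  have hT : IsTest fun p => θ p * Complex.exp (2 * (φ p : ℂ)) := hθ.mul_right cE
  have hW : ∀ p, Complex.exp (2 * (φ p : ℂ)) * expWeight φ p = 1 := fun p => by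
    rw [expWeight, ← Complex.exp_add]
    simp
  have key := integral_dbarStar u hT.conj
  have hd : ∀ e p, conj (dbarDir e (fun q => conj (θ q * Complex.exp (2 * (φ q : ℂ)))) p) =
      (dDir e θ p + 2 * grad φ e p * θ p) * Complex.exp (2 * (φ p : ℂ)) := fun e p => by
    rw [dbarDir_conj, Complex.conj_conj, dDir_mul e p (hθ.1.differentiable (by simp) p)
      (cE.differentiable (by simp) p), dDir_exp e p 2 (hφ.differentiable (by simp) p)]
    ring
  simp only [hd, Complex.conj_conj] at key
  convert key using 2
  · funext p
    linear_combination (-(θ p * dbarStar φ u p)) * hW p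
  · congr 1
    funext p
    linear_combination (-((u : L2Form φ) 0 p *
      (dDir (1, 0) θ p + 2 * grad φ (1, 0) p * θ p))) * hW p
  · congr 1
    funext p
    linear_combination (-((u : L2Form φ) 1 p *
      (dDir (0, 1) θ p + 2 * grad φ (0, 1) p * θ p))) * hW p

theorem pair_dbar1 (u : (dbar1 φ).domain) {ψ : ℂ × ℂ → ℂ} (hψ : IsTest ψ) :
    (∫ p, (u : L2Form φ) 1 p * dbarDir (1, 0) ψ p) - ∫ p, (u : L2Form φ) 0 p * dbarDir (0, 1) ψ p =
      -∫ p, dbar1 φ u p * ψ p := by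
  have h := (dbar1 φ).mem_graph u
  rw [dbar1_graph] at h
  have h2 := h ψ hψ
  rw [dzbar_eq, dwbar_eq] at h2
  exact h2

end Adjoint

/-! ### Cut-off functions -/

/-- Smooth cut-off functions, equal to one on large balls. -/
def cutoff (k : ℕ) (p : ℂ × ℂ) : ℂ :=
  ((⟨1, 2, one_pos, one_lt_two⟩ : ContDiffBump (0 : ℂ × ℂ)) ((1 / ((k : ℝ) + 1)) • p) : ℝ)

section Cutoff

theorem isTest_cutoff (k : ℕ) : IsTest (cutoff k) := by
  set b : ContDiffBump (0 : ℂ × ℂ) := ⟨1, 2, one_pos, one_lt_two⟩ with hb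
  have hk : (1 / ((k : ℝ) + 1)) ≠ 0 := by positivity
  refine ⟨Complex.ofRealCLM.contDiff.comp (b.contDiff.comp (contDiff_const_smul _)), ?_⟩
  have h1 : HasCompactSupport fun p => ((b p : ℝ) : ℂ) :=
    b.hasCompactSupport.comp_left (g := fun x : ℝ => (x : ℂ)) Complex.ofReal_zero
  exact h1.comp_homeomorph (Homeomorph.smulOfNeZero _ hk)

theorem norm_cutoff_le (k : ℕ) (p : ℂ × ℂ) : ‖cutoff k p‖ ≤ 1 := by
  rw [cutoff, Complex.norm_real, Real.norm_eq_abs, abs_of_nonneg (ContDiffBump.nonneg _)]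
  exact ContDiffBump.le_one _

theorem tendsto_cutoff (p : ℂ × ℂ) : Tendsto (fun k => cutoff k p) atTop (𝓝 1) := by
  have h := tendsto_one_div_add_atTop_nhds_zero_nat (𝕜 := ℝ)
  have h2 : Tendsto (fun k : ℕ => (1 / ((k : ℝ) + 1)) • p) atTop (𝓝 0) := by
    simpa using h.smul_const p
  refine tendsto_const_nhds.congr' ?_
  filter_upwards [h2 (Metric.closedBall_mem_nhds _ one_pos)] with k hk
  rw [cutoff, ContDiffBump.one_of_mem_closedBall _ hk, Complex.ofReal_one]

theorem cutoff_eq (k : ℕ) : cutoff k = fun p => cutoff 0 ((1 / ((k : ℝ) + 1)) • p) := by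
  funext p
  simp [cutoff]

/-- The cut-offs are dilates of one function, so their derivatives are O(1/(k + 1)) uniformly on ℂ².
-/
theorem fderiv_cutoff (k : ℕ) (p v : ℂ × ℂ) :
    fderiv ℝ (cutoff k) p v =
      (1 / ((k : ℝ) + 1) : ℝ) * fderiv ℝ (cutoff 0) ((1 / ((k : ℝ) + 1)) • p) v := by
  rw [cutoff_eq, fderiv_comp_smul]
  simp

theorem exists_norm_fderiv_cutoff_le : ∃ C : ℝ, 0 ≤ C ∧ ∀ (k : ℕ) (p v : ℂ × ℂ),
    ‖fderiv ℝ (cutoff k) p v‖ ≤ C * (1 / ((k : ℝ) + 1)) * ‖v‖ := by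
  obtain ⟨C, hC⟩ := ((isTest_cutoff 0).2.fderiv (𝕜 := ℝ)).exists_bound_of_continuous
    ((isTest_cutoff 0).1.continuous_fderiv (by simp))
  refine ⟨C, (norm_nonneg _).trans (hC 0), fun k p v => ?_⟩
  have h1 : (0 : ℝ) ≤ 1 / ((k : ℝ) + 1) := by positivity
  rw [fderiv_cutoff, norm_mul, Complex.norm_real, Real.norm_eq_abs, abs_of_nonneg h1]
  have h2 := ((fderiv ℝ (cutoff 0) ((1 / ((k : ℝ) + 1)) • p)).le_opNorm v).trans
    (mul_le_mul_of_nonneg_right (hC _) (norm_nonneg v))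
  calc _ ≤ 1 / ((k : ℝ) + 1) * (C * ‖v‖) := by gcongr
    _ = _ := by ring

theorem exists_norm_dir_cutoff_le (e : ℂ × ℂ) : ∃ C : ℝ, 0 ≤ C ∧ ∀ (k : ℕ) (p : ℂ × ℂ),
    ‖dbarDir e (cutoff k) p‖ ≤ C * (1 / ((k : ℝ) + 1)) ∧
      ‖dDir e (cutoff k) p‖ ≤ C * (1 / ((k : ℝ) + 1)) := by
  obtain ⟨C, hC0, hC⟩ := exists_norm_fderiv_cutoff_le
  refine ⟨C * ‖e‖, by positivity, fun k p => ?_⟩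
  have h1 := hC k p e
  have h2 := hC k p (Complex.I • e)
  rw [norm_smul, Complex.norm_I, one_mul] at h2
  have h3 : ‖Complex.I * fderiv ℝ (cutoff k) p (Complex.I • e)‖ ≤
      C * (1 / ((k : ℝ) + 1)) * ‖e‖ := by rwa [norm_mul, Complex.norm_I, one_mul]
  constructor
  · rw [dbarDir, norm_mul]
    have := norm_add_le (fderiv ℝ (cutoff k) p e)
      (Complex.I * fderiv ℝ (cutoff k) p (Complex.I • e))
    norm_num at this ⊢
    norm_num at h1 h3
    linarith
  · rw [dDir, norm_mul]
    have := norm_sub_le (fderiv ℝ (cutoff k) p e)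
      (Complex.I * fderiv ℝ (cutoff k) p (Complex.I • e))
    norm_num at this ⊢
    norm_num at h1 h3
    linarith

end Cutoff

/-! ### Localization of forms in the energy domain -/

section Localize

variable {φ : C(ℂ × ℂ, ℝ)}

theorem integrable_L2_mul_test (f : L2 φ) {k : ℂ × ℂ → ℂ} (hk : IsTest k) :
    Integrable fun p => f p * k p :=
  integrable_mul_test (locallyIntegrable_L2 f) hk.1.continuous hk.2

/-- The product rule in weak form: the equation for u is tested with χψ, which moves the cut-off
from the test function to u. -/
theorem integral_cutoff_dbar1 (u : (dbar1 φ).domain) {χ ψ : ℂ × ℂ → ℂ} (hχ : IsTest χ)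
    (hψ : IsTest ψ) :
    ∫ t, (χ t * (u : L2Form φ) 1 t * dbarDir (1, 0) ψ t -
        χ t * (u : L2Form φ) 0 t * dbarDir (0, 1) ψ t) =
      -∫ t, (χ t * dbar1 φ u t + (dbarDir (1, 0) χ t * (u : L2Form φ) 1 t -
        dbarDir (0, 1) χ t * (u : L2Form φ) 0 t)) * ψ t := by
  have hT := hψ.mul_left hχ.1
  have key := pair_dbar1 u hT
  have i1 := integrable_L2_mul_test ((u : L2Form φ) 1) (hT.dbarDir (1, 0))
  have i0 := integrable_L2_mul_test ((u : L2Form φ) 0) (hT.dbarDir (0, 1))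
  have ig := integrable_L2_mul_test (dbar1 φ u) hT
  have i10 : Integrable fun p => (u : L2Form φ) 1 p * dbarDir (1, 0) (fun q => χ q * ψ q) p -
      (u : L2Form φ) 0 p * dbarDir (0, 1) (fun q => χ q * ψ q) p := i1.sub i0
  have j1 := integrable_L2_mul_test ((u : L2Form φ) 1) (hψ.mul_left (hχ.dbarDir (1, 0)).1)
  have j0 := integrable_L2_mul_test ((u : L2Form φ) 0) (hψ.mul_left (hχ.dbarDir (0, 1)).1)
  have j10 : Integrable fun p => (u : L2Form φ) 1 p * (dbarDir (1, 0) χ p * ψ p) -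
      (u : L2Form φ) 0 p * (dbarDir (0, 1) χ p * ψ p) := j1.sub j0
  have dm : ∀ e p, dbarDir e (fun q => χ q * ψ q) p =
      dbarDir e χ p * ψ p + χ p * dbarDir e ψ p := fun e p =>
    dbarDir_mul e p (hχ.1.differentiable (by simp) p) (hψ.1.differentiable (by simp) p)
  have e1 : ∀ t, χ t * (u : L2Form φ) 1 t * dbarDir (1, 0) ψ t -
      χ t * (u : L2Form φ) 0 t * dbarDir (0, 1) ψ t =
      ((u : L2Form φ) 1 t * dbarDir (1, 0) (fun q => χ q * ψ q) t -
      (u : L2Form φ) 0 t * dbarDir (0, 1) (fun q => χ q * ψ q) t) -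
      ((u : L2Form φ) 1 t * (dbarDir (1, 0) χ t * ψ t) -
      (u : L2Form φ) 0 t * (dbarDir (0, 1) χ t * ψ t)) := fun t => by rw [dm, dm]; ring
  have e2 : ∀ t, (χ t * dbar1 φ u t + (dbarDir (1, 0) χ t * (u : L2Form φ) 1 t -
      dbarDir (0, 1) χ t * (u : L2Form φ) 0 t)) * ψ t = dbar1 φ u t * (χ t * ψ t) +
      ((u : L2Form φ) 1 t * (dbarDir (1, 0) χ t * ψ t) -
      (u : L2Form φ) 0 t * (dbarDir (0, 1) χ t * ψ t)) := fun t => by ring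
  simp only [e1, e2]
  rw [integral_sub i10 j10, integral_add ig j10, integral_sub i1 i0, key]
  ring

/-- The zeroth order part of the localized adjoint equation. -/
def localAdjoint (u : (dbarStar φ).domain) (χ : ℂ × ℂ → ℂ) (t : ℂ × ℂ) : ℂ :=
  χ t * dbarStar φ u t - (dDir (1, 0) χ t * (u : L2Form φ) 0 t +
    dDir (0, 1) χ t * (u : L2Form φ) 1 t)

theorem integral_cutoff_dbarStar (hφ : ContDiff ℝ ∞ φ) (u : (dbarStar φ).domain)
    {χ ψ : ℂ × ℂ → ℂ} (hχ : IsTest χ) (hψ : IsTest ψ) :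
    ∫ t, (χ t * (u : L2Form φ) 0 t * dDir (1, 0) ψ t +
        χ t * (u : L2Form φ) 1 t * dDir (0, 1) ψ t) =
      ∫ t, (localAdjoint u χ t - (2 * grad φ (1, 0) t * χ t * (u : L2Form φ) 0 t +
        2 * grad φ (0, 1) t * χ t * (u : L2Form φ) 1 t)) * ψ t := by
  have hT := hψ.mul_left hχ.1
  have key := integral_dbarStar_mul hφ u hT
  have hG : ∀ e, IsTest fun p => dDir e (fun q => χ q * ψ q) p +
      2 * grad φ e p * (χ p * ψ p) := fun e =>
    (hT.dDir e).add (hT.mul_left (contDiff_const.mul (contDiff_grad e hφ)))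
  have hH : ∀ e, IsTest fun p => dDir e χ p * ψ p + 2 * grad φ e p * (χ p * ψ p) := fun e =>
    (hψ.mul_left (hχ.dDir e).1).add (hT.mul_left (contDiff_const.mul (contDiff_grad e hφ)))
  have i0 := integrable_L2_mul_test ((u : L2Form φ) 0) (hG (1, 0))
  have i1 := integrable_L2_mul_test ((u : L2Form φ) 1) (hG (0, 1))
  have ig := integrable_L2_mul_test (dbarStar φ u) hT
  have j0 := integrable_L2_mul_test ((u : L2Form φ) 0) (hH (1, 0))
  have j1 := integrable_L2_mul_test ((u : L2Form φ) 1) (hH (0, 1))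
  have i01 := i0.add i1
  have j01 := j0.add j1
  simp only [Pi.add_def] at i01 j01
  have dm : ∀ e p, dDir e (fun q => χ q * ψ q) p =
      dDir e χ p * ψ p + χ p * dDir e ψ p := fun e p =>
    dDir_mul e p (hχ.1.differentiable (by simp) p) (hψ.1.differentiable (by simp) p)
  have e1 : ∀ t, χ t * (u : L2Form φ) 0 t * dDir (1, 0) ψ t +
      χ t * (u : L2Form φ) 1 t * dDir (0, 1) ψ t =
      ((u : L2Form φ) 0 t * (dDir (1, 0) (fun q => χ q * ψ q) t +
        2 * grad φ (1, 0) t * (χ t * ψ t)) +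
      (u : L2Form φ) 1 t * (dDir (0, 1) (fun q => χ q * ψ q) t +
        2 * grad φ (0, 1) t * (χ t * ψ t))) -
      ((u : L2Form φ) 0 t * (dDir (1, 0) χ t * ψ t + 2 * grad φ (1, 0) t * (χ t * ψ t)) +
      (u : L2Form φ) 1 t * (dDir (0, 1) χ t * ψ t + 2 * grad φ (0, 1) t * (χ t * ψ t))) :=
    fun t => by rw [dm, dm]; ring
  have e2 : ∀ t, (localAdjoint u χ t - (2 * grad φ (1, 0) t * χ t * (u : L2Form φ) 0 t +
      2 * grad φ (0, 1) t * χ t * (u : L2Form φ) 1 t)) * ψ t = dbarStar φ u t * (χ t * ψ t) -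
      ((u : L2Form φ) 0 t * (dDir (1, 0) χ t * ψ t + 2 * grad φ (1, 0) t * (χ t * ψ t)) +
      (u : L2Form φ) 1 t * (dDir (0, 1) χ t * ψ t + 2 * grad φ (0, 1) t * (χ t * ψ t))) :=
    fun t => by rw [localAdjoint]; ring
  simp only [e1, e2]
  rw [integral_sub i01 j01, integral_sub ig j01, integral_add i0 i1, key]

end Localize

/-! ### Removing the cut-off -/

theorem norm_add_sub_sq_le {x y z : ℂ} {X Y Z : ℝ} (hx : ‖x‖ ≤ X) (hy : ‖y‖ ≤ Y) (hz : ‖z‖ ≤ Z) :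
    ‖x + (y - z)‖ ^ 2 ≤ 3 * (X ^ 2 + Y ^ 2 + Z ^ 2) ∧
      ‖x - (y + z)‖ ^ 2 ≤ 3 * (X ^ 2 + Y ^ 2 + Z ^ 2) := by
  have key : ∀ w : ℂ, ‖w‖ ≤ X + Y + Z → ‖w‖ ^ 2 ≤ 3 * (X ^ 2 + Y ^ 2 + Z ^ 2) := fun w hw => by
    have := pow_le_pow_left₀ (norm_nonneg _) hw 2
    nlinarith [sq_nonneg (X - Y), sq_nonneg (X - Z), sq_nonneg (Y - Z)]
  constructor
  · refine key _ ?_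
    linarith [norm_add_le x (y - z), norm_sub_le y z]
  · refine key _ ?_
    linarith [norm_sub_le x (y + z), norm_add_le y z]

/-- The compactly supported inequality is applied to `cutoff k` times u. Cutting off perturbs ∂̄u
and ∂̄*u only by derivatives of the cut-off times u, which tend to zero with an integrable majorant.
-/
theorem lintegral_growth_le_energy {Γ : Finset (ℕ × ℕ)} {K : ℝ} (hK0 : 0 ≤ K)
    (hK : ∀ u₁ u₂ : ℂ × ℂ → ℂ, IsTest u₁ → IsTest u₂ →
      ∫ q, growth Γ q ^ 2 * (‖u₁ q‖ ^ 2 + ‖u₂ q‖ ^ 2) * Real.exp (-2 * modelWeight Γ q) ≤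
        K * testEnergy Γ u₁ u₂) {u : L2Form (modelWeight Γ)}
    (h1 : u ∈ (dbar1 (modelWeight Γ)).domain) (h2 : u ∈ (dbarStar (modelWeight Γ)).domain) :
    ∫⁻ q, .ofReal (growth Γ q ^ 2 * (‖u 0 q‖ ^ 2 + ‖u 1 q‖ ^ 2) *
        Real.exp (-2 * modelWeight Γ q)) ≤ .ofReal (K * (‖dbar1 (modelWeight Γ) ⟨u, h1⟩‖ ^ 2 +
        ‖dbarStar (modelWeight Γ) ⟨u, h2⟩‖ ^ 2)) := by
  have hφ := contDiff_modelWeight Γ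
  set g := dbar1 (modelWeight Γ) ⟨u, h1⟩
  set us : (dbarStar (modelWeight Γ)).domain := ⟨u, h2⟩
  set h := dbarStar (modelWeight Γ) us
  obtain ⟨C₁, hC₁, hC₁'⟩ := exists_norm_dir_cutoff_le (1, 0)
  obtain ⟨C₂, hC₂, hC₂'⟩ := exists_norm_dir_cutoff_le (0, 1)
  have small : ∀ k : ℕ, 1 / ((k : ℝ) + 1) ≤ 1 := fun k => by
    rw [div_le_one (by positivity)]
    linarith [k.cast_nonneg (α := ℝ)]
  have lim0 := tendsto_one_div_add_atTop_nhds_zero_nat (𝕜 := ℝ)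
  set G : ℕ → ℂ × ℂ → ℂ := fun k t => cutoff k t * g t +
    (dbarDir (1, 0) (cutoff k) t * u 1 t - dbarDir (0, 1) (cutoff k) t * u 0 t) with hG
  set V : ℕ → ℂ × ℂ → ℂ := fun k t => localAdjoint us (cutoff k) t -
    (2 * grad (modelWeight Γ) (1, 0) t * cutoff k t * u 0 t +
      2 * grad (modelWeight Γ) (0, 1) t * cutoff k t * u 1 t) with hV
  have mG : ∀ k, MemLp (G k) 2 := fun k =>
    (memLp_mul_test g (isTest_cutoff k)).add
      ((memLp_mul_test (u 1) ((isTest_cutoff k).dbarDir (1, 0))).sub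
        (memLp_mul_test (u 0) ((isTest_cutoff k).dbarDir (0, 1))))
  have mV : ∀ k, MemLp (V k) 2 := fun k =>
    ((memLp_mul_test h (isTest_cutoff k)).sub
      ((memLp_mul_test (u 0) ((isTest_cutoff k).dDir (1, 0))).add
        (memLp_mul_test (u 1) ((isTest_cutoff k).dDir (0, 1))))).sub
      ((memLp_mul_test (u 0) ((isTest_cutoff k).mul_left
        (contDiff_const.mul (contDiff_grad (1, 0) hφ)))).add
      (memLp_mul_test (u 1) ((isTest_cutoff k).mul_left
        (contDiff_const.mul (contDiff_grad (0, 1) hφ)))))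
  -- The unbounded terms containing ∇φ cancel, so the density is bounded uniformly in k by an
  -- integrable function.
  have wd : ∀ k q, weakDensity (modelWeight Γ) (fun t => cutoff k t * u 0 t)
      (fun t => cutoff k t * u 1 t)
      (G k) (V k) q = ‖G k q‖ ^ 2 + ‖localAdjoint us (cutoff k) q‖ ^ 2 := fun k q => by
    rw [weakDensity, hV]
    congr 3
    ring
  have loc := fun k => lintegral_growth_le_of_hasCompactSupport hK0 hK
    (memLp_mul_test (u 0) (isTest_cutoff k)) (memLp_mul_test (u 1) (isTest_cutoff k)) (mG k) (mV k)
    (isTest_cutoff k).2.mul_right (isTest_cutoff k).2.mul_right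
    (fun ψ hψ => integral_cutoff_dbar1 ⟨u, h1⟩ (isTest_cutoff k) hψ)
    (fun ψ hψ => integral_cutoff_dbarStar hφ us (isTest_cutoff k) hψ)
  have q0 := integrable_norm_sq_L2 (u 0)
  have q1 := integrable_norm_sq_L2 (u 1)
  have qg := integrable_norm_sq_L2 g
  have qh := integrable_norm_sq_L2 h
  -- A majorant independent of k: the cut-offs are at most 1 and their derivatives at most C₁, C₂ in
  -- the two directions.
  set F : ℂ × ℂ → ℝ := fun q => K * ((3 * (‖g q‖ ^ 2 + (C₁ * ‖u 1 q‖) ^ 2 + (C₂ * ‖u 0 q‖) ^ 2) +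
    3 * (‖h q‖ ^ 2 + (C₁ * ‖u 0 q‖) ^ 2 + (C₂ * ‖u 1 q‖) ^ 2)) *
      Real.exp (-2 * modelWeight Γ q)) with hF
  have iF : Integrable F :=
    ((((qg.add qh).const_mul (3 * K)).add (q0.const_mul (3 * K * (C₁ ^ 2 + C₂ ^ 2)))).add
      (q1.const_mul (3 * K * (C₁ ^ 2 + C₂ ^ 2)))).congr
      (.of_forall fun q => by simp only [Pi.add_apply, hF]; ring)
  have cexp := continuous_exp_modelWeight (Γ := Γ)
  have cg := (continuous_growth (Γ := Γ)).pow 2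
  have am : ∀ {f₁ f₂ : ℂ × ℂ → ℂ}, AEStronglyMeasurable f₁ volume →
      AEStronglyMeasurable f₂ volume →
      AEStronglyMeasurable (fun q => ‖f₁ q‖ ^ 2 + ‖f₂ q‖ ^ 2) volume := fun h₁ h₂ =>
    (h₁.norm.pow 2).add (h₂.norm.pow 2)
  have aL : ∀ k, AEStronglyMeasurable (localAdjoint us (cutoff k)) volume := fun k =>
    (memLp_mul_test h (isTest_cutoff k)).1.sub
      ((memLp_mul_test (u 0) ((isTest_cutoff k).dDir (1, 0))).1.add
        (memLp_mul_test (u 1) ((isTest_cutoff k).dDir (0, 1))).1)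
  have a0 : ∀ (k : ℕ) (q : ℂ × ℂ), 0 ≤ growth Γ q ^ 2 * (‖cutoff k q * u 0 q‖ ^ 2 +
      ‖cutoff k q * u 1 q‖ ^ 2) * Real.exp (-2 * modelWeight Γ q) := fun _ _ => by positivity
  have b0 : ∀ (k : ℕ) (q : ℂ × ℂ), 0 ≤ K * ((‖G k q‖ ^ 2 + ‖localAdjoint us (cutoff k) q‖ ^ 2) *
      Real.exp (-2 * modelWeight Γ q)) := fun _ _ => by positivity
  have main : ∫⁻ q, .ofReal (growth Γ q ^ 2 * (‖u 0 q‖ ^ 2 + ‖u 1 q‖ ^ 2) *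
      Real.exp (-2 * modelWeight Γ q)) ≤
      ∫⁻ q, .ofReal (K * ((‖g q‖ ^ 2 + ‖h q‖ ^ 2) * Real.exp (-2 * modelWeight Γ q))) := by
    refine lintegral_limit_le (F := F) (Fn := fun _ => F)
      (An := fun k q => growth Γ q ^ 2 * (‖cutoff k q * u 0 q‖ ^ 2 + ‖cutoff k q * u 1 q‖ ^ 2) *
        Real.exp (-2 * modelWeight Γ q))
      (Bn := fun k q => K * ((‖G k q‖ ^ 2 + ‖localAdjoint us (cutoff k) q‖ ^ 2) *
        Real.exp (-2 * modelWeight Γ q)))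
      a0 b0 (fun k => .of_forall fun q => ?_)
      (fun k => ?_) (fun k => ?_) (fun _ => iF) iF (fun k => ?_) (fun _ => le_refl (∫ q, F q))
      (.of_forall fun q => ?_) (.of_forall fun q => ?_) (.of_forall fun q => tendsto_const_nhds)
    · have d₁ := hC₁' k q
      have d₂ := hC₂' k q
      have b : ∀ {x C : ℝ} (y : ℝ), 0 ≤ C → 0 ≤ y → x ≤ C * (1 / ((k : ℝ) + 1)) → x * y ≤ C * y :=
        fun y hC hy hx => mul_le_mul_of_nonneg_right
          (hx.trans (mul_le_of_le_one_right hC (small k))) hy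
      have b0 : ∀ x : ℂ, ‖cutoff k q * x‖ ≤ ‖x‖ := fun x => by
        rw [norm_mul]
        exact mul_le_of_le_one_left (norm_nonneg x) (norm_cutoff_le k q)
      have k1 := (norm_add_sub_sq_le (b0 (g q))
        ((norm_mul _ _).trans_le (b ‖u 1 q‖ hC₁ (norm_nonneg _) d₁.1))
        ((norm_mul _ _).trans_le (b ‖u 0 q‖ hC₂ (norm_nonneg _) d₂.1))).1
      have k2 := (norm_add_sub_sq_le (b0 (h q))
        ((norm_mul _ _).trans_le (b ‖u 0 q‖ hC₁ (norm_nonneg _) d₁.2))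
        ((norm_mul _ _).trans_le (b ‖u 1 q‖ hC₂ (norm_nonneg _) d₂.2))).2
      exact mul_le_mul_of_nonneg_left (mul_le_mul_of_nonneg_right (add_le_add k1 k2)
        (Real.exp_pos _).le) hK0
    · exact (cg.aestronglyMeasurable.mul (am (memLp_mul_test (u 0) (isTest_cutoff k)).1
        (memLp_mul_test (u 1) (isTest_cutoff k)).1)).mul cexp.aestronglyMeasurable
    · exact ((am (mG k).1 (aL k)).mul cexp.aestronglyMeasurable).const_mul K
    · have := loc k
      simp only [wd] at this
      exact this
    · have c := tendsto_cutoff q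
      have c0 := (c.mul_const (u 0 q)).norm.pow 2
      have c1 := (c.mul_const (u 1 q)).norm.pow 2
      simp only [one_mul] at c0 c1
      exact ((c0.add c1).const_mul _).mul_const _
    · have z : ∀ {C : ℝ} {f : ℕ → ℂ}, (∀ k, ‖f k‖ ≤ C * (1 / ((k : ℝ) + 1))) →
          Tendsto f atTop (𝓝 0) := fun hf =>
        squeeze_zero_norm hf (by simpa using lim0.const_mul _)
      have c := tendsto_cutoff q
      have cG : Tendsto (fun k => G k q) atTop (𝓝 (g q)) := by
        simpa using (c.mul_const (g q)).add (((z fun k => (hC₁' k q).1).mul_const (u 1 q)).sub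
          ((z fun k => (hC₂' k q).1).mul_const (u 0 q)))
      have cL : Tendsto (fun k => localAdjoint us (cutoff k) q) atTop (𝓝 (h q)) := by
        unfold localAdjoint
        simpa using (c.mul_const (h q)).sub (((z fun k => (hC₁' k q).2).mul_const (u 0 q)).add
          ((z fun k => (hC₂' k q).2).mul_const (u 1 q)))
      exact (((cG.norm.pow 2).add (cL.norm.pow 2)).mul_const _).const_mul K
  refine main.trans_eq ?_
  rw [ENNReal.ofReal_mul hK0, ENNReal.ofReal_add (sq_nonneg _)
    (sq_nonneg _), ofReal_norm_sq, ofReal_norm_sq, ← lintegral_add_left'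
    qg.aestronglyMeasurable.aemeasurable.ennreal_ofReal, ← lintegral_const_mul' _ _ (by simp)]
  refine lintegral_congr fun q => ?_
  rw [ENNReal.ofReal_mul hK0, ← ENNReal.ofReal_add (by positivity) (by positivity), add_mul]

end WeightedKohn

end

/-! ### Coercivity on the form domain -/

theorem mainTheorem1 (Γ : Finset (ℕ × ℕ)) (hΓ : WeightedKohn.IsHomogeneous Γ) :
    ∃ c : ℝ, 0 < c ∧
      WeightedKohn.IsCoercive (WeightedKohn.modelWeight Γ)
        (fun p : ℂ × ℂ => c * (1 + ‖p.1‖ ^ (WeightedKohn.sigma Γ : ℝ) +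
          ‖p.2‖ ^ (WeightedKohn.tau Γ : ℝ))) := by
  obtain ⟨K, hK0, hK⟩ := WeightedKohn.exists_integral_growth_le hΓ
  -- The constant must satisfy c²K ≤ 1; since K ≥ 0 gives K ≤ (K + 1)², this choice works even for K
  -- = 0 and avoids a square root.
  refine ⟨(K + 1)⁻¹, by positivity, fun u => ?_⟩
  have key := WeightedKohn.lintegral_growth_le_energy hK0 hK u.2.1 u.2.2
  have hE : 0 ≤ WeightedKohn.energy (WeightedKohn.modelWeight Γ) u := by
    unfold WeightedKohn.energy
    positivity
  rw [WeightedKohn.mulNormSq, WeightedKohn.lintegral_weightMeasure fun p => by positivity]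
  calc _ = ∫⁻ q, ENNReal.ofReal ((K + 1)⁻¹ ^ 2) * .ofReal (WeightedKohn.growth Γ q ^ 2 *
        (‖(u : WeightedKohn.L2Form (WeightedKohn.modelWeight Γ)) 0 q‖ ^ 2 +
          ‖(u : WeightedKohn.L2Form (WeightedKohn.modelWeight Γ)) 1 q‖ ^ 2) *
        Real.exp (-2 * WeightedKohn.modelWeight Γ q)) := by
        refine lintegral_congr fun q => ?_
        rw [← ENNReal.ofReal_mul (by positivity), WeightedKohn.growth]
        congr 1
        ring
    _ ≤ ENNReal.ofReal ((K + 1)⁻¹ ^ 2) *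
        .ofReal (K * WeightedKohn.energy (WeightedKohn.modelWeight Γ) u) := by
        rw [lintegral_const_mul' _ _ (by simp)]
        exact mul_le_mul_right key _
    _ ≤ _ := by
        rw [← ENNReal.ofReal_mul (by positivity)]
        refine ENNReal.ofReal_le_ofReal ?_
        rw [← mul_assoc]
        refine mul_le_of_le_one_left hE ?_
        rw [inv_pow, inv_mul_le_iff₀ (by positivity)]
        nlinarith
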